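/- **Setting.** Fix $\gamma>0$. Let $e:[0,\infty)\to(0,1]$ belong to the class $\mathcal R_\gamma$, that is, with $\eta_e(r):=r\,e(r)$: * $e$ is non-increasing on $[0,\infty)$ and differentiable on $(0,\infty)$, $\eta_e$ is strictly increasing, and $\lim_{r\to\infty}e(r)\in[0,1)$; * there are $\mathfrak a_0,\mathfrak b_0>0$ and $\overline\gamma>\frac32\gamma$ with $|e(r)-1+\mathfrak a_0r^\gamma|\le \mathfrak b_0r^{\overline\gamma}$ for all $r\ge 0$; * there are $\alpha,c,C>0$ with $\eta_e'(r)\ge c\,e(r)^\alpha$ and $|\eta_e'(r)-e(r)|\le C|1-e(r)|$ for all $r>0$; * there is $m>0$ with $\limsup_{z\to\infty}z^{-m}\eta_e^{-1}(z)<\infty$ (in particular $\eta_e^{-1}(z)$ exists for all large $z$). Let $b\in W^{1,1}((-1,1))$ be nonnegative with $\int_{\mathbb S^2}b(\sigma\cdot\widehat z)\,d\sigma=1$ for every $\widehat z\in\mathbb S^2$. For $v,v_*\in\mathbb R^3$ and $\sigma\in\mathbb S^2$ put $u=v-v_*$, $\widehat u=u/|u|$ and $$v'=v+\tfrac14\Big(1+e\Big(|u|\sqrt{\tfrac{1-\widehat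 u\cdot\sigma}{2}}\Big)\Big)(|u|\sigma-u).$$ The gain operator $\mathcal Q^+_e(f,g)$ is the function, unique up to null sets, for which $$\int_{\mathbb R^3}\mathcal Q^+_e(f,g)(v)\,\psi(v)\,dv=\int_{\mathbb R^3\times\mathbb R^3\times\mathbb S^2}f(v)\,g(v_*)\,|v-v_*|\,b(\widehat u\cdot\sigma)\,\psi(v')\,d\sigma\,dv_*\,dv$$ for all continuous compactly supported $\psi$, the integral being absolutely convergent. Write $e_\ell(r)=e(\ell r)$ for $\ell>0$, let $\mathcal Q^+_1$ be the operator for $e\equiv1$, and put $\varpi_s(v)=(1+|v|^2)^{s/2}$, $\|h\|_{L^p(\varpi_s)}=\|h\varpi_s\|_{L^p(\mathbb R^3)}$, $\|g\|_{W^{1,2}(\varpi_s)}=\|g\|_{L^2(\varpi_s)}+\||\nabla g|\|_{L^2(\varpi_s)}$ (weak gradient). **Proposition 2.6.** For every $q\ge0$ there is a constant $C>0$, depending only on $q$, $\gamma$, $e$ and $b$, such that for every $\ell>0$: 1. for all $f\in L^1(\varpi_{q+3+\gamma})$ and $g\in W^{1,2}(\varpi_{q+3+\gamma})$, the functions $\mathcal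 Q^+_{e_\ell}(f,g)$ and $\mathcal Q^+_1(f,g)$ are well defined and $$\big\|\mathcal Q^+_{e_\ell}(f,g)-\mathcal Q^+_1(f,g)\big\|_{L^2(\varpi_q)}\le C\,\ell^\gamma\,\|f\|_{L^1(\varpi_{q+3+\gamma})}\,\|g\|_{W^{1,2}(\varpi_{q+3+\gamma})};$$ 2. for all $f\in L^2(\varpi_{q+3+\gamma})$ and $g\in W^{1,2}(\varpi_{q+3+\gamma})$, the functions $\mathcal Q^+_{e_\ell}(g,f)$ and $\mathcal Q^+_1(g,f)$ are well defined and $$\big\|\mathcal Q^+_{e_\ell}(g,f)-\mathcal Q^+_1(g,f)\big\|_{L^2(\varpi_q)}\le C\,\ell^\gamma\,\|f\|_{L^2(\varpi_{q+3+\gamma})}\,\|g\|_{W^{1,2}(\varpi_{q+3+\gamma})}.$$ -/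

import Mathlib

open MeasureTheory Set Filter Topology Metric
open scoped ENNReal ContDiff RealInnerProductSpace

noncomputable section

namespace Granular

/-- Velocity space `ℝ³` with its Euclidean norm. -/
abbrev V3 : Type := EuclideanSpace ℝ (Fin 3)

/-- The unit sphere `𝕊²`. -/
abbrev S2 : Type := sphere (0 : V3) 1

/-- The surface (Lebesgue) measure on `𝕊²`, of total mass `4π`. -/
def surface : Measure S2 := (volume : Measure V3).toSphere

/-- The polynomial weight `(1 + |v|²)^(s/2)`. -/
def weight (s : ℝ) (v : V3) : ℝ := (1 + ‖v‖ ^ 2) ^ (s / 2)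

/-! Restitution coefficients -/

/-- The class `R_γ` of restitution coefficients `e : [0, ∞) → (0, 1]` (values of `e` at negative
numbers are never used). Here `r * e r` is the function `η_e`. -/
structure IsRestitution (γ : ℝ) (e : ℝ → ℝ) : Prop where
  range : ∀ r, 0 ≤ r → 0 < e r ∧ e r ≤ 1
  differentiable : ∀ r, 0 < r → DifferentiableAt ℝ e r
  antitone : AntitoneOn e (Ici 0)
  strictMono : StrictMonoOn (fun r => r * e r) (Ici 0)
  limit : ∃ e₀ : ℝ, 0 ≤ e₀ ∧ e₀ < 1 ∧ Tendsto e atTop (𝓝 e₀)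
  expansion : ∃ a₀ b₀ γ' : ℝ, 0 < a₀ ∧ 0 < b₀ ∧ 3 / 2 * γ < γ' ∧
    ∀ r, 0 ≤ r → |e r - 1 + a₀ * r ^ γ| ≤ b₀ * r ^ γ'
  jacobian_lower : ∃ α c : ℝ, 0 < α ∧ 0 < c ∧
    ∀ r, 0 < r → c * e r ^ α ≤ deriv (fun x => x * e x) r
  jacobian_close : ∃ C : ℝ, 0 < C ∧
    ∀ r, 0 < r → |deriv (fun x => x * e x) r - e r| ≤ C * |1 - e r|
  /-- `limsup_{z → ∞} z^(-m) η_e⁻¹(z) < ∞`: for large `z` the (unique) `r ≥ 0` with `η_e(r) = z`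
  exists and is at most `C z^m`. -/
  inverse_growth : ∃ m C : ℝ, 0 < m ∧ 0 < C ∧
    ∀ᶠ z : ℝ in atTop, ∃ r : ℝ, 0 ≤ r ∧ r * e r = z ∧ r ≤ C * z ^ m

/-- The rescaled coefficient `e_ℓ(r) = e(ℓ r)`. -/
def rescale (ℓ : ℝ) (e : ℝ → ℝ) : ℝ → ℝ := fun r => e (ℓ * r)

/-- The elastic coefficient, identically `1`. -/
def elastic : ℝ → ℝ := fun _ => 1

/-! Angular kernels -/

/-- `b'` is the weak derivative of `b` on the interval `(-1, 1)`. -/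
def HasWeakDeriv (b b' : ℝ → ℝ) : Prop :=
  ∀ φ : ℝ → ℝ, ContDiff ℝ ∞ φ → HasCompactSupport φ → tsupport φ ⊆ Ioo (-1) 1 →
    ∫ s in Ioo (-1 : ℝ) 1, b s * deriv φ s = -∫ s in Ioo (-1 : ℝ) 1, b' s * φ s

/-- Nonnegative angular kernels in `W^{1,1}((-1,1))` (a Borel representative is chosen), with
unit mass on the sphere. -/
structure IsAngularKernel (b : ℝ → ℝ) : Prop where
  measurable : Measurable b
  nonneg : ∀ᵐ s ∂(volume.restrict (Ioo (-1 : ℝ) 1)), 0 ≤ b s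
  integrable : IntegrableOn b (Ioo (-1 : ℝ) 1)
  weakDeriv : ∃ b' : ℝ → ℝ, IntegrableOn b' (Ioo (-1 : ℝ) 1) ∧ HasWeakDeriv b b'
  normalized : ∀ z : S2, ∫ σ : S2, b ⟪(z : V3), (σ : V3)⟫ ∂surface = 1

/-! The gain operator -/

/-- `û · σ`, the cosine of the deflection angle, where `û = u / |u|`. -/
def cosAngle (u : V3) (σ : S2) : ℝ := ⟪‖u‖⁻¹ • u, (σ : V3)⟫

/-- The impact velocity `|u| √((1 - û·σ)/2)`. -/
def impact (u : V3) (σ : S2) : ℝ := ‖u‖ * √((1 - cosAngle u σ) / 2)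

/-- The post-collisional velocity
`v' = v + (1 + e(|u| √((1 - û·σ)/2))) / 4 * (|u| σ - u)` with `u = v - v_*`. -/
def postVelocity (e : ℝ → ℝ) (v vs : V3) (σ : S2) : V3 :=
  v + ((1 + e (impact (v - vs) σ)) / 4) • (‖v - vs‖ • (σ : V3) - (v - vs))

/-- `f(v) g(v_*) |v - v_*| b(û·σ)` as a function of `((v, v_*), σ)`. -/
def collisionDensity (b : ℝ → ℝ) (f g : V3 → ℝ) (p : (V3 × V3) × S2) : ℝ :=
  f p.1.1 * g p.1.2 * ‖p.1.1 - p.1.2‖ * b (cosAngle (p.1.1 - p.1.2) p.2)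

/-- `Q` is the gain term `Q⁺_e(f,g)`: the absolutely convergent weak form
`∫ Q ψ dv = ∫∫∫ f(v) g(v_*) |v - v_*| b(û·σ) ψ(v') dσ dv_* dv` holds for every continuous
compactly supported `ψ`. -/
structure IsGain (e b : ℝ → ℝ) (f g Q : V3 → ℝ) : Prop where
  integrable : Integrable (collisionDensity b f g)
    (((volume : Measure V3).prod (volume : Measure V3)).prod surface)
  locallyIntegrable : LocallyIntegrable Q
  weakForm : ∀ ψ : V3 → ℝ, Continuous ψ → HasCompactSupport ψ →
    ∫ v, Q v * ψ v =
      ∫ p, collisionDensity b f g p * ψ (postVelocity e p.1.1 p.1.2 p.2)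
        ∂(((volume : Measure V3).prod (volume : Measure V3)).prod surface)

/-- The weak form determines the gain term up to a null set. -/
theorem IsGain.ae_eq {e b : ℝ → ℝ} {f g Q Q' : V3 → ℝ}
    (h : IsGain e b f g Q) (h' : IsGain e b f g Q') : Q =ᵐ[volume] Q' := by
  refine ae_eq_of_integral_contDiff_smul_eq h.locallyIntegrable h'.locallyIntegrable ?_
  intro ψ hψ hc
  have h1 := h.weakForm ψ hψ.continuous hc
  have h2 := h'.weakForm ψ hψ.continuous hc
  simp only [smul_eq_mul, mul_comm (ψ _)]
  rw [h1, h2]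

open Classical in
/-- The gain operator `Q⁺_e(f,g)` with angular kernel `b`: the function, unique up to null sets,
that satisfies the weak form (and `0` if there is none). -/
def gain (e b : ℝ → ℝ) (f g : V3 → ℝ) : V3 → ℝ :=
  if h : ∃ Q, IsGain e b f g Q then h.choose else 0

/-! Weighted Lebesgue and Sobolev norms -/

/-- Membership in the weighted space `L^p(weight s)`. -/
def MemLpW (p : ℝ≥0∞) (s : ℝ) (h : V3 → ℝ) : Prop :=
  MemLp (fun v => weight s v * h v) p volume

/-- The weighted norm `‖h‖_{L^p(weight s)} = ‖h · weight s‖_{L^p}`. -/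
def normLpW (p : ℝ≥0∞) (s : ℝ) (h : V3 → ℝ) : ℝ≥0∞ :=
  eLpNorm (fun v => weight s v * h v) p volume

/-- `G` is the weak gradient of `g` on `ℝ³`. -/
structure HasWeakGradient (g : V3 → ℝ) (G : V3 → V3) : Prop where
  locallyIntegrable : LocallyIntegrable g
  locallyIntegrable_grad : LocallyIntegrable G
  parts : ∀ φ : V3 → ℝ, ContDiff ℝ ∞ φ → HasCompactSupport φ → ∀ w : V3,
    ∫ v, g v * fderiv ℝ φ v w = -∫ v, ⟪G v, w⟫ * φ v

/-- Membership in the weighted Sobolev space `W^{1,2}(weight s)`. -/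
def MemW12 (s : ℝ) (g : V3 → ℝ) : Prop :=
  MemLpW 2 s g ∧ ∃ G, HasWeakGradient g G ∧ MemLp (fun v => weight s v • G v) 2 volume

/-- The weighted norm `‖g‖_{L²(weight s)} + ‖∇g‖_{L²(weight s)}` of `W^{1,2}(weight s)`; the weak
gradient is unique up to null sets, so the infimum is over a single value. -/
def normW12 (s : ℝ) (g : V3 → ℝ) : ℝ≥0∞ :=
  normLpW 2 s g +
    ⨅ (G : V3 → V3) (_ : HasWeakGradient g G), eLpNorm (fun v => weight s v • G v) 2 volume

end Granular

end

noncomputable section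

namespace Granular

/-! Write D = (1 - e)/2 for the inelasticity defect at the impact speed |u| sin(θ/2), and u± = (u ±
|u|σ)/2. Then v' = v - (1 - D)u⁻ = v_* + u⁺ + D u⁻, and the elastic collision is D = 0. By duality
(`weightNorm_le_of_dual`) it is enough to compare the two weak forms on bounded measurable ψ and to
bound the difference by the L² norm of ψ with weight exponent -q. No derivative may fall on ψ. The
elastic integral is therefore rewritten in variables in which its ψ has the same argument as in the
inelastic one; the discrepancy then sits in g, which has a gradient, and in a Jacobian.

When g is the second argument, v is kept fixed and u is dilated to (1 - D)u at constant angle, which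
carries u⁻ to (1 - D)u⁻. One compares g(v - u) with g(v - (1 - D)u) along a segment
(`HasWeakGradient.ae_enorm_sub_le`), and the Jacobian error is O(D): this is `IsDefect.compare_one`.
When g is the first argument, v_* is kept fixed and u is replaced by ũ = u + D(u⁻ - tan²(θ/2)u⁺),
the vector for which the angle is preserved and ũ⁺ = u⁺ + D u⁻. The displacement is now |u| tan(θ/2)
D, singular as θ → π, and the Jacobian is unbounded; its error is controlled by transporting it back
to the original variables: this is `IsDefect.compare_two`. In both cases D ≤ A ℓ^γ |u|^γ supplies
the rate (`IsRestitution.defect_le`), while the structural bounds on D are invariant under scaling,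
so no constant depends on ℓ (`IsRestitution.isDefect`).

None of these changes of variables is differentiated as a map of ℝ³ × 𝕊². In polar coordinates,
averaged over the orthogonal group, an integrand sees a pair of vectors only through its Gram matrix
(`orth_average_eq`). At fixed θ only the radius ρ = |u| has to be substituted (`lintegral_comb_le`
for inequalities, `lintegral_change` for identities), and `IsDefect.isRadial` bounds the cost of
that substitution by 8, 8/sin³(θ/2) or 8/cos³(θ/2), according to the velocity concerned.

What remains are trilinear integrals of functions of three velocities. Cauchy–Schwarz in (u, σ)
treats L¹ × L² × L² (`lintegral_trilinear_one`); a three-factor Hölder inequality treats L^(4/3) ×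
L^(4/3) × L² and absorbs the singular factor 1/cos(θ/2) (`lintegral_trilinear_two`). Both rest on
the integrable angular weight (1 - s²)^(-7/8). The factor |u|^(2+γ) is paid by polynomial weights;
in the second estimate the one remaining power of the weight pays for the embedding of weighted L²
into L^(4/3). The kernel b enters only through its essential bound, since W^{1,1} of an interval
lies in L^∞ (`IsAngularKernel.exists_bounded`). -/

/-! ### Averaging over the orthogonal group -/

/-- The orthogonal group of `ℝ³`, as a group of continuous linear maps. -/
abbrev Orth : Type := unitary (V3 →L[ℝ] V3)

instance : ContinuousStar (V3 →L[ℝ] V3) :=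
  ⟨(ContinuousLinearMap.adjoint : (V3 →L[ℝ] V3) ≃ₗᵢ⋆[ℝ] (V3 →L[ℝ] V3)).continuous⟩

instance : CompactSpace Orth := by
  refine isCompact_iff_compactSpace.mp ?_
  refine Metric.isCompact_of_isClosed_isBounded isClosed_unitary ?_
  refine (Metric.isBounded_closedBall (x := (0 : V3 →L[ℝ] V3)) (r := 1)).subset fun U hU => ?_
  rw [mem_closedBall_zero_iff]
  exact (CStarRing.norm_of_mem_unitary hU).le

/-- A right-invariant probability measure on the orthogonal group. -/
def orthMeasure : Measure Orth :=
  (Measure.haarMeasure (⊤ : TopologicalSpace.PositiveCompacts Orth)).inv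

/-- Inversion turns the left invariance of Haar measure into invariance under `R ↦ R * S`. This is
the side needed when `S` acts on the vectors before `R` does. -/
instance : Measure.IsMulRightInvariant orthMeasure := by
  unfold orthMeasure; infer_instance

instance : IsProbabilityMeasure orthMeasure := by
  constructor
  rw [orthMeasure, Measure.inv_apply]
  have := Measure.haarMeasure_self (K₀ := (⊤ : TopologicalSpace.PositiveCompacts Orth))
  simpa using this

theorem orth_norm (R : Orth) (x : V3) : ‖(R : V3 →L[ℝ] V3) x‖ = ‖x‖ :=
  Unitary.norm_map R x

theorem orth_inner (R : Orth) (x y : V3) :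
    ⟪(R : V3 →L[ℝ] V3) x, (R : V3 →L[ℝ] V3) y⟫ = ⟪x, y⟫ :=
  Unitary.inner_map_map R x y

theorem measurable_orth_apply :
    Measurable fun p : Orth × V3 => (p.1 : V3 →L[ℝ] V3) p.2 := by
  refine Continuous.measurable ?_
  exact (continuous_subtype_val.comp continuous_fst).clm_apply continuous_snd

/-- Two pairs of vectors with the same Gram matrix are related by an orthogonal map. -/
theorem exists_orth_pair {a b a' b' : V3} (ha : ‖a‖ = ‖a'‖) (hb : ‖b‖ = ‖b'‖)
    (hab : ⟪a, b⟫ = ⟪a', b'⟫) :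
    ∃ R : Orth, (R : V3 →L[ℝ] V3) a = a' ∧ (R : V3 →L[ℝ] V3) b = b' := by
  -- Two reflections suffice. The first sends `a` to `a'`; the second sends `r₁ b` to `b'` and fixes
  -- `a'`, because equal inner products make `a'` orthogonal to `r₁ b - b'`.
  let r₁ := Submodule.reflection (ℝ ∙ (a - a'))ᗮ
  have h₁ : r₁ a = a' := Submodule.reflection_sub ha
  let r₂ := Submodule.reflection (ℝ ∙ (r₁ b - b'))ᗮ
  have h₂ : r₂ (r₁ b) = b' := Submodule.reflection_sub (by simpa using hb)
  have h₃ : r₂ a' = a' := by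
    refine Submodule.reflection_mem_subspace_eq_self ?_
    rw [Submodule.mem_orthogonal_singleton_iff_inner_right, inner_sub_left, sub_eq_zero,
      ← h₁, r₁.inner_map_map, real_inner_comm, hab, real_inner_comm, ← h₁]
  refine ⟨Unitary.linearIsometryEquiv.symm (r₁.trans r₂), ?_, ?_⟩
  · simp [h₁, h₃]
  · simp [h₂]

/-- The Gram matrix is the only invariant of a pair of vectors under the orthogonal group, and right
invariance absorbs the map relating the two pairs. Every later statement about directions of
velocities reduces to this. -/
theorem orth_average_eq {a b a' b' : V3} (ha : ‖a‖ = ‖a'‖) (hb : ‖b‖ = ‖b'‖)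
    (hab : ⟪a, b⟫ = ⟪a', b'⟫) (F : V3 → V3 → ℝ≥0∞) :
    ∫⁻ R : Orth, F ((R : V3 →L[ℝ] V3) a) ((R : V3 →L[ℝ] V3) b) ∂orthMeasure =
      ∫⁻ R : Orth, F ((R : V3 →L[ℝ] V3) a') ((R : V3 →L[ℝ] V3) b') ∂orthMeasure := by
  obtain ⟨S, hS, hS'⟩ := exists_orth_pair ha hb hab
  have := lintegral_mul_right_eq_self (μ := orthMeasure)
    (fun R : Orth => F ((R : V3 →L[ℝ] V3) a) ((R : V3 →L[ℝ] V3) b)) S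
  rw [← this]
  refine lintegral_congr fun R => ?_
  simp [hS, hS']

/-! ### Polar coordinates -/

instance : IsFiniteMeasure surface := by
  unfold surface; infer_instance

theorem lintegral_polar {F : V3 → ℝ≥0∞} (hF : Measurable F) :
    ∫⁻ u, F u = ∫⁻ ξ : S2, (∫⁻ ρ in Ioi (0 : ℝ), ENNReal.ofReal (ρ ^ 2) * F (ρ • (ξ : V3)))
      ∂surface := by
  have h0 : MeasurableSet ({0}ᶜ : Set V3) := (measurableSet_singleton _).compl
  have e := (volume : Measure V3).measurePreserving_homeomorphUnitSphereProd
  have hG : Measurable fun p : S2 × Ioi (0 : ℝ) => F ((p.2 : ℝ) • (p.1 : V3)) := by fun_prop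
  have h1 : ∫⁻ u, F u = ∫⁻ u : ({0}ᶜ : Set V3), F u ∂((volume : Measure V3).comap Subtype.val) := by
    rw [lintegral_subtype_comap h0, restrict_compl_singleton]
  have h2 : ∫⁻ u : ({0}ᶜ : Set V3), F u ∂((volume : Measure V3).comap Subtype.val) =
      ∫⁻ p : S2 × Ioi (0 : ℝ), F ((p.2 : ℝ) • (p.1 : V3))
        ∂(surface.prod (Measure.volumeIoiPow (Module.finrank ℝ V3 - 1))) := by
    rw [surface, ← e.lintegral_comp hG]
    refine lintegral_congr fun u => ?_
    have := congrArg Subtype.val ((homeomorphUnitSphereProd V3).symm_apply_apply u)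
    rw [homeomorphUnitSphereProd_symm_apply_coe] at this
    rw [this]
  rw [h1, h2, lintegral_prod _ hG.aemeasurable]
  refine lintegral_congr fun ξ => ?_
  rw [Measure.volumeIoiPow, lintegral_withDensity_eq_lintegral_mul _ (by fun_prop) (by fun_prop)]
  simp only [Pi.mul_apply, finrank_euclideanSpace, Fintype.card_fin]
  exact lintegral_subtype_comap measurableSet_Ioi
    fun ρ : ℝ => ENNReal.ofReal (ρ ^ 2) * F (ρ • (ξ : V3))

/-- The factor 3 inverts ∫₀¹ ρ² dρ. Writing the sphere as a ball makes the rotation invariance and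
the Cartesian coordinates of Lebesgue measure available on it. -/
theorem lintegral_surface_eq {φ : V3 → ℝ≥0∞} (hφ : Measurable φ) :
    ∫⁻ σ : S2, φ σ ∂surface = 3 * ∫⁻ x in ball (0 : V3) 1, φ (‖x‖⁻¹ • x) := by
  have hm : Measurable fun x : V3 => φ (‖x‖⁻¹ • x) := by fun_prop
  rw [← lintegral_indicator measurableSet_ball, lintegral_polar (hm.indicator measurableSet_ball)]
  have h1 : ∀ ξ : S2, ∫⁻ ρ in Ioi (0 : ℝ), ENNReal.ofReal (ρ ^ 2) *
      (ball (0 : V3) 1).indicator (fun x => φ (‖x‖⁻¹ • x)) (ρ • (ξ : V3)) =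
      φ ξ * ENNReal.ofReal (1 / 3) := by
    intro ξ
    have h2 : ∫⁻ ρ in Ioo (0 : ℝ) 1, ENNReal.ofReal (ρ ^ 2) = ENNReal.ofReal (1 / 3) := by
      rw [← ofReal_integral_eq_lintegral_ofReal, ← integral_Ioc_eq_integral_Ioo,
        ← intervalIntegral.integral_of_le zero_le_one, integral_pow]
      · norm_num
      · exact ((continuous_pow 2).integrableOn_Icc).mono_set Ioo_subset_Icc_self
      · exact Filter.Eventually.of_forall fun x => by positivity
    rw [← h2, ← lintegral_const_mul _ (by fun_prop), ← lintegral_indicator measurableSet_Ioi,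
      ← lintegral_indicator measurableSet_Ioo]
    refine lintegral_congr fun ρ => ?_
    by_cases h0 : 0 < ρ
    · by_cases h1 : ρ < 1
      · rw [indicator_of_mem (show ρ ∈ Ioi 0 from h0), indicator_of_mem (show ρ ∈ Ioo 0 1 from ⟨h0, h1⟩),
          indicator_of_mem (by simpa [norm_smul, abs_of_pos h0] using h1)]
        simp [norm_smul, abs_of_pos h0, smul_smul, inv_mul_cancel₀ h0.ne', mul_comm]
      · rw [indicator_of_mem (show ρ ∈ Ioi 0 from h0),
          indicator_of_notMem (fun h : ρ ∈ Ioo 0 1 => h1 h.2),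
          indicator_of_notMem (by simpa [norm_smul, abs_of_pos h0] using h1), mul_zero]
    · rw [indicator_of_notMem (show ρ ∉ Ioi 0 from h0),
        indicator_of_notMem (fun h : ρ ∈ Ioo 0 1 => h0 h.1)]
  simp_rw [h1]
  rw [lintegral_mul_const _ (by fun_prop), mul_comm, mul_assoc, mul_comm]
  have : ENNReal.ofReal (1 / 3) * 3 = 1 := by
    rw [show (3 : ℝ≥0∞) = ENNReal.ofReal 3 by simp, ← ENNReal.ofReal_mul (by norm_num)]
    norm_num
  rw [this, one_mul]

theorem lintegral_orth (R : Orth) {F : V3 → ℝ≥0∞} (hF : Measurable F) :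
    ∫⁻ u, F ((R : V3 →L[ℝ] V3) u) = ∫⁻ u, F u := by
  exact (Unitary.linearIsometryEquiv R).measurePreserving.lintegral_comp hF

theorem lintegral_surface_orth (R : Orth) {φ : V3 → ℝ≥0∞} (hφ : Measurable φ) :
    ∫⁻ σ : S2, φ ((R : V3 →L[ℝ] V3) σ) ∂surface = ∫⁻ σ : S2, φ σ ∂surface := by
  have hm : Measurable fun x : V3 => φ (‖x‖⁻¹ • x) := by fun_prop
  rw [lintegral_surface_eq hφ, lintegral_surface_eq (φ := fun x => φ ((R : V3 →L[ℝ] V3) x))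
    (by fun_prop), ← lintegral_indicator measurableSet_ball, ← lintegral_indicator measurableSet_ball,
    ← lintegral_orth R (hm.indicator measurableSet_ball)]
  congr 1
  refine lintegral_congr fun x => ?_
  simp only [indicator, mem_ball_zero_iff, orth_norm, map_smul]

/-- Polar decomposition of the measure on `ℝ³ × 𝕊²`, averaged over the orthogonal group. -/
theorem lintegral_average {F : V3 × V3 → ℝ≥0∞} (hF : Measurable F) :
    ∫⁻ u : V3, ∫⁻ σ : S2, F (u, σ) ∂surface =
      ∫⁻ ξ : S2, ∫⁻ σ : S2, (∫⁻ ρ in Ioi (0 : ℝ), ENNReal.ofReal (ρ ^ 2) *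
        ∫⁻ R : Orth, F (ρ • (R : V3 →L[ℝ] V3) ξ, (R : V3 →L[ℝ] V3) σ) ∂orthMeasure)
          ∂surface ∂surface := by
  have hH : Measurable fun q : ((S2 × ℝ) × Orth) × S2 =>
      F (q.1.1.2 • (q.1.2 : V3 →L[ℝ] V3) q.1.1.1, (q.1.2 : V3 →L[ℝ] V3) q.2) := by
    have h1 : Measurable fun q : ((S2 × ℝ) × Orth) × S2 => (q.1.2 : V3 →L[ℝ] V3) q.1.1.1 :=
      measurable_orth_apply.comp (by fun_prop : Measurable fun q : ((S2 × ℝ) × Orth) × S2 =>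
        (q.1.2, (q.1.1.1 : V3)))
    have h2 : Measurable fun q : ((S2 × ℝ) × Orth) × S2 => (q.1.2 : V3 →L[ℝ] V3) q.2 :=
      measurable_orth_apply.comp (by fun_prop : Measurable fun q : ((S2 × ℝ) × Orth) × S2 =>
        (q.1.2, (q.2 : V3)))
    fun_prop
  have hHσ := hH.lintegral_prod_right' (ν := surface)
  -- Rotating `u` and `σ` by a common `R` does not change the integral, so it equals its own average
  -- over `R`; the rest is Tonelli.
  have h1 : ∀ R : Orth, ∫⁻ u : V3, ∫⁻ σ : S2, F (u, σ) ∂surface =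
      ∫⁻ ξ : S2, (∫⁻ ρ in Ioi (0 : ℝ), ENNReal.ofReal (ρ ^ 2) *
        ∫⁻ σ : S2, F (ρ • (R : V3 →L[ℝ] V3) ξ, (R : V3 →L[ℝ] V3) σ) ∂surface) ∂surface := by
    intro R
    have hm : Measurable fun u : V3 => ∫⁻ σ : S2, F (u, (R : V3 →L[ℝ] V3) σ) ∂surface := by
      refine Measurable.lintegral_prod_right' (ν := surface)
        (f := fun p : V3 × S2 => F (p.1, (R : V3 →L[ℝ] V3) p.2)) (by fun_prop)
    calc ∫⁻ u : V3, ∫⁻ σ : S2, F (u, σ) ∂surface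
        = ∫⁻ u : V3, ∫⁻ σ : S2, F (u, (R : V3 →L[ℝ] V3) σ) ∂surface := by
          refine lintegral_congr fun u => ?_
          exact (lintegral_surface_orth R (φ := fun σ => F (u, σ)) (by fun_prop)).symm
      _ = ∫⁻ u : V3, ∫⁻ σ : S2, F ((R : V3 →L[ℝ] V3) u, (R : V3 →L[ℝ] V3) σ) ∂surface :=
          (lintegral_orth R hm).symm
      _ = _ := by
          refine (lintegral_polar (hm.comp (R : V3 →L[ℝ] V3).continuous.measurable)).trans ?_
          simp only [Function.comp_apply, map_smul]
  have h2 : ∫⁻ u : V3, ∫⁻ σ : S2, F (u, σ) ∂surface =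
      ∫⁻ R : Orth, ∫⁻ ξ : S2, (∫⁻ ρ in Ioi (0 : ℝ), ENNReal.ofReal (ρ ^ 2) *
        ∫⁻ σ : S2, F (ρ • (R : V3 →L[ℝ] V3) ξ, (R : V3 →L[ℝ] V3) σ) ∂surface) ∂surface
          ∂orthMeasure := by
    simp_rw [← h1]
    simp
  rw [h2, lintegral_lintegral_swap]
  · refine lintegral_congr fun ξ => ?_
    rw [lintegral_lintegral_swap]
    · have h3 : ∀ ρ : ℝ, ∫⁻ R : Orth, ENNReal.ofReal (ρ ^ 2) *
          ∫⁻ σ : S2, F (ρ • (R : V3 →L[ℝ] V3) ξ, (R : V3 →L[ℝ] V3) σ) ∂surface ∂orthMeasure =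
          ∫⁻ σ : S2, ENNReal.ofReal (ρ ^ 2) * ∫⁻ R : Orth,
            F (ρ • (R : V3 →L[ℝ] V3) ξ, (R : V3 →L[ℝ] V3) σ) ∂orthMeasure ∂surface := by
        intro ρ
        have hm : Measurable fun p : Orth × S2 =>
            F (ρ • (p.1 : V3 →L[ℝ] V3) ξ, (p.1 : V3 →L[ℝ] V3) p.2) :=
          hH.comp (by fun_prop : Measurable fun p : Orth × S2 => (((ξ, ρ), p.1), p.2))
        rw [lintegral_const_mul _ hm.lintegral_prod_right', lintegral_const_mul,
          lintegral_lintegral_swap hm.aemeasurable]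
        exact hm.lintegral_prod_left'
      simp_rw [h3]
      refine lintegral_lintegral_swap ?_
      have h4 : Measurable fun q : ((S2 × ℝ) × S2) × Orth =>
          F (q.1.1.2 • (q.2 : V3 →L[ℝ] V3) q.1.1.1, (q.2 : V3 →L[ℝ] V3) q.1.2) :=
        hH.comp (by fun_prop : Measurable fun q : ((S2 × ℝ) × S2) × Orth =>
          ((q.1.1, q.2), q.1.2))
      have h5 := (h4.lintegral_prod_right' (ν := orthMeasure)).comp
        (by fun_prop : Measurable fun p : ℝ × S2 => ((ξ, p.1), p.2))
      exact ((by fun_prop : Measurable fun p : ℝ × S2 =>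
        ENNReal.ofReal (p.1 ^ 2)).mul h5).aemeasurable
    · have h5 := hHσ.comp (by fun_prop : Measurable fun p : Orth × ℝ => ((ξ, p.2), p.1))
      exact ((by fun_prop : Measurable fun p : Orth × ℝ =>
        ENNReal.ofReal (p.2 ^ 2)).mul h5).aemeasurable
  · have h5 : Measurable fun q : (Orth × S2) × ℝ => ENNReal.ofReal (q.2 ^ 2) *
        ∫⁻ σ : S2, F (q.2 • (q.1.1 : V3 →L[ℝ] V3) q.1.2, (q.1.1 : V3 →L[ℝ] V3) σ) ∂surface :=
      (by fun_prop : Measurable fun q : (Orth × S2) × ℝ => ENNReal.ofReal (q.2 ^ 2)).mul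
        (hHσ.comp (by fun_prop : Measurable fun q : (Orth × S2) × ℝ => ((q.1.2, q.2), q.1.1)))
    exact h5.lintegral_prod_right'.aemeasurable

/-! ### The distribution of the deflection angle -/

/-- On a line at distance √q from the axis, s = x/√(x² + q) is the cosine of the angle with the
axis. Here 1 - s² = q/(x² + q) and dx = √q (1 - s²)^(-3/2) ds. The ball condition x² + q < 1 reads q
< 1 - s², which also gives √q ≤ √(1 - s²). -/
theorem lintegral_line_le {q : ℝ} (hq : 0 < q) {φ : ℝ → ℝ≥0∞} :
    ∫⁻ x : ℝ, (if x ^ 2 + q < 1 then φ (x / √(x ^ 2 + q)) else 0) ≤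
      ∫⁻ s in Ioo (-1 : ℝ) 1, (if q < 1 - s ^ 2 then ENNReal.ofReal (1 / (1 - s ^ 2)) * φ s else 0) := by
  set f : ℝ → ℝ := fun x => x / √(x ^ 2 + q)
  set g : ℝ → ℝ≥0∞ := fun s => if q < 1 - s ^ 2 then
    ENNReal.ofReal (√q / ((1 - s ^ 2) * √(1 - s ^ 2))) * φ s else 0
  have hpos : ∀ x : ℝ, 0 < x ^ 2 + q := fun x => by positivity
  have hsq : ∀ x : ℝ, √(x ^ 2 + q) ^ 2 = x ^ 2 + q := fun x => Real.sq_sqrt (hpos x).le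
  have hf2 : ∀ x, 1 - f x ^ 2 = q / (x ^ 2 + q) := by
    intro x
    have := hpos x
    simp only [f, div_pow, hsq]
    field_simp
    ring
  have hd : ∀ x, HasDerivAt f (q / ((x ^ 2 + q) * √(x ^ 2 + q))) x := by
    intro x
    have h1 : HasDerivAt (fun x : ℝ => x ^ 2 + q) (2 * x) x := by
      simpa using (hasDerivAt_pow 2 x).add_const q
    have h2 := (hasDerivAt_id x).div (h1.sqrt (hpos x).ne') (Real.sqrt_pos.2 (hpos x)).ne'
    refine h2.congr_deriv ?_
    have h3 := Real.sqrt_pos.2 (hpos x)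
    have h4 := hsq x
    have h5 := hpos x
    simp only [id]
    rw [h4]
    field_simp
    rw [h4]
    ring
  have hmono : StrictMono f := by
    refine strictMono_of_deriv_pos fun x => ?_
    rw [(hd x).deriv]
    have := hpos x
    positivity
  have himg := lintegral_image_eq_lintegral_abs_deriv_mul MeasurableSet.univ
    (fun x _ => (hd x).hasDerivWithinAt) hmono.injective.injOn g
  have hsub : f '' univ ⊆ Ioo (-1) 1 := by
    rintro _ ⟨x, -, rfl⟩
    have h1 : 0 < 1 - f x ^ 2 := by rw [hf2]; have := hpos x; positivity
    exact abs_lt.1 (by rw [← sq_lt_one_iff_abs_lt_one]; linarith)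
  calc _ = ∫⁻ s in f '' univ, g s := by
        rw [himg, Measure.restrict_univ]
        refine lintegral_congr fun x => ?_
        have h5 := hpos x
        have h6 : (q < 1 - f x ^ 2) ↔ x ^ 2 + q < 1 := by
          rw [hf2, lt_div_iff₀ h5]
          constructor <;> intro h <;> nlinarith
        simp only [g, h6]
        split_ifs with h
        · rw [← mul_assoc, ← ENNReal.ofReal_mul (abs_nonneg _), hf2, abs_of_pos (by positivity),
            Real.sqrt_div hq.le]
          have h3 := Real.sqrt_pos.2 h5
          have h4 := Real.sqrt_pos.2 hq
          have : q / ((x ^ 2 + q) * √(x ^ 2 + q)) *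
              (√q / (q / (x ^ 2 + q) * (√q / √(x ^ 2 + q)))) = 1 := by
            field_simp
          rw [this]
          simp [f]
        · simp
    _ ≤ ∫⁻ s in Ioo (-1 : ℝ) 1, g s := lintegral_mono_set hsub
    _ ≤ _ := by
        refine lintegral_mono fun s => ?_
        simp only [g]
        split_ifs with h
        · gcongr ENNReal.ofReal ?_ * _
          have h1 : 0 < 1 - s ^ 2 := hq.trans h
          have h3 := Real.sqrt_pos.2 h1
          rw [div_le_div_iff₀ (by positivity) h1, one_mul, mul_comm]
          gcongr
        · simp

theorem volume_disc_le (M : ℝ) :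
    volume {y : Fin 2 → ℝ | y 0 ^ 2 + y 1 ^ 2 < M} ≤ ENNReal.ofReal (4 * M) := by
  by_cases hM : 0 < M
  · calc _ ≤ volume (Set.pi univ fun _ : Fin 2 => Ioo (-√M) (√M)) := by
          refine measure_mono fun y hy i _ => ?_
          simp only [mem_ofPred_eq] at hy
          rw [mem_Ioo, ← abs_lt]
          refine Real.lt_sqrt_of_sq_lt ?_
          rw [sq_abs]
          fin_cases i <;> simp <;> nlinarith [sq_nonneg (y 0), sq_nonneg (y 1)]
      _ = _ := by
          rw [Real.volume_pi_Ioo]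
          simp only [sub_neg_eq_add, Fin.prod_univ_two]
          rw [← ENNReal.ofReal_mul (by positivity)]
          congr 1
          nlinarith [Real.sq_sqrt hM.le]
  · have : {y : Fin 2 → ℝ | y 0 ^ 2 + y 1 ^ 2 < M} = ∅ := by
      ext y
      simp only [mem_ofPred_eq, mem_empty_iff_false, iff_false, not_lt]
      nlinarith [sq_nonneg (y 0), sq_nonneg (y 1)]
    simp [this]

/-- The cosine of the angle with a fixed direction has a bounded density on `(-1, 1)`. -/
theorem lintegral_dot_le (z : S2) {φ : ℝ → ℝ≥0∞} (hφ : Measurable φ) :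
    ∫⁻ σ : S2, φ ⟪(z : V3), (σ : V3)⟫ ∂surface ≤ 12 * ∫⁻ s in Ioo (-1 : ℝ) 1, φ s := by
  set e₀ : V3 := EuclideanSpace.single 0 1
  obtain ⟨R, hR, -⟩ := exists_orth_pair (a := (z : V3)) (a' := e₀) (b := 0) (b' := 0)
    (by simp [e₀]) rfl (by simp)
  have h1 : ∫⁻ σ : S2, φ ⟪(z : V3), (σ : V3)⟫ ∂surface = ∫⁻ σ : S2, φ ⟪e₀, (σ : V3)⟫ ∂surface := by
    rw [← lintegral_surface_orth R (φ := fun x => φ ⟪e₀, x⟫) (by fun_prop)]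
    simp_rw [← hR, orth_inner]
  rw [h1, lintegral_surface_eq (φ := fun x => φ ⟪e₀, x⟫) (by fun_prop),
    show (12 : ℝ≥0∞) = 3 * 4 by norm_num, mul_assoc]
  gcongr
  set F : ℝ × (Fin 2 → ℝ) → ℝ≥0∞ := fun p =>
    if p.1 ^ 2 + (p.2 0 ^ 2 + p.2 1 ^ 2) < 1 then φ (p.1 / √(p.1 ^ 2 + (p.2 0 ^ 2 + p.2 1 ^ 2))) else 0
  have hF : Measurable F := by
    refine Measurable.ite (measurableSet_lt (by fun_prop) (by fun_prop)) (by fun_prop) (by fun_prop)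
  have h2 : ∫⁻ x in ball (0 : V3) 1, φ ⟪e₀, ‖x‖⁻¹ • x⟫ = ∫⁻ p, F p := by
    have m1 := PiLp.volume_preserving_ofLp (Fin 3)
    have m2 := volume_preserving_piFinSuccAbove (fun _ : Fin 3 => ℝ) 0
    rw [← (m2.comp m1).lintegral_comp hF, ← lintegral_indicator measurableSet_ball]
    refine lintegral_congr fun x => ?_
    have hn : ‖x‖ = √(x 0 ^ 2 + (x 1 ^ 2 + x 2 ^ 2)) := by
      rw [EuclideanSpace.norm_eq, Fin.sum_univ_three]
      simp [add_assoc]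
    have hlt : x ∈ ball (0 : V3) 1 ↔ x 0 ^ 2 + (x 1 ^ 2 + x 2 ^ 2) < 1 := by
      rw [mem_ball_zero_iff, hn, Real.sqrt_lt' one_pos, one_pow]
    have hF' : F (((MeasurableEquiv.piFinSuccAbove (fun _ : Fin 3 => ℝ) 0) ∘ WithLp.ofLp) x) =
        if x 0 ^ 2 + (x 1 ^ 2 + x 2 ^ 2) < 1 then φ (x 0 / √(x 0 ^ 2 + (x 1 ^ 2 + x 2 ^ 2))) else 0 := by
      simp [F, MeasurableEquiv.piFinSuccAbove]
      rfl
    rw [hF']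
    by_cases hx : x ∈ ball (0 : V3) 1
    swap
    · rw [indicator_of_notMem hx, if_neg (mt hlt.2 hx)]
    rw [indicator_of_mem hx, if_pos (hlt.1 hx), ← hn]
    congr 1
    simp [e₀, inner_smul_right, EuclideanSpace.inner_single_left, div_eq_inv_mul]
  -- The axis itself, where the substitution along lines degenerates, is a null set.
  have hne : ∀ᵐ y : Fin 2 → ℝ, 0 < y 0 ^ 2 + y 1 ^ 2 := by
    filter_upwards [compl_mem_ae_iff.2 (measure_singleton (0 : Fin 2 → ℝ))] with y hy
    by_contra hcon
    refine hy ?_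
    have h0 : y 0 = 0 := by nlinarith [sq_nonneg (y 0), sq_nonneg (y 1)]
    have h1 : y 1 = 0 := by nlinarith [sq_nonneg (y 0), sq_nonneg (y 1)]
    rw [mem_singleton_iff]
    ext i
    fin_cases i <;> simp [h0, h1]
  rw [h2]
  calc ∫⁻ p, F p = ∫⁻ y : Fin 2 → ℝ, ∫⁻ x : ℝ, F (x, y) := by
        rw [Measure.volume_eq_prod, lintegral_prod_symm _ hF.aemeasurable]
    _ ≤ ∫⁻ y : Fin 2 → ℝ, ∫⁻ s in Ioo (-1 : ℝ) 1, (if y 0 ^ 2 + y 1 ^ 2 < 1 - s ^ 2 then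
          ENNReal.ofReal (1 / (1 - s ^ 2)) * φ s else 0) :=
        lintegral_mono_ae (hne.mono fun y hy => lintegral_line_le hy)
    _ = ∫⁻ s in Ioo (-1 : ℝ) 1, ∫⁻ y : Fin 2 → ℝ, (if y 0 ^ 2 + y 1 ^ 2 < 1 - s ^ 2 then
          ENNReal.ofReal (1 / (1 - s ^ 2)) * φ s else 0) := by
        refine lintegral_lintegral_swap (Measurable.aemeasurable ?_)
        exact Measurable.ite (measurableSet_lt (by fun_prop) (by fun_prop)) (by fun_prop)
          (by fun_prop)
    -- The admissible `y` form a disc of area at most 4(1 - s²), cancelling the factor 1/(1 - s²)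
    -- from the line substitution.
    _ ≤ ∫⁻ s in Ioo (-1 : ℝ) 1, 4 * φ s := by
        refine setLIntegral_mono' measurableSet_Ioo fun s hs => ?_
        have h1 : 0 < 1 - s ^ 2 := by nlinarith [hs.1, hs.2]
        have hms : MeasurableSet {y : Fin 2 → ℝ | y 0 ^ 2 + y 1 ^ 2 < 1 - s ^ 2} :=
          measurableSet_lt (by fun_prop) (by fun_prop)
        have : ∫⁻ y : Fin 2 → ℝ, (if y 0 ^ 2 + y 1 ^ 2 < 1 - s ^ 2 then
            ENNReal.ofReal (1 / (1 - s ^ 2)) * φ s else 0) =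
            ENNReal.ofReal (1 / (1 - s ^ 2)) * φ s *
              volume {y : Fin 2 → ℝ | y 0 ^ 2 + y 1 ^ 2 < 1 - s ^ 2} := by
          rw [← lintegral_indicator_const hms]
          rfl
        rw [this]
        calc _ ≤ ENNReal.ofReal (1 / (1 - s ^ 2)) * φ s * ENNReal.ofReal (4 * (1 - s ^ 2)) := by
              gcongr
              exact volume_disc_le _
          _ = ENNReal.ofReal (1 / (1 - s ^ 2) * (4 * (1 - s ^ 2))) * φ s := by
              rw [ENNReal.ofReal_mul (one_div_nonneg.2 h1.le), mul_right_comm]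
          _ = 4 * φ s := by
              congr 1
              rw [show 1 / (1 - s ^ 2) * (4 * (1 - s ^ 2)) = 4 by field_simp]
              simp
    _ = _ := lintegral_const_mul _ hφ

/-- The bounded density of the cosine, applied to the indicator of a measurable null set containing
the exceptional one. -/
theorem ae_dot {P : ℝ → Prop} (z : S2) (hP : ∀ᵐ s ∂(volume.restrict (Ioo (-1 : ℝ) 1)), P s) :
    ∀ᵐ σ : S2 ∂surface, P ⟪(z : V3), (σ : V3)⟫ := by
  rw [ae_iff] at hP ⊢
  set N := toMeasurable (volume.restrict (Ioo (-1 : ℝ) 1)) {s | ¬P s}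
  have hN : MeasurableSet N := measurableSet_toMeasurable _ _
  have hN0 : (volume.restrict (Ioo (-1 : ℝ) 1)) N = 0 := by
    rw [measure_toMeasurable, hP]
  have h1 := lintegral_dot_le z (φ := N.indicator 1) (measurable_one.indicator hN)
  rw [lintegral_indicator_one hN, hN0, mul_zero, nonpos_iff_eq_zero] at h1
  refine measure_mono_null (t := {σ : S2 | ⟪(z : V3), (σ : V3)⟫ ∈ N}) (fun σ hσ => ?_) ?_
  · exact subset_toMeasurable _ _ hσ
  · have hms : MeasurableSet {σ : S2 | ⟪(z : V3), (σ : V3)⟫ ∈ N} :=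
      hN.preimage (by fun_prop)
    rw [← lintegral_indicator_one hms]
    exact h1

/-- The angular weight `(1 - s²)^(-7/8)`. -/
def angularWeight (s : ℝ) : ℝ≥0∞ := ENNReal.ofReal ((1 - s ^ 2) ^ (-(7 / 8) : ℝ))

theorem measurable_angularWeight : Measurable angularWeight := by
  unfold angularWeight; fun_prop

/-- The exponent 7/8 is below 1, hence integrable at both endpoints; it is also the smallest
exponent that serves in `secHalf_le_weights`. -/
theorem lintegral_angularWeight_lt_top :
    ∫⁻ s in Ioo (-1 : ℝ) 1, angularWeight s < ⊤ := by
  have h0 : IntervalIntegrable (fun x : ℝ => x ^ (-(7 / 8) : ℝ)) volume 0 2 :=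
    intervalIntegral.intervalIntegrable_rpow' (by norm_num)
  have h1 : IntervalIntegrable (fun x : ℝ => (1 - x) ^ (-(7 / 8) : ℝ)) volume 1 (-1) := by
    have := h0.comp_sub_left 1
    norm_num at this
    simpa using this
  have h2 : IntervalIntegrable (fun x : ℝ => (1 + x) ^ (-(7 / 8) : ℝ)) volume (-1) 1 := by
    have := h0.comp_add_left 1
    norm_num at this
    simpa using this
  have h3 : IntegrableOn (fun x : ℝ => (1 - x) ^ (-(7 / 8) : ℝ) + (1 + x) ^ (-(7 / 8) : ℝ))
      (Ioo (-1) 1) := by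
    have := (h1.symm.add h2)
    rw [intervalIntegrable_iff_integrableOn_Ioo_of_le (by norm_num)] at this
    exact this
  refine lt_of_le_of_lt ?_ h3.lintegral_lt_top
  refine setLIntegral_mono' measurableSet_Ioo fun s hs => ENNReal.ofReal_le_ofReal ?_
  have ha : 0 < 1 - s := by linarith [hs.2]
  have hb : 0 < 1 + s := by linarith [hs.1]
  have hA := Real.rpow_nonneg ha.le (-(7 / 8) : ℝ)
  have hB := Real.rpow_nonneg hb.le (-(7 / 8) : ℝ)
  rw [show 1 - s ^ 2 = (1 - s) * (1 + s) by ring, Real.mul_rpow ha.le hb.le]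
  by_cases h : 0 ≤ s
  · have : (1 + s) ^ (-(7 / 8) : ℝ) ≤ 1 := Real.rpow_le_one_of_one_le_of_nonpos (by linarith) (by norm_num)
    nlinarith
  · have : (1 - s) ^ (-(7 / 8) : ℝ) ≤ 1 := Real.rpow_le_one_of_one_le_of_nonpos (by linarith) (by norm_num)
    nlinarith

/-! ### Collision geometry -/

/-- `û · σ` for `σ ∈ ℝ³`. -/
def cosV (u σ : V3) : ℝ := ⟪‖u‖⁻¹ • u, σ⟫

/-- `u⁺ = (u + |u| σ) / 2`. -/
def up (u σ : V3) : V3 := (1 / 2 : ℝ) • (u + ‖u‖ • σ)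

/-- `u⁻ = (u - |u| σ) / 2`. -/
def um (u σ : V3) : V3 := (1 / 2 : ℝ) • (u - ‖u‖ • σ)

/-- The combination `x u⁺ + y u⁻` with coefficients depending on `|u|` and `û · σ`. -/
def comb (x y : ℝ → ℝ → ℝ) (u σ : V3) : V3 :=
  x ‖u‖ (cosV u σ) • up u σ + y ‖u‖ (cosV u σ) • um u σ

theorem up_add_um (u σ : V3) : up u σ + um u σ = u := by
  simp only [up, um]; module

theorem measurable_cosV : Measurable fun p : V3 × V3 => cosV p.1 p.2 := by
  unfold cosV; fun_prop

theorem measurable_up : Measurable fun p : V3 × V3 => up p.1 p.2 := by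
  unfold up; fun_prop

theorem measurable_um : Measurable fun p : V3 × V3 => um p.1 p.2 := by
  unfold um; fun_prop

theorem measurable_coeff {x : ℝ → ℝ → ℝ} (hx : Measurable (Function.uncurry x)) :
    Measurable fun p : V3 × V3 => x ‖p.1‖ (cosV p.1 p.2) :=
  hx.comp ((measurable_norm.comp measurable_fst).prodMk measurable_cosV)

theorem measurable_comb {x y : ℝ → ℝ → ℝ} (hx : Measurable (Function.uncurry x))
    (hy : Measurable (Function.uncurry y)) : Measurable fun p : V3 × V3 => comb x y p.1 p.2 :=
  ((measurable_coeff hx).smul measurable_up).add ((measurable_coeff hy).smul measurable_um)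

theorem cosV_orth (R : Orth) (u σ : V3) :
    cosV ((R : V3 →L[ℝ] V3) u) ((R : V3 →L[ℝ] V3) σ) = cosV u σ := by
  rw [cosV, orth_norm, ← map_smul, orth_inner, cosV]

theorem up_orth (R : Orth) (u σ : V3) :
    up ((R : V3 →L[ℝ] V3) u) ((R : V3 →L[ℝ] V3) σ) = (R : V3 →L[ℝ] V3) (up u σ) := by
  simp [up, orth_norm]

theorem um_orth (R : Orth) (u σ : V3) :
    um ((R : V3 →L[ℝ] V3) u) ((R : V3 →L[ℝ] V3) σ) = (R : V3 →L[ℝ] V3) (um u σ) := by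
  simp [um, orth_norm]

theorem comb_orth (x y : ℝ → ℝ → ℝ) (R : Orth) (u σ : V3) :
    comb x y ((R : V3 →L[ℝ] V3) u) ((R : V3 →L[ℝ] V3) σ) = (R : V3 →L[ℝ] V3) (comb x y u σ) := by
  simp [comb, orth_norm, cosV_orth, up_orth, um_orth]

theorem cosV_smul {ρ : ℝ} (hρ : 0 < ρ) (ξ : S2) (σ : V3) :
    cosV (ρ • (ξ : V3)) σ = ⟪(ξ : V3), σ⟫ := by
  simp [cosV, norm_smul, abs_of_pos hρ, smul_smul, inv_mul_cancel₀ hρ.ne']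

theorem norm_smul_sphere {ρ : ℝ} (hρ : 0 < ρ) (ξ : S2) : ‖ρ • (ξ : V3)‖ = ρ := by
  simp [norm_smul, abs_of_pos hρ]

theorem norm_mul_cosV (u σ : V3) : ‖u‖ * cosV u σ = ⟪u, σ⟫ := by
  by_cases hu : u = 0
  · simp [hu]
  · rw [cosV, real_inner_smul_left, mul_inv_cancel_left₀ (norm_ne_zero_iff.2 hu)]

theorem norm_up_sq (u : V3) (σ : S2) : ‖up u σ‖ ^ 2 = ‖u‖ ^ 2 * ((1 + cosV u σ) / 2) := by
  rw [up, norm_smul, mul_pow, norm_add_sq_real, real_inner_smul_right, ← norm_mul_cosV, norm_smul]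
  simp
  ring

theorem norm_um_sq (u : V3) (σ : S2) : ‖um u σ‖ ^ 2 = ‖u‖ ^ 2 * ((1 - cosV u σ) / 2) := by
  rw [um, norm_smul, mul_pow, norm_sub_sq_real, real_inner_smul_right, ← norm_mul_cosV, norm_smul]
  simp
  ring

theorem inner_up_um (u : V3) (σ : S2) : ⟪up u σ, um u σ⟫ = 0 := by
  rw [up, um, real_inner_smul_left, real_inner_smul_right, inner_add_left, inner_sub_right,
    inner_sub_right, real_inner_smul_left, real_inner_smul_left, real_inner_smul_right,
    real_inner_smul_right, real_inner_comm (σ : V3) u]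
  simp
  ring

/-- The vectors u⁺ and u⁻ are orthogonal with lengths |u| cos(θ/2) and |u| sin(θ/2). Gram matrices
of their combinations therefore depend on |u| and û·σ alone, as `orth_average_eq` requires. -/
theorem inner_comb (x y x' y' : ℝ → ℝ → ℝ) (u : V3) (σ : S2) :
    ⟪comb x y u σ, comb x' y' u σ⟫ = ‖u‖ ^ 2 *
      (x ‖u‖ (cosV u σ) * x' ‖u‖ (cosV u σ) * ((1 + cosV u σ) / 2) +
      y ‖u‖ (cosV u σ) * y' ‖u‖ (cosV u σ) * ((1 - cosV u σ) / 2)) := by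
  have h1 := norm_up_sq u σ
  have h2 := norm_um_sq u σ
  rw [← real_inner_self_eq_norm_sq] at h1 h2
  simp only [comb, inner_add_left, inner_add_right, real_inner_smul_left, real_inner_smul_right,
    inner_up_um, real_inner_comm (up u σ) (um u σ), h1, h2]
  ring

theorem norm_comb_sq (x y : ℝ → ℝ → ℝ) (u : V3) (σ : S2) :
    ‖comb x y u σ‖ ^ 2 = ‖u‖ ^ 2 * (x ‖u‖ (cosV u σ) ^ 2 * ((1 + cosV u σ) / 2) +
      y ‖u‖ (cosV u σ) ^ 2 * ((1 - cosV u σ) / 2)) := by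
  rw [← real_inner_self_eq_norm_sq, inner_comb]
  ring

/-! ### Radial changes of variables -/

/-- `z` is an increasing change of variables of `(0, ∞)` into itself, with `z² dz ≥ a ρ² dρ`. -/
structure IsRadial (a : ℝ) (z : ℝ → ℝ) : Prop where
  pos : 0 < a
  map_pos : ∀ ρ, 0 < ρ → 0 < z ρ
  differentiableAt : ∀ ρ, 0 < ρ → DifferentiableAt ℝ z ρ
  lower : ∀ ρ, 0 < ρ → a * ρ ^ 2 ≤ z ρ ^ 2 * deriv z ρ

namespace IsRadial

variable {a : ℝ} {z : ℝ → ℝ}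

theorem deriv_pos (hz : IsRadial a z) {ρ : ℝ} (hρ : 0 < ρ) : 0 < deriv z ρ := by
  have h1 := hz.lower ρ hρ
  have h2 : 0 < a * ρ ^ 2 := mul_pos hz.pos (by positivity)
  exact pos_of_mul_pos_right (h2.trans_le h1) (sq_nonneg _)

theorem strictMonoOn (hz : IsRadial a z) : StrictMonoOn z (Ioi 0) := by
  refine strictMonoOn_of_deriv_pos (convex_Ioi 0)
    (fun ρ hρ => (hz.differentiableAt ρ hρ).continuousAt.continuousWithinAt) fun ρ hρ => ?_
  rw [interior_Ioi] at hρ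
  exact hz.deriv_pos hρ

theorem lintegral_image (hz : IsRadial a z) (m : ℝ → ℝ≥0∞) :
    ∫⁻ r in z '' Ioi 0, m r = ∫⁻ ρ in Ioi (0 : ℝ), ENNReal.ofReal (deriv z ρ) * m (z ρ) := by
  rw [lintegral_image_eq_lintegral_abs_deriv_mul measurableSet_Ioi
    (fun ρ hρ => (hz.differentiableAt ρ hρ).hasDerivAt.hasDerivWithinAt)
    hz.strictMonoOn.injOn]
  refine setLIntegral_congr_fun measurableSet_Ioi fun ρ hρ => ?_
  rw [abs_of_pos (hz.deriv_pos hρ)]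

/-- Substitution r = z(ρ), with ρ² dρ ≤ a⁻¹ z² dz. For an inequality it is enough that the image
lies in (0, ∞). -/
theorem lintegral_le (hz : IsRadial a z) (m : ℝ → ℝ≥0∞) :
    ∫⁻ ρ in Ioi (0 : ℝ), ENNReal.ofReal (ρ ^ 2) * m (z ρ) ≤
      ENNReal.ofReal (1 / a) * ∫⁻ r in Ioi (0 : ℝ), ENNReal.ofReal (r ^ 2) * m r := by
  have hsub : z '' Ioi 0 ⊆ Ioi 0 := by
    rintro _ ⟨ρ, hρ, rfl⟩; exact hz.map_pos ρ hρ
  calc _ ≤ ∫⁻ ρ in Ioi (0 : ℝ), ENNReal.ofReal (1 / a) *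
        (ENNReal.ofReal (deriv z ρ) * (ENNReal.ofReal (z ρ ^ 2) * m (z ρ))) := by
        refine setLIntegral_mono' measurableSet_Ioi fun ρ hρ => ?_
        rw [← mul_assoc, ← mul_assoc, ← ENNReal.ofReal_mul (one_div_nonneg.2 hz.pos.le),
          ← ENNReal.ofReal_mul (mul_nonneg (one_div_nonneg.2 hz.pos.le) (hz.deriv_pos hρ).le)]
        gcongr
        have h1 := hz.lower ρ hρ
        have h2 := hz.pos
        rw [one_div, mul_assoc, mul_comm (deriv z ρ), inv_mul_eq_div, le_div_iff₀ h2]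
        linarith
    _ = ENNReal.ofReal (1 / a) * ∫⁻ r in z '' Ioi 0, ENNReal.ofReal (r ^ 2) * m r := by
        rw [lintegral_const_mul' _ _ ENNReal.ofReal_ne_top,
          hz.lintegral_image fun r => ENNReal.ofReal (r ^ 2) * m r]
    _ ≤ _ := by gcongr

end IsRadial

/-! ### Estimates for pairs of velocities -/

theorem measurable_comp_orth {h : V3 → ℝ≥0∞} (hh : Measurable h) (v : V3) :
    Measurable fun R : Orth => h ((R : V3 →L[ℝ] V3) v) :=
  hh.comp (measurable_orth_apply.comp (measurable_id.prodMk measurable_const))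

/-- The averaged shell integral is the same for every direction `ξ`, so it can be integrated over
the sphere and divided by the area. -/
theorem lintegral_shell {h : V3 → ℝ≥0∞} (hh : Measurable h) (ξ : S2) :
    ∫⁻ ρ in Ioi (0 : ℝ), ENNReal.ofReal (ρ ^ 2) *
      ∫⁻ R : Orth, h (ρ • (R : V3 →L[ℝ] V3) ξ) ∂orthMeasure = (surface univ)⁻¹ * ∫⁻ u, h u := by
  have h1 := lintegral_average (F := fun p => h p.1) (by fun_prop)
  have h2 : ∀ ξ' σ' : S2, (∫⁻ ρ in Ioi (0 : ℝ), ENNReal.ofReal (ρ ^ 2) *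
      ∫⁻ R : Orth, h (ρ • (R : V3 →L[ℝ] V3) ξ') ∂orthMeasure) =
      ∫⁻ ρ in Ioi (0 : ℝ), ENNReal.ofReal (ρ ^ 2) *
      ∫⁻ R : Orth, h (ρ • (R : V3 →L[ℝ] V3) ξ) ∂orthMeasure := by
    intro ξ' _
    refine lintegral_congr fun ρ => ?_
    congr 1
    exact orth_average_eq (b := 0) (b' := 0) (by simp) rfl (by simp) fun p _ => h (ρ • p)
  simp only [lintegral_const, fun ξ' => h2 ξ' ξ'] at h1
  rw [lintegral_mul_const _ hh] at h1
  have h3 : surface univ ≠ 0 := by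
    rw [Ne, Measure.measure_univ_eq_zero]; exact Measure.toSphere_ne_zero _
  have h4 : surface univ ≠ ⊤ := measure_ne_top _ _
  have h5 := (ENNReal.mul_left_inj h3 h4).1 h1
  rw [h5, mul_comm, mul_assoc, ENNReal.mul_inv_cancel h3 h4, mul_one]

/-- The total mass of the angular weight on `𝕊² × 𝕊²`, normalized by the area of the sphere. -/
def angularConst : ℝ≥0∞ :=
  (∫⁻ ξ : S2, ∫⁻ σ : S2, angularWeight ⟪(ξ : V3), (σ : V3)⟫ ∂surface ∂surface) * (surface univ)⁻¹

theorem angularConst_lt_top : angularConst < ⊤ := by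
  refine ENNReal.mul_lt_top ?_ ?_
  · calc _ ≤ ∫⁻ _ : S2, (12 * ∫⁻ s in Ioo (-1 : ℝ) 1, angularWeight s) ∂surface :=
          lintegral_mono fun ξ => lintegral_dot_le ξ measurable_angularWeight
      _ < ⊤ := by
          rw [lintegral_const]
          exact ENNReal.mul_lt_top (ENNReal.mul_lt_top (by simp) lintegral_angularWeight_lt_top)
            (measure_lt_top _ _)
  · rw [ENNReal.inv_lt_top, pos_iff_ne_zero, Ne, Measure.measure_univ_eq_zero]
    exact Measure.toSphere_ne_zero _

theorem ae_dot_mem (z : S2) : ∀ᵐ σ : S2 ∂surface, ⟪(z : V3), (σ : V3)⟫ ∈ Ioo (-1 : ℝ) 1 :=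
  ae_dot z (ae_restrict_mem measurableSet_Ioo)

/-- After averaging over rotations `h` sees only the length z(ρ) of the combination. The radial
substitution costs 1/a at each angle, and `hz` makes this cost, multiplied by `w`, at most `C` times
an integrable angular weight. -/
theorem lintegral_comb_le {x y : ℝ → ℝ → ℝ} (hx : Measurable (Function.uncurry x))
    (hy : Measurable (Function.uncurry y)) {w : ℝ → ℝ≥0∞} (hw : Measurable w) {C : ℝ≥0∞}
    (hz : ∀ s ∈ Ioo (-1 : ℝ) 1, ∃ a z, IsRadial a z ∧
      (∀ ρ, 0 < ρ → ρ ^ 2 * (x ρ s ^ 2 * ((1 + s) / 2) + y ρ s ^ 2 * ((1 - s) / 2)) = z ρ ^ 2) ∧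
      w s * ENNReal.ofReal (1 / a) ≤ C * angularWeight s)
    {h : V3 → ℝ≥0∞} (hh : Measurable h) :
    ∫⁻ u : V3, ∫⁻ σ : S2, w (cosV u σ) * h (comb x y u σ) ∂surface ≤
      C * angularConst * ∫⁻ u, h u := by
  have hF : Measurable fun p : V3 × V3 => w (cosV p.1 p.2) * h (comb x y p.1 p.2) :=
    (hw.comp measurable_cosV).mul (hh.comp (measurable_comb hx hy))
  rw [lintegral_average hF]
  calc _ ≤ ∫⁻ ξ : S2, ∫⁻ σ : S2, C * angularWeight ⟪(ξ : V3), (σ : V3)⟫ *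
        ((surface univ)⁻¹ * ∫⁻ u, h u) ∂surface ∂surface := by
        refine lintegral_mono fun ξ => lintegral_mono_ae ?_
        filter_upwards [ae_dot_mem ξ] with σ hσ
        set s := ⟪(ξ : V3), (σ : V3)⟫
        obtain ⟨a, z, hz1, hz2, hz3⟩ := hz s hσ
        have key : ∀ ρ ∈ Ioi (0 : ℝ), (∫⁻ R : Orth, w (cosV (ρ • (R : V3 →L[ℝ] V3) ξ)
            ((R : V3 →L[ℝ] V3) σ)) * h (comb x y (ρ • (R : V3 →L[ℝ] V3) ξ)
            ((R : V3 →L[ℝ] V3) σ)) ∂orthMeasure) =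
            w s * ∫⁻ R : Orth, h (z ρ • (R : V3 →L[ℝ] V3) ξ) ∂orthMeasure := by
          intro ρ hρ
          simp only [← map_smul, cosV_orth, comb_orth, cosV_smul hρ]
          rw [lintegral_const_mul _ (measurable_comp_orth hh _)]
          congr 1
          refine orth_average_eq (b := 0) (b' := 0) ?_ rfl (by simp) fun p _ => h p
          have h1 := hz1.map_pos ρ hρ
          rw [norm_smul_sphere h1, ← sq_eq_sq₀ (norm_nonneg _) h1.le, norm_comb_sq,
            norm_smul_sphere hρ, cosV_smul hρ, ← hz2 ρ hρ]
        have key' : ∀ ρ ∈ Ioi (0 : ℝ), ENNReal.ofReal (ρ ^ 2) * (∫⁻ R : Orth,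
            w (cosV (ρ • (R : V3 →L[ℝ] V3) ξ)
            ((R : V3 →L[ℝ] V3) σ)) * h (comb x y (ρ • (R : V3 →L[ℝ] V3) ξ)
            ((R : V3 →L[ℝ] V3) σ)) ∂orthMeasure) =
            w s * (ENNReal.ofReal (ρ ^ 2) *
              ∫⁻ R : Orth, h (z ρ • (R : V3 →L[ℝ] V3) ξ) ∂orthMeasure) := by
          intro ρ hρ
          rw [key ρ hρ, mul_left_comm]
        rw [setLIntegral_congr_fun measurableSet_Ioi key']
        have hm : Measurable fun r : ℝ => ∫⁻ R : Orth, h (r • (R : V3 →L[ℝ] V3) ξ) ∂orthMeasure := by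
          refine Measurable.lintegral_prod_right' (ν := orthMeasure)
            (f := fun p : ℝ × Orth => h (p.1 • (p.2 : V3 →L[ℝ] V3) ξ)) ?_
          refine hh.comp (measurable_fst.smul ?_)
          exact measurable_orth_apply.comp (measurable_snd.prodMk measurable_const)
        calc _ ≤ w s * (ENNReal.ofReal (1 / a) * ((surface univ)⁻¹ * ∫⁻ u, h u)) := by
              rw [← lintegral_shell hh ξ]
              refine le_trans (le_of_eq ?_) (mul_le_mul_right (hz1.lintegral_le _) _)
              refine lintegral_const_mul'' _ (AEMeasurable.mul (by fun_prop) ?_)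
              refine hm.comp_aemeasurable ?_
              exact (ContinuousOn.aemeasurable (fun ρ hρ =>
                (hz1.differentiableAt ρ hρ).continuousAt.continuousWithinAt) measurableSet_Ioi)
          _ ≤ _ := by
              rw [← mul_assoc]
              gcongr
    _ = _ := by
        have hm : Measurable fun p : S2 × S2 => angularWeight ⟪(p.1 : V3), (p.2 : V3)⟫ :=
          measurable_angularWeight.comp (by fun_prop)
        have h1 : ∀ ξ : S2, ∫⁻ σ : S2, C * angularWeight ⟪(ξ : V3), (σ : V3)⟫ *
            ((surface univ)⁻¹ * ∫⁻ u, h u) ∂surface =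
            (∫⁻ σ : S2, angularWeight ⟪(ξ : V3), (σ : V3)⟫ ∂surface) *
              (C * ((surface univ)⁻¹ * ∫⁻ u, h u)) := by
          intro ξ
          have hm' : Measurable fun σ : S2 => angularWeight ⟪(ξ : V3), (σ : V3)⟫ :=
            measurable_angularWeight.comp (by fun_prop)
          rw [← lintegral_mul_const _ hm']
          refine lintegral_congr fun σ => ?_
          ring
        have hm' : Measurable fun ξ : S2 =>
            ∫⁻ σ : S2, angularWeight ⟪(ξ : V3), (σ : V3)⟫ ∂surface :=
          Measurable.lintegral_prod_right' (ν := surface) hm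
        rw [lintegral_congr h1, lintegral_mul_const _ hm', angularConst, mul_left_comm, mul_assoc,
          mul_assoc]

/-! ### Inelasticity defects -/

/-- The properties of the defect `D = (1 - e) / 2` of a restitution coefficient `e` that enter the
estimates. -/
structure IsDefect (K : ℝ) (D : ℝ → ℝ) : Prop where
  const_nonneg : 0 ≤ K
  measurable : Measurable D
  nonneg : ∀ r, 0 ≤ D r
  le_half : ∀ r, D r ≤ 1 / 2
  mono : MonotoneOn D (Ioi 0)
  differentiableAt : ∀ r, 0 < r → DifferentiableAt ℝ D r
  deriv_nonneg : ∀ r, 0 < r → 0 ≤ deriv D r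
  deriv_le : ∀ r, 0 < r → r * deriv D r ≤ K * D r
  deriv_le_half : ∀ r, 0 < r → D r + r * deriv D r ≤ 1 / 2

theorem isDefect_zero : IsDefect 0 fun _ => 0 := by
  refine ⟨le_rfl, by fun_prop, ?_, ?_, ?_, ?_, ?_, ?_, ?_⟩ <;> intros <;> simp [MonotoneOn]

/-- The length of a combination of `u⁺` and `u⁻` with coefficients affine in the defect. -/
def radius (D : ℝ → ℝ) (c α μ ν ρ : ℝ) : ℝ :=
  √((α * ρ * (1 - μ * D (c * ρ))) ^ 2 + (ν * ρ * D (c * ρ)) ^ 2)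

namespace IsDefect

variable {K : ℝ} {D : ℝ → ℝ} {c α μ ν : ℝ}

theorem hasDerivAt_radius (hD : IsDefect K D) (hc : 0 < c) (hα : 0 < α) (hμ : μ ∈ Icc (0 : ℝ) 1)
    {ρ : ℝ} (hρ : 0 < ρ) :
    HasDerivAt (radius D c α μ ν)
      ((α ^ 2 * ρ * (1 - μ * D (c * ρ)) * (1 - μ * (D (c * ρ) + c * ρ * deriv D (c * ρ))) +
        ν ^ 2 * ρ * D (c * ρ) * (D (c * ρ) + c * ρ * deriv D (c * ρ))) / radius D c α μ ν ρ) ρ := by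
  have hcρ : 0 < c * ρ := mul_pos hc hρ
  have h1 : HasDerivAt (fun ρ => D (c * ρ)) (deriv D (c * ρ) * c) ρ := by
    have h2 : HasDerivAt (fun ρ : ℝ => c * ρ) c ρ := by
      simpa using (hasDerivAt_id ρ).const_mul c
    exact (hD.differentiableAt _ hcρ).hasDerivAt.comp ρ h2
  have hA : HasDerivAt (fun ρ => α * ρ * (1 - μ * D (c * ρ)))
      (α * 1 * (1 - μ * D (c * ρ)) + α * ρ * (-(μ * (deriv D (c * ρ) * c)))) ρ :=
    ((hasDerivAt_id ρ).const_mul α).mul ((h1.const_mul μ).const_sub 1)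
  have hB : HasDerivAt (fun ρ => ν * ρ * D (c * ρ))
      (ν * 1 * D (c * ρ) + ν * ρ * (deriv D (c * ρ) * c)) ρ :=
    ((hasDerivAt_id ρ).const_mul ν).mul h1
  have hpos : 0 < α * ρ * (1 - μ * D (c * ρ)) := by
    have : μ * D (c * ρ) ≤ 1 / 2 := by
      nlinarith [hμ.1, hμ.2, hD.nonneg (c * ρ), hD.le_half (c * ρ)]
    exact mul_pos (mul_pos hα hρ) (by linarith)
  have hne : (α * ρ * (1 - μ * D (c * ρ))) ^ 2 + (ν * ρ * D (c * ρ)) ^ 2 ≠ 0 := by positivity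
  refine (((hA.pow 2).add (hB.pow 2)).sqrt hne).congr_deriv ?_
  simp only [radius, Pi.add_apply, Pi.pow_apply]
  rw [div_eq_div_iff (by positivity) (by positivity)]
  push_cast
  ring

theorem half_le_one_sub (hD : IsDefect K D) (hμ : μ ∈ Icc (0 : ℝ) 1) (r : ℝ) :
    1 / 2 ≤ 1 - μ * D r := by
  nlinarith [hμ.1, hμ.2, hD.nonneg r, hD.le_half r]

theorem le_radius (hD : IsDefect K D) (hα : 0 < α) (hμ : μ ∈ Icc (0 : ℝ) 1) {ρ : ℝ} (hρ : 0 < ρ) :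
    α * ρ / 2 ≤ radius D c α μ ν ρ := by
  have h1 := hD.half_le_one_sub hμ (c * ρ)
  have h2 : 0 < α * ρ := mul_pos hα hρ
  refine Real.le_sqrt_of_sq_le ?_
  have : α * ρ / 2 ≤ α * ρ * (1 - μ * D (c * ρ)) := by nlinarith
  have h3 := pow_le_pow_left₀ (by positivity) this 2
  nlinarith [sq_nonneg (ν * ρ * D (c * ρ))]

/-- Both D ≤ 1/2 and D + r D' ≤ 1/2 are used: they give z ≥ αρ/2 and z z' ≥ α²ρ/4, the `ν` term
contributing only nonnegatively. The product is z² z' ≥ (α/2)³ ρ². -/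
theorem isRadial (hD : IsDefect K D) (hc : 0 < c) (hα : 0 < α) (hμ : μ ∈ Icc (0 : ℝ) 1) :
    IsRadial ((α / 2) ^ 3) (radius D c α μ ν) where
  pos := by positivity
  map_pos ρ hρ := lt_of_lt_of_le (by positivity) (hD.le_radius hα hμ hρ)
  differentiableAt ρ hρ := (hD.hasDerivAt_radius hc hα hμ hρ).differentiableAt
  lower ρ hρ := by
    have hz : α * ρ / 2 ≤ radius D c α μ ν ρ := hD.le_radius hα hμ hρ
    have h0 : 0 < α * ρ / 2 := by positivity
    rw [(hD.hasDerivAt_radius hc hα hμ hρ).deriv]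
    set z := radius D c α μ ν ρ
    have hzpos : 0 < z := h0.trans_le hz
    have hcρ : 0 < c * ρ := mul_pos hc hρ
    have h1 := hD.half_le_one_sub hμ (c * ρ)
    have h2 : 1 / 2 ≤ 1 - μ * (D (c * ρ) + c * ρ * deriv D (c * ρ)) := by
      have := hD.deriv_le_half _ hcρ
      have := hD.deriv_nonneg _ hcρ
      have := hD.nonneg (c * ρ)
      have : 0 ≤ D (c * ρ) + c * ρ * deriv D (c * ρ) := by positivity
      nlinarith [hμ.1, hμ.2]
    have h3 : 0 ≤ ν ^ 2 * ρ * D (c * ρ) * (D (c * ρ) + c * ρ * deriv D (c * ρ)) := by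
      have := hD.deriv_nonneg _ hcρ
      have := hD.nonneg (c * ρ)
      positivity
    have h4 : α ^ 2 * ρ * (1 / 2) * (1 / 2) ≤ α ^ 2 * ρ * (1 - μ * D (c * ρ)) *
        (1 - μ * (D (c * ρ) + c * ρ * deriv D (c * ρ))) := by
      gcongr
    calc (α / 2) ^ 3 * ρ ^ 2 = (α * ρ / 2) * (α ^ 2 * ρ * (1 / 2) * (1 / 2)) := by ring
      _ ≤ z * _ := mul_le_mul hz (h4.trans (le_add_of_nonneg_right h3)) (by positivity) hzpos.le
      _ = _ := by field_simp

theorem radius_le (hD : IsDefect K D) (hα : 0 < α) (hμ : μ ∈ Icc (0 : ℝ) 1) (hν : 0 ≤ ν)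
    {ρ : ℝ} (hρ : 0 < ρ) : radius D c α μ ν ρ ≤ (α + ν) * ρ := by
  have h1 := hD.half_le_one_sub hμ (c * ρ)
  have h5 := hD.nonneg (c * ρ)
  have h6 := hD.le_half (c * ρ)
  refine Real.sqrt_le_iff.2 ⟨by positivity, ?_⟩
  have h2 : α * ρ * (1 - μ * D (c * ρ)) ≤ α * ρ := by
    have : 0 ≤ α * ρ * (μ * D (c * ρ)) := by have := hμ.1; positivity
    linarith
  have h3 : ν * ρ * D (c * ρ) ≤ ν * ρ := by
    have : 0 ≤ ν * ρ := by positivity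
    nlinarith
  have h4 : 0 ≤ ν * ρ * D (c * ρ) := by positivity
  have h7 : 0 ≤ α * ρ * (1 - μ * D (c * ρ)) := by
    have : 0 ≤ 1 - μ * D (c * ρ) := by linarith
    positivity
  nlinarith [pow_le_pow_left₀ h4 h3 2, pow_le_pow_left₀ h7 h2 2,
    mul_nonneg (mul_nonneg hα.le hρ.le) (mul_nonneg hν hρ.le)]

/-- The bounds αρ/2 ≤ z ≤ (α + ν)ρ bracket any positive value, and the intermediate value theorem
applies. Surjectivity is what turns the radial inequality into an exact change of variables. -/
theorem image_radius (hD : IsDefect K D) (hc : 0 < c) (hα : 0 < α) (hμ : μ ∈ Icc (0 : ℝ) 1)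
    (hν : 0 ≤ ν) : radius D c α μ ν '' Ioi 0 = Ioi 0 := by
  have hR := hD.isRadial (ν := ν) hc hα hμ
  refine Subset.antisymm ?_ fun y hy => ?_
  · rintro _ ⟨ρ, hρ, rfl⟩; exact hR.map_pos ρ hρ
  · have hy : 0 < y := hy
    have hαν : 0 < α + ν := by positivity
    have h1 : 0 < y / (α + ν) := by positivity
    have h2 : 0 < 2 * y / α := by positivity
    have h12 : y / (α + ν) ≤ 2 * y / α := by
      rw [div_le_div_iff₀ hαν hα]; nlinarith
    have hcont : ContinuousOn (radius D c α μ ν) (Icc (y / (α + ν)) (2 * y / α)) := fun ρ hρ =>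
      (hR.differentiableAt ρ (h1.trans_le hρ.1)).continuousAt.continuousWithinAt
    have hlo : radius D c α μ ν (y / (α + ν)) ≤ y := by
      refine (hD.radius_le hα hμ hν h1).trans_eq ?_
      field_simp
    have hhi : y ≤ radius D c α μ ν (2 * y / α) := by
      refine le_trans (le_of_eq ?_) (hD.le_radius hα hμ h2)
      field_simp
    obtain ⟨ρ, hρ, hρy⟩ := intermediate_value_Icc h12 hcont ⟨hlo, hhi⟩
    exact ⟨ρ, h1.trans_le hρ.1, hρy⟩

end IsDefect

/-! ### Changes of variables on `ℝ³ × 𝕊²` -/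

/-- The first three identities say that the pair of combinations has the Gram matrix of (w, w⁻),
where w has length z(ρ) and the same angle with σ. Averaging over rotations thus identifies the
pairs, and only ρ ↦ z(ρ) is left to substitute, with Jacobian z² z'/ρ². -/
theorem lintegral_change {x y x' y' J : ℝ → ℝ → ℝ} (hx : Measurable (Function.uncurry x))
    (hy : Measurable (Function.uncurry y)) (hx' : Measurable (Function.uncurry x'))
    (hy' : Measurable (Function.uncurry y')) (hJ : Measurable (Function.uncurry J))
    (hz : ∀ s ∈ Ioo (-1 : ℝ) 1, ∃ a z, IsRadial a z ∧ z '' Ioi 0 = Ioi 0 ∧ ∀ ρ, 0 < ρ →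
      ρ ^ 2 * (x ρ s ^ 2 * ((1 + s) / 2) + y ρ s ^ 2 * ((1 - s) / 2)) = z ρ ^ 2 ∧
      ρ ^ 2 * (x' ρ s ^ 2 * ((1 + s) / 2) + y' ρ s ^ 2 * ((1 - s) / 2)) =
        z ρ ^ 2 * ((1 - s) / 2) ∧
      ρ ^ 2 * (x ρ s * x' ρ s * ((1 + s) / 2) + y ρ s * y' ρ s * ((1 - s) / 2)) =
        z ρ ^ 2 * ((1 - s) / 2) ∧
      ρ ^ 2 * J ρ s = z ρ ^ 2 * deriv z ρ)
    {F : V3 × V3 → ℝ≥0∞} (hF : Measurable F) :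
    ∫⁻ u : V3, ∫⁻ σ : S2, ENNReal.ofReal (J ‖u‖ (cosV u σ)) *
        F (comb x y u σ, comb x' y' u σ) ∂surface =
      ∫⁻ u : V3, ∫⁻ σ : S2, F (u, um u σ) ∂surface := by
  have hF1 : Measurable fun p : V3 × V3 => ENNReal.ofReal (J ‖p.1‖ (cosV p.1 p.2)) *
      F (comb x y p.1 p.2, comb x' y' p.1 p.2) :=
    (measurable_coeff hJ).ennreal_ofReal.mul
      (hF.comp ((measurable_comb hx hy).prodMk (measurable_comb hx' hy')))
  have hF2 : Measurable fun p : V3 × V3 => F (p.1, um p.1 p.2) :=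
    hF.comp (measurable_fst.prodMk measurable_um)
  rw [lintegral_average hF1, lintegral_average hF2]
  refine lintegral_congr fun ξ => lintegral_congr_ae ?_
  filter_upwards [ae_dot_mem ξ] with σ hσ
  set s := ⟪(ξ : V3), (σ : V3)⟫
  obtain ⟨a, z, hz1, hz2, hz3⟩ := hz s hσ
  set m : ℝ → ℝ≥0∞ := fun r => ∫⁻ R : Orth, F (r • (R : V3 →L[ℝ] V3) ξ,
    um (r • (R : V3 →L[ℝ] V3) ξ) ((R : V3 →L[ℝ] V3) σ)) ∂orthMeasure with hm
  have key : ∀ ρ ∈ Ioi (0 : ℝ), ENNReal.ofReal (ρ ^ 2) * (∫⁻ R : Orth,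
      ENNReal.ofReal (J ‖ρ • (R : V3 →L[ℝ] V3) ξ‖ (cosV (ρ • (R : V3 →L[ℝ] V3) ξ)
        ((R : V3 →L[ℝ] V3) σ))) * F (comb x y (ρ • (R : V3 →L[ℝ] V3) ξ) ((R : V3 →L[ℝ] V3) σ),
        comb x' y' (ρ • (R : V3 →L[ℝ] V3) ξ) ((R : V3 →L[ℝ] V3) σ)) ∂orthMeasure) =
      ENNReal.ofReal (deriv z ρ) * (ENNReal.ofReal (z ρ ^ 2) * m (z ρ)) := by
    intro ρ hρ
    obtain ⟨h1, h2, h3, h4⟩ := hz3 ρ hρ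
    have hzρ := hz1.map_pos ρ hρ
    simp only [← map_smul, orth_norm, cosV_orth, comb_orth, cosV_smul hρ, norm_smul_sphere hρ, hm,
      um_orth]
    rw [lintegral_const_mul' _ _ ENNReal.ofReal_ne_top, ← mul_assoc,
      ← ENNReal.ofReal_mul (sq_nonneg _), h4, ← mul_assoc,
      ← ENNReal.ofReal_mul (hz1.deriv_pos hρ).le, mul_comm (z ρ ^ 2)]
    congr 1
    refine orth_average_eq ?_ ?_ ?_ fun p q => F (p, q)
    · rw [norm_smul_sphere hzρ, ← sq_eq_sq₀ (norm_nonneg _) hzρ.le, norm_comb_sq,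
        norm_smul_sphere hρ, cosV_smul hρ, ← h1]
    · rw [← sq_eq_sq₀ (norm_nonneg _) (norm_nonneg _), norm_comb_sq, norm_um_sq,
        norm_smul_sphere hρ, cosV_smul hρ, norm_smul_sphere hzρ, cosV_smul hzρ, ← h2]
    · have h5 : ⟪z ρ • (ξ : V3), um (z ρ • (ξ : V3)) σ⟫ = z ρ ^ 2 * ((1 - s) / 2) := by
        have := inner_up_um (z ρ • (ξ : V3)) σ
        nth_rw 1 [← up_add_um (z ρ • (ξ : V3)) σ]
        rw [inner_add_left, this, real_inner_self_eq_norm_sq, norm_um_sq, norm_smul_sphere hzρ,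
          cosV_smul hzρ, zero_add]
      rw [h5, inner_comb, norm_smul_sphere hρ, cosV_smul hρ, ← h3]
  rw [setLIntegral_congr_fun measurableSet_Ioi key,
    ← hz1.lintegral_image fun r => ENNReal.ofReal (r ^ 2) * m r, hz2]

/-! ### Trilinear estimates -/

/-- The measure `du dσ` on `ℝ³ × 𝕊²`. -/
abbrev pairMeasure : Measure (V3 × S2) := (volume : Measure V3).prod surface

/-- The measure `dv du dσ`. -/
abbrev tripleMeasure : Measure (V3 × (V3 × S2)) := (volume : Measure V3).prod pairMeasure

/-- `sin (θ / 2)` as a function of `cos θ`. -/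
def sinHalf (s : ℝ) : ℝ := √((1 - s) / 2)

/-- `cos (θ / 2)` as a function of `cos θ`. -/
def cosHalf (s : ℝ) : ℝ := √((1 + s) / 2)

theorem measurable_sinHalf : Measurable sinHalf := by unfold sinHalf; fun_prop

theorem measurable_cosHalf : Measurable cosHalf := by unfold cosHalf; fun_prop

theorem sinHalf_nonneg (s : ℝ) : 0 ≤ sinHalf s := Real.sqrt_nonneg _

theorem sinHalf_pos {s : ℝ} (hs : s ∈ Ioo (-1 : ℝ) 1) : 0 < sinHalf s :=
  Real.sqrt_pos.2 (by linarith [hs.2])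

theorem cosHalf_pos {s : ℝ} (hs : s ∈ Ioo (-1 : ℝ) 1) : 0 < cosHalf s :=
  Real.sqrt_pos.2 (by linarith [hs.1])

theorem sinHalf_sq {s : ℝ} (hs : s ∈ Ioo (-1 : ℝ) 1) : sinHalf s ^ 2 = (1 - s) / 2 :=
  Real.sq_sqrt (by linarith [hs.2])

theorem cosHalf_sq {s : ℝ} (hs : s ∈ Ioo (-1 : ℝ) 1) : cosHalf s ^ 2 = (1 + s) / 2 :=
  Real.sq_sqrt (by linarith [hs.1])

theorem sinHalf_le_one {s : ℝ} (hs : s ∈ Ioo (-1 : ℝ) 1) : sinHalf s ≤ 1 :=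
  Real.sqrt_le_one.2 (by linarith [hs.1])

theorem cosHalf_le_one {s : ℝ} (hs : s ∈ Ioo (-1 : ℝ) 1) : cosHalf s ≤ 1 :=
  Real.sqrt_le_one.2 (by linarith [hs.2])

/-- The angular weight with a factor `sin³ (θ / 2)`. -/
def sinWeight (s : ℝ) : ℝ≥0∞ := angularWeight s * ENNReal.ofReal (sinHalf s ^ 3)

/-- The angular weight with a factor `cos³ (θ / 2)`. -/
def cosWeight (s : ℝ) : ℝ≥0∞ := angularWeight s * ENNReal.ofReal (cosHalf s ^ 3)

theorem measurable_sinWeight : Measurable sinWeight :=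
  measurable_angularWeight.mul (measurable_sinHalf.pow_const 3).ennreal_ofReal

theorem measurable_cosWeight : Measurable cosWeight :=
  measurable_angularWeight.mul (measurable_cosHalf.pow_const 3).ennreal_ofReal

theorem angularWeight_eq {s : ℝ} (hs : s ∈ Ioo (-1 : ℝ) 1) :
    angularWeight s = ENNReal.ofReal ((2 * sinHalf s * cosHalf s) ^ (-(7 / 4) : ℝ)) := by
  have h1 := sinHalf_pos hs
  have h2 := cosHalf_pos hs
  rw [angularWeight]
  congr 1
  have : 1 - s ^ 2 = (2 * sinHalf s * cosHalf s) ^ 2 := by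
    rw [mul_pow, mul_pow, sinHalf_sq hs, cosHalf_sq hs]; ring
  rw [this, ← Real.rpow_natCast, ← Real.rpow_mul (by positivity)]
  norm_num

/-- With a = sin(θ/2) and c = cos(θ/2) the right side is 2^(1/4) a^(-1/4) c^(-7/4), all of whose
factors are at least 1. The weight is singular enough to absorb the a^(3/2) from `sinWeight`. -/
theorem one_le_weights {s : ℝ} (hs : s ∈ Ioo (-1 : ℝ) 1) :
    1 ≤ 4 * (angularWeight s ^ (1 / 2 : ℝ) * sinWeight s ^ (1 / 2 : ℝ)) := by
  have h1 := sinHalf_pos hs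
  have h2 := cosHalf_pos hs
  have h3 := sinHalf_le_one hs
  have h4 := cosHalf_le_one hs
  rw [sinWeight, angularWeight_eq hs, ← ENNReal.ofReal_mul (by positivity),
    ENNReal.ofReal_rpow_of_nonneg (by positivity) (by norm_num),
    ENNReal.ofReal_rpow_of_nonneg (by positivity) (by norm_num),
    ← ENNReal.ofReal_mul (by positivity), show (4 : ℝ≥0∞) = ENNReal.ofReal 4 by simp,
    ← ENNReal.ofReal_mul (by positivity), ENNReal.one_le_ofReal]
  set a := sinHalf s
  set c := cosHalf s
  have e0 : ∀ X : ℝ, 0 < X → (X ^ (-(7 / 4) : ℝ)) ^ (1 / 2 : ℝ) *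
      (X ^ (-(7 / 4) : ℝ) * a ^ 3) ^ (1 / 2 : ℝ) = X ^ (-(7 / 4) : ℝ) * a ^ (3 / 2 : ℝ) := by
    intro X hX
    rw [Real.mul_rpow (by positivity) (by positivity), ← mul_assoc, ← Real.rpow_mul hX.le,
      ← Real.rpow_add hX, ← Real.rpow_natCast, ← Real.rpow_mul h1.le]
    norm_num
  have e1 : 4 * ((2 * a * c) ^ (-(7 / 4) : ℝ) * a ^ (3 / 2 : ℝ)) =
      (2 : ℝ) ^ (1 / 4 : ℝ) * a ^ (-(1 / 4) : ℝ) * c ^ (-(7 / 4) : ℝ) := by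
    have p2 : (2 : ℝ) ^ (1 / 4 : ℝ) = 4 * 2 ^ (-(7 / 4) : ℝ) := by
      rw [show (4 : ℝ) = 2 ^ (2 : ℝ) by norm_num, ← Real.rpow_add two_pos]
      norm_num
    have pa : a ^ (-(1 / 4) : ℝ) = a ^ (-(7 / 4) : ℝ) * a ^ (3 / 2 : ℝ) := by
      rw [← Real.rpow_add h1]
      norm_num
    rw [Real.mul_rpow (by positivity) h2.le, Real.mul_rpow (by positivity) h1.le, p2, pa]
    ring
  rw [e0 _ (by positivity), e1]
  have g1 : 1 ≤ (2 : ℝ) ^ (1 / 4 : ℝ) := Real.one_le_rpow (by norm_num) (by norm_num)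
  have g2 : 1 ≤ a ^ (-(1 / 4) : ℝ) := Real.one_le_rpow_of_pos_of_le_one_of_nonpos h1 h3 (by norm_num)
  have g3 : 1 ≤ c ^ (-(7 / 4) : ℝ) := Real.one_le_rpow_of_pos_of_le_one_of_nonpos h2 h4 (by norm_num)
  exact one_le_mul_of_one_le_of_one_le (one_le_mul_of_one_le_of_one_le g1 g2) g3

/-- The singular angular factor `1 / cos (θ / 2)`. -/
def secHalf (s : ℝ) : ℝ≥0∞ := ENNReal.ofReal (1 / cosHalf s)

theorem measurable_secHalf : Measurable secHalf :=
  (measurable_const.div measurable_cosHalf).ennreal_ofReal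

/-- The angular weights contribute (2ac)^(-7/4) in total and the cubes contribute a^(3/4) c^(3/4),
so the right side is 2^(1/4)/(ac). The power of c is exactly the required -1, which fixes the
exponent 7/8. -/
theorem secHalf_le_weights {s : ℝ} (hs : s ∈ Ioo (-1 : ℝ) 1) :
    secHalf s ≤ 4 * (angularWeight s ^ (1 / 2 : ℝ) * sinWeight s ^ (1 / 4 : ℝ) *
      cosWeight s ^ (1 / 4 : ℝ)) := by
  have h1 := sinHalf_pos hs
  have h2 := cosHalf_pos hs
  have h3 := sinHalf_le_one hs
  have h4 := cosHalf_le_one hs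
  rw [secHalf, sinWeight, cosWeight, angularWeight_eq hs, ← ENNReal.ofReal_mul (by positivity),
    ← ENNReal.ofReal_mul (by positivity),
    ENNReal.ofReal_rpow_of_nonneg (by positivity) (by norm_num),
    ENNReal.ofReal_rpow_of_nonneg (by positivity) (by norm_num),
    ENNReal.ofReal_rpow_of_nonneg (by positivity) (by norm_num),
    ← ENNReal.ofReal_mul (by positivity), ← ENNReal.ofReal_mul (by positivity),
    show (4 : ℝ≥0∞) = ENNReal.ofReal 4 by simp, ← ENNReal.ofReal_mul (by positivity)]
  refine ENNReal.ofReal_le_ofReal ?_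
  set a := sinHalf s
  set c := cosHalf s
  have e0 : ∀ p : ℝ, (2 * a * c) ^ p = 2 ^ p * a ^ p * c ^ p := fun p => by
    rw [Real.mul_rpow (by positivity) h2.le, Real.mul_rpow (by positivity) h1.le]
  have e1 : ∀ x : ℝ, 0 < x → ∀ p : ℝ, ((2 * a * c) ^ (-(7 / 4) : ℝ) * x ^ 3) ^ p =
      (2 * a * c) ^ (-(7 / 4) * p : ℝ) * x ^ (3 * p) := fun x hx p => by
    rw [Real.mul_rpow (by positivity) (by positivity), ← Real.rpow_mul (by positivity),
      ← Real.rpow_natCast, ← Real.rpow_mul hx.le]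
    norm_num
  rw [e1 a h1, e1 c h2, ← Real.rpow_mul (by positivity), e0, e0]
  have e2 : (4 : ℝ) * (2 ^ (-(7 / 4) * (1 / 2) : ℝ) * a ^ (-(7 / 4) * (1 / 2) : ℝ) *
      c ^ (-(7 / 4) * (1 / 2) : ℝ) * (2 ^ (-(7 / 4) * (1 / 4) : ℝ) * a ^ (-(7 / 4) * (1 / 4) : ℝ) *
      c ^ (-(7 / 4) * (1 / 4) : ℝ) * a ^ (3 * (1 / 4) : ℝ)) *
      (2 ^ (-(7 / 4) * (1 / 4) : ℝ) * a ^ (-(7 / 4) * (1 / 4) : ℝ) *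
      c ^ (-(7 / 4) * (1 / 4) : ℝ) * c ^ (3 * (1 / 4) : ℝ))) =
      2 ^ (1 / 4 : ℝ) * a ^ (-1 : ℝ) * c ^ (-1 : ℝ) := by
    have p2 : (2 : ℝ) ^ (1 / 4 : ℝ) = 4 * (2 ^ (-(7 / 4) * (1 / 2) : ℝ) *
        2 ^ (-(7 / 4) * (1 / 4) : ℝ) * 2 ^ (-(7 / 4) * (1 / 4) : ℝ)) := by
      rw [show (4 : ℝ) = 2 ^ (2 : ℝ) by norm_num, ← Real.rpow_add two_pos, ← Real.rpow_add two_pos,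
        ← Real.rpow_add two_pos]
      norm_num
    have pa : a ^ (-1 : ℝ) = a ^ (-(7 / 4) * (1 / 2) : ℝ) * a ^ (-(7 / 4) * (1 / 4) : ℝ) *
        a ^ (-(7 / 4) * (1 / 4) : ℝ) * a ^ (3 * (1 / 4) : ℝ) := by
      rw [← Real.rpow_add h1, ← Real.rpow_add h1, ← Real.rpow_add h1]
      norm_num
    have pc : c ^ (-1 : ℝ) = c ^ (-(7 / 4) * (1 / 2) : ℝ) * c ^ (-(7 / 4) * (1 / 4) : ℝ) *
        c ^ (-(7 / 4) * (1 / 4) : ℝ) * c ^ (3 * (1 / 4) : ℝ) := by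
      rw [← Real.rpow_add h2, ← Real.rpow_add h2, ← Real.rpow_add h2]
      norm_num
    rw [p2, pa, pc]
    ring
  rw [e2, Real.rpow_neg_one, Real.rpow_neg_one, one_div]
  have g1 : 1 ≤ (2 : ℝ) ^ (1 / 4 : ℝ) := Real.one_le_rpow (by norm_num) (by norm_num)
  have g2 : 1 ≤ a⁻¹ := (one_le_inv₀ h1).2 h3
  exact le_mul_of_one_le_left (by positivity) (one_le_mul_of_one_le_of_one_le g1 g2)

/-- The angular marginal bound `∫∫ w(û·σ) h(U(u,σ)) dσ du ≤ A ∫ h`. -/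
structure PairBound (A : ℝ≥0∞) (w : ℝ → ℝ≥0∞) (U : V3 × S2 → V3) : Prop where
  measurable : Measurable U
  bound : ∀ h : V3 → ℝ≥0∞, Measurable h →
    ∫⁻ p, w (cosV p.1 p.2) * h (U p) ∂pairMeasure ≤ A * ∫⁻ x, h x

theorem measurable_cosV_pair : Measurable fun p : V3 × S2 => cosV p.1 p.2 := by
  unfold cosV; fun_prop

theorem ae_cosV_mem : ∀ᵐ p ∂pairMeasure, cosV p.1 p.2 ∈ Ioo (-1 : ℝ) 1 := by
  rw [Measure.ae_prod_iff_ae_ae (measurable_cosV_pair measurableSet_Ioo)]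
  filter_upwards [compl_mem_ae_iff.2 (measure_singleton (0 : V3))] with u hu
  have hu : u ≠ 0 := hu
  refine ae_dot_mem ⟨‖u‖⁻¹ • u, ?_⟩
  simp [norm_smul, hu]

/-- For fixed v, insert the weights by `one_le_weights` and apply Cauchy–Schwarz in (u, σ). Each
factor is a `PairBound` integral of a reflected translate, so the result does not depend on v and F
is integrated on its own. -/
theorem lintegral_trilinear_one {A : ℝ≥0∞} {U Z : V3 × S2 → V3}
    (hU : PairBound A angularWeight U) (hZ : PairBound A sinWeight Z) {F H Ψ : V3 → ℝ≥0∞}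
    (hF : Measurable F) (hH : Measurable H) (hΨ : Measurable Ψ) :
    ∫⁻ q, F q.1 * H (q.1 - U q.2) * Ψ (q.1 - Z q.2) ∂tripleMeasure ≤
      4 * A * (∫⁻ v, F v) * (∫⁻ v, H v ^ (2 : ℝ)) ^ (1 / 2 : ℝ) *
        (∫⁻ v, Ψ v ^ (2 : ℝ)) ^ (1 / 2 : ℝ) := by
  have hUm := hU.measurable
  have hZm := hZ.measurable
  rw [lintegral_prod _ (by fun_prop)]
  have key : ∀ v : V3, ∫⁻ p, H (v - U p) * Ψ (v - Z p) ∂pairMeasure ≤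
      4 * (A * (∫⁻ v, H v ^ (2 : ℝ)) ^ (1 / 2 : ℝ) * (∫⁻ v, Ψ v ^ (2 : ℝ)) ^ (1 / 2 : ℝ)) := by
    intro v
    have m1 : Measurable fun p : V3 × S2 => angularWeight (cosV p.1 p.2) * H (v - U p) ^ (2 : ℝ) :=
      (measurable_angularWeight.comp measurable_cosV_pair).mul (by fun_prop)
    have m2 : Measurable fun p : V3 × S2 => sinWeight (cosV p.1 p.2) * Ψ (v - Z p) ^ (2 : ℝ) :=
      (measurable_sinWeight.comp measurable_cosV_pair).mul (by fun_prop)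
    calc _ ≤ ∫⁻ p, 4 * ((angularWeight (cosV p.1 p.2) * H (v - U p) ^ (2 : ℝ)) ^ (1 / 2 : ℝ) *
          (sinWeight (cosV p.1 p.2) * Ψ (v - Z p) ^ (2 : ℝ)) ^ (1 / 2 : ℝ)) ∂pairMeasure := by
          refine lintegral_mono_ae ?_
          filter_upwards [ae_cosV_mem] with p hp
          have h1 := one_le_weights hp
          rw [ENNReal.mul_rpow_of_nonneg _ _ (by norm_num),
            ENNReal.mul_rpow_of_nonneg _ _ (by norm_num), ← ENNReal.rpow_mul, ← ENNReal.rpow_mul]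
          norm_num
          calc _ = 1 * (H (v - U p) * Ψ (v - Z p)) := (one_mul _).symm
            _ ≤ _ := mul_le_mul_left h1 _
            _ = _ := by norm_num; ring
      _ = 4 * ∫⁻ p, (angularWeight (cosV p.1 p.2) * H (v - U p) ^ (2 : ℝ)) ^ (1 / 2 : ℝ) *
          (sinWeight (cosV p.1 p.2) * Ψ (v - Z p) ^ (2 : ℝ)) ^ (1 / 2 : ℝ) ∂pairMeasure :=
          lintegral_const_mul _ (by fun_prop)
      _ ≤ 4 * ((∫⁻ p, angularWeight (cosV p.1 p.2) * H (v - U p) ^ (2 : ℝ) ∂pairMeasure) ^ (1 / 2 : ℝ) *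
          (∫⁻ p, sinWeight (cosV p.1 p.2) * Ψ (v - Z p) ^ (2 : ℝ) ∂pairMeasure) ^ (1 / 2 : ℝ)) := by
          gcongr
          exact ENNReal.lintegral_mul_norm_pow_le m1.aemeasurable m2.aemeasurable (by norm_num)
            (by norm_num) (by norm_num)
      _ ≤ 4 * ((A * ∫⁻ x, H x ^ (2 : ℝ)) ^ (1 / 2 : ℝ) * (A * ∫⁻ x, Ψ x ^ (2 : ℝ)) ^ (1 / 2 : ℝ)) := by
          gcongr
          · refine (hU.bound (fun x => H (v - x) ^ (2 : ℝ)) (by fun_prop)).trans_eq ?_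
            rw [lintegral_sub_left_eq_self (fun x => H x ^ (2 : ℝ)) v]
          · refine (hZ.bound (fun x => Ψ (v - x) ^ (2 : ℝ)) (by fun_prop)).trans_eq ?_
            rw [lintegral_sub_left_eq_self (fun x => Ψ x ^ (2 : ℝ)) v]
      _ = _ := by
          rw [ENNReal.mul_rpow_of_nonneg _ _ (by norm_num),
            ENNReal.mul_rpow_of_nonneg _ _ (by norm_num), mul_mul_mul_comm, ← ENNReal.rpow_add_of_nonneg _ _ (by norm_num) (by norm_num)]
          norm_num
          ring
  calc _ ≤ ∫⁻ v, F v * (4 * (A * (∫⁻ v, H v ^ (2 : ℝ)) ^ (1 / 2 : ℝ) *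
        (∫⁻ v, Ψ v ^ (2 : ℝ)) ^ (1 / 2 : ℝ))) := by
        refine lintegral_mono fun v => ?_
        simp only [mul_assoc (F v)]
        rw [lintegral_const_mul _ (by fun_prop)]
        gcongr
        exact key v
    _ = _ := by
        rw [lintegral_mul_const _ hF]
        ring

/-- Hölder with exponents 1/2, 1/4, 1/4 on three functions, each omitting one of Ψ, F, H. The powers
4/3, 4/3, 2 are chosen so that each of F, H, Ψ recombines to its first power. Each function is then
integrated first in the variable that decouples its two factors. -/
theorem lintegral_trilinear_two {A : ℝ≥0∞} {U X Z : V3 × S2 → V3}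
    (hU : PairBound A angularWeight U) (hX : PairBound A cosWeight X)
    (hZ : PairBound A sinWeight Z) (hXZ : ∀ p, U p - Z p = X p) {F H Ψ : V3 → ℝ≥0∞}
    (hF : Measurable F) (hH : Measurable H) (hΨ : Measurable Ψ) :
    ∫⁻ q, secHalf (cosV q.2.1 q.2.2) * (F q.1 * H (q.1 + U q.2) * Ψ (q.1 + X q.2)) ∂tripleMeasure ≤
      4 * A * (∫⁻ v, F v ^ (4 / 3 : ℝ)) ^ (3 / 4 : ℝ) * (∫⁻ v, H v ^ (4 / 3 : ℝ)) ^ (3 / 4 : ℝ) *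
        (∫⁻ v, Ψ v ^ (2 : ℝ)) ^ (1 / 2 : ℝ) := by
  have hUm := hU.measurable
  have hXm := hX.measurable
  have hcos : Measurable fun q : V3 × (V3 × S2) => cosV q.2.1 q.2.2 :=
    measurable_cosV_pair.comp measurable_snd
  set f : Fin 3 → V3 × (V3 × S2) → ℝ≥0∞ := ![
    fun q => angularWeight (cosV q.2.1 q.2.2) * (F q.1 ^ (4 / 3 : ℝ) * H (q.1 + U q.2) ^ (4 / 3 : ℝ)),
    fun q => sinWeight (cosV q.2.1 q.2.2) * (H (q.1 + U q.2) ^ (4 / 3 : ℝ) * Ψ (q.1 + X q.2) ^ (2 : ℝ)),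
    fun q => cosWeight (cosV q.2.1 q.2.2) * (F q.1 ^ (4 / 3 : ℝ) * Ψ (q.1 + X q.2) ^ (2 : ℝ))] with hf
  set e : Fin 3 → ℝ := ![1 / 2, 1 / 4, 1 / 4]
  have m0 : Measurable (f 0) := (measurable_angularWeight.comp hcos).mul (by fun_prop)
  have m1 : Measurable (f 1) := (measurable_sinWeight.comp hcos).mul (by fun_prop)
  have m2 : Measurable (f 2) := (measurable_cosWeight.comp hcos).mul (by fun_prop)
  have hm : ∀ i ∈ Finset.univ, AEMeasurable (f i) tripleMeasure := by
    intro i _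
    fin_cases i
    exacts [m0.aemeasurable, m1.aemeasurable, m2.aemeasurable]
  have holder := ENNReal.lintegral_prod_norm_pow_le (μ := tripleMeasure) Finset.univ hm (p := e)
    (by simp [e, Fin.sum_univ_three]; norm_num)
    (by intro i _; fin_cases i <;> simp [e])
  simp only [Fin.prod_univ_three] at holder
  have b0 : ∫⁻ q, f 0 q ∂tripleMeasure ≤
      A * ((∫⁻ v, F v ^ (4 / 3 : ℝ)) * ∫⁻ v, H v ^ (4 / 3 : ℝ)) := by
    rw [lintegral_prod _ m0.aemeasurable]
    calc _ ≤ ∫⁻ v, F v ^ (4 / 3 : ℝ) * (A * ∫⁻ v, H v ^ (4 / 3 : ℝ)) := by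
          refine lintegral_mono fun v => ?_
          calc _ = ∫⁻ p, F v ^ (4 / 3 : ℝ) * (angularWeight (cosV p.1 p.2) *
                H (v + U p) ^ (4 / 3 : ℝ)) ∂pairMeasure :=
                lintegral_congr fun p => by simp only [hf]; exact mul_left_comm _ _ _
            _ = F v ^ (4 / 3 : ℝ) * ∫⁻ p, angularWeight (cosV p.1 p.2) *
                H (v + U p) ^ (4 / 3 : ℝ) ∂pairMeasure :=
                lintegral_const_mul _
                  ((measurable_angularWeight.comp measurable_cosV_pair).mul (by fun_prop))
            _ ≤ _ := by
                gcongr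
                refine (hU.bound (fun x => H (v + x) ^ (4 / 3 : ℝ)) (by fun_prop)).trans_eq ?_
                rw [lintegral_add_left_eq_self (fun x => H x ^ (4 / 3 : ℝ)) v]
      _ = _ := by rw [lintegral_mul_const _ (by fun_prop)]; ring
  have b2 : ∫⁻ q, f 2 q ∂tripleMeasure ≤
      A * ((∫⁻ v, F v ^ (4 / 3 : ℝ)) * ∫⁻ v, Ψ v ^ (2 : ℝ)) := by
    rw [lintegral_prod _ m2.aemeasurable]
    calc _ ≤ ∫⁻ v, F v ^ (4 / 3 : ℝ) * (A * ∫⁻ v, Ψ v ^ (2 : ℝ)) := by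
          refine lintegral_mono fun v => ?_
          calc _ = ∫⁻ p, F v ^ (4 / 3 : ℝ) * (cosWeight (cosV p.1 p.2) *
                Ψ (v + X p) ^ (2 : ℝ)) ∂pairMeasure :=
                lintegral_congr fun p => by simp only [hf]; exact mul_left_comm _ _ _
            _ = F v ^ (4 / 3 : ℝ) * ∫⁻ p, cosWeight (cosV p.1 p.2) *
                Ψ (v + X p) ^ (2 : ℝ) ∂pairMeasure :=
                lintegral_const_mul _
                  ((measurable_cosWeight.comp measurable_cosV_pair).mul (by fun_prop))
            _ ≤ _ := by
                gcongr
                refine (hX.bound (fun x => Ψ (v + x) ^ (2 : ℝ)) (by fun_prop)).trans_eq ?_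
                rw [lintegral_add_left_eq_self (fun x => Ψ x ^ (2 : ℝ)) v]
      _ = _ := by rw [lintegral_mul_const _ (by fun_prop)]; ring
  -- `F` is absent here, so v may be translated by `U`: then `H` is evaluated at v and `Ψ` at v - Z,
  -- with Z = U - X. This is where the bound on `Z` enters.
  have b1 : ∫⁻ q, f 1 q ∂tripleMeasure ≤
      A * ((∫⁻ v, H v ^ (4 / 3 : ℝ)) * ∫⁻ v, Ψ v ^ (2 : ℝ)) := by
    have hZm := hZ.measurable
    have m1' : Measurable fun q : V3 × (V3 × S2) => sinWeight (cosV q.2.1 q.2.2) *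
        (H q.1 ^ (4 / 3 : ℝ) * Ψ (q.1 - Z q.2) ^ (2 : ℝ)) :=
      (measurable_sinWeight.comp hcos).mul (by fun_prop)
    rw [lintegral_prod_symm _ m1.aemeasurable]
    calc _ = ∫⁻ p, (∫⁻ v, sinWeight (cosV p.1 p.2) *
          (H v ^ (4 / 3 : ℝ) * Ψ (v - Z p) ^ (2 : ℝ))) ∂pairMeasure := by
          refine lintegral_congr fun p => ?_
          rw [← lintegral_add_right_eq_self (fun v => sinWeight (cosV p.1 p.2) *
            (H v ^ (4 / 3 : ℝ) * Ψ (v - Z p) ^ (2 : ℝ))) (U p)]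
          refine lintegral_congr fun v => ?_
          rw [add_sub_assoc, hXZ]
          rfl
      _ = ∫⁻ v, ∫⁻ p, sinWeight (cosV p.1 p.2) *
          (H v ^ (4 / 3 : ℝ) * Ψ (v - Z p) ^ (2 : ℝ)) ∂pairMeasure := by
          rw [← lintegral_prod_symm _ m1'.aemeasurable, lintegral_prod _ m1'.aemeasurable]
      _ ≤ ∫⁻ v, H v ^ (4 / 3 : ℝ) * (A * ∫⁻ v, Ψ v ^ (2 : ℝ)) := by
          refine lintegral_mono fun v => ?_
          calc _ = ∫⁻ p, H v ^ (4 / 3 : ℝ) * (sinWeight (cosV p.1 p.2) *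
                Ψ (v - Z p) ^ (2 : ℝ)) ∂pairMeasure :=
                lintegral_congr fun p => mul_left_comm _ _ _
            _ = H v ^ (4 / 3 : ℝ) * ∫⁻ p, sinWeight (cosV p.1 p.2) *
                Ψ (v - Z p) ^ (2 : ℝ) ∂pairMeasure :=
                lintegral_const_mul _
                  ((measurable_sinWeight.comp measurable_cosV_pair).mul (by fun_prop))
            _ ≤ _ := by
                gcongr
                refine (hZ.bound (fun x => Ψ (v - x) ^ (2 : ℝ)) (by fun_prop)).trans_eq ?_
                rw [lintegral_sub_left_eq_self (fun x => Ψ x ^ (2 : ℝ)) v]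
      _ = _ := by rw [lintegral_mul_const _ (by fun_prop)]; ring
  have hcos' : ∀ᵐ q ∂tripleMeasure, cosV q.2.1 q.2.2 ∈ Ioo (-1 : ℝ) 1 :=
    Measure.quasiMeasurePreserving_snd.ae ae_cosV_mem
  calc _ ≤ ∫⁻ q, 4 * (f 0 q ^ e 0 * f 1 q ^ e 1 * f 2 q ^ e 2) ∂tripleMeasure := by
        refine lintegral_mono_ae ?_
        filter_upwards [hcos'] with q hq
        have h1 := secHalf_le_weights hq
        have split : ∀ x : ℝ≥0∞, x = (x ^ (4 / 3 : ℝ)) ^ (1 / 2 : ℝ) * (x ^ (4 / 3 : ℝ)) ^ (1 / 4 : ℝ) := by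
          intro x
          rw [← ENNReal.rpow_mul, ← ENNReal.rpow_mul,
            ← ENNReal.rpow_add_of_nonneg _ _ (by norm_num) (by norm_num)]
          norm_num
        have split' : ∀ x : ℝ≥0∞, x = (x ^ (2 : ℝ)) ^ (1 / 4 : ℝ) * (x ^ (2 : ℝ)) ^ (1 / 4 : ℝ) := by
          intro x
          rw [← ENNReal.rpow_mul, ← ENNReal.rpow_add_of_nonneg _ _ (by norm_num) (by norm_num)]
          norm_num
        calc _ ≤ _ := mul_le_mul_left h1 _
          _ = _ := by
            have hf0 : f 0 q = angularWeight (cosV q.2.1 q.2.2) *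
              (F q.1 ^ (4 / 3 : ℝ) * H (q.1 + U q.2) ^ (4 / 3 : ℝ)) := rfl
            have hf1 : f 1 q = sinWeight (cosV q.2.1 q.2.2) *
              (H (q.1 + U q.2) ^ (4 / 3 : ℝ) * Ψ (q.1 + X q.2) ^ (2 : ℝ)) := rfl
            have hf2 : f 2 q = cosWeight (cosV q.2.1 q.2.2) *
              (F q.1 ^ (4 / 3 : ℝ) * Ψ (q.1 + X q.2) ^ (2 : ℝ)) := rfl
            have he0 : e 0 = 1 / 2 := rfl
            have he1 : e 1 = 1 / 4 := rfl
            have he2 : e 2 = 1 / 4 := rfl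
            rw [hf0, hf1, hf2, he0, he1, he2]
            simp only [ENNReal.mul_rpow_of_nonneg _ _ (by norm_num : (0 : ℝ) ≤ 1 / 2),
              ENNReal.mul_rpow_of_nonneg _ _ (by norm_num : (0 : ℝ) ≤ 1 / 4)]
            nth_rw 1 [split (F q.1), split (H (q.1 + U q.2)), split' (Ψ (q.1 + X q.2))]
            ring
    _ = 4 * ∫⁻ q, f 0 q ^ e 0 * f 1 q ^ e 1 * f 2 q ^ e 2 ∂tripleMeasure :=
        lintegral_const_mul _ (((m0.pow_const _).mul (m1.pow_const _)).mul (m2.pow_const _))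
    _ ≤ 4 * ((A * ((∫⁻ v, F v ^ (4 / 3 : ℝ)) * ∫⁻ v, H v ^ (4 / 3 : ℝ))) ^ (1 / 2 : ℝ) *
        (A * ((∫⁻ v, H v ^ (4 / 3 : ℝ)) * ∫⁻ v, Ψ v ^ (2 : ℝ))) ^ (1 / 4 : ℝ) *
        (A * ((∫⁻ v, F v ^ (4 / 3 : ℝ)) * ∫⁻ v, Ψ v ^ (2 : ℝ))) ^ (1 / 4 : ℝ)) := by
        gcongr
        refine holder.trans ?_
        gcongr
        · exact ENNReal.rpow_le_rpow b0 (by simp [e])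
        · exact ENNReal.rpow_le_rpow b1 (by simp [e])
        · exact ENNReal.rpow_le_rpow b2 (by simp [e])
    _ = _ := by
        have split : ∀ x : ℝ≥0∞, x ^ (3 / 4 : ℝ) = x ^ (1 / 2 : ℝ) * x ^ (1 / 4 : ℝ) := by
          intro x
          rw [← ENNReal.rpow_add_of_nonneg _ _ (by norm_num) (by norm_num)]
          norm_num
        have split' : ∀ x : ℝ≥0∞, x ^ (1 / 2 : ℝ) = x ^ (1 / 4 : ℝ) * x ^ (1 / 4 : ℝ) := by
          intro x
          rw [← ENNReal.rpow_add_of_nonneg _ _ (by norm_num) (by norm_num)]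
          norm_num
        have hA : A = A ^ (1 / 2 : ℝ) * A ^ (1 / 4 : ℝ) * A ^ (1 / 4 : ℝ) := by
          rw [← ENNReal.rpow_add_of_nonneg _ _ (by norm_num) (by norm_num),
            ← ENNReal.rpow_add_of_nonneg _ _ (by norm_num) (by norm_num)]
          norm_num
        simp only [ENNReal.mul_rpow_of_nonneg _ _ (by norm_num : (0 : ℝ) ≤ 1 / 2),
          ENNReal.mul_rpow_of_nonneg _ _ (by norm_num : (0 : ℝ) ≤ 1 / 4)]
        rw [split, split, split' (∫⁻ v, Ψ v ^ (2 : ℝ))]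
        nth_rw 4 [hA]
        ring

/-! ### The velocity combinations of the two comparison paths -/

/-- Coefficients that are affine in the defect at the impact speed. -/
def coef (D p q : ℝ → ℝ) : ℝ → ℝ → ℝ := fun ρ s => p s + q s * D (sinHalf s * ρ)

theorem measurable_coef {D p q : ℝ → ℝ} (hD : Measurable D) (hp : Measurable p)
    (hq : Measurable q) : Measurable (Function.uncurry (coef D p q)) := by
  have := measurable_sinHalf
  unfold coef Function.uncurry
  fun_prop

theorem IsDefect.sq_radius {D : ℝ → ℝ} {c α μ ν ρ : ℝ} :
    radius D c α μ ν ρ ^ 2 =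
      ρ ^ 2 * (α ^ 2 * (1 - μ * D (c * ρ)) ^ 2 + ν ^ 2 * D (c * ρ) ^ 2) := by
  rw [radius, Real.sq_sqrt (by positivity)]
  ring

/-- The combination of `u⁺` and `u⁻` with coefficients affine in the defect. -/
def combD (D p q p' q' : ℝ → ℝ) (a : V3 × S2) : V3 := comb (coef D p q) (coef D p' q') a.1 a.2

theorem measurable_coe_pair : Measurable fun a : V3 × S2 => (a.1, (a.2 : V3)) :=
  measurable_fst.prodMk measurable_snd.subtype_coe

theorem measurable_pair {U : V3 → V3 → V3} (hU : Measurable fun p : V3 × V3 => U p.1 p.2) :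
    Measurable fun p : V3 × S2 => U p.1 p.2 := hU.comp measurable_coe_pair

theorem measurable_combD {D p q p' q' : ℝ → ℝ} (hD : Measurable D) (hp : Measurable p)
    (hq : Measurable q) (hp' : Measurable p') (hq' : Measurable q') :
    Measurable (combD D p q p' q') :=
  measurable_pair (U := comb (coef D p q) (coef D p' q'))
    (measurable_comb (measurable_coef hD hp hq) (measurable_coef hD hp' hq'))

theorem lintegral_pair_eq {f : V3 × S2 → ℝ≥0∞} (hf : Measurable f) :
    ∫⁻ a, f a ∂pairMeasure = ∫⁻ u, ∫⁻ σ, f (u, σ) ∂surface := lintegral_prod _ hf.aemeasurable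

/-- At fixed angle the squared length is ρ² times a quadratic polynomial in the defect d. Once that
polynomial has the form α²(1 - μd)² + ν²d², the length is a `radius` and `isRadial` applies. The
hypothesis on `w` absorbs the cost 8/α³. -/
theorem IsDefect.pairBound {K : ℝ} {D : ℝ → ℝ} (hD : IsDefect K D) {p q p' q' : ℝ → ℝ}
    (hp : Measurable p) (hq : Measurable q) (hp' : Measurable p') (hq' : Measurable q')
    {w : ℝ → ℝ≥0∞} (hw : Measurable w)
    (h : ∀ s ∈ Ioo (-1 : ℝ) 1, ∃ α μ ν : ℝ, 0 < α ∧ μ ∈ Icc (0 : ℝ) 1 ∧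
      (∀ d, (p s + q s * d) ^ 2 * ((1 + s) / 2) + (p' s + q' s * d) ^ 2 * ((1 - s) / 2) =
        α ^ 2 * (1 - μ * d) ^ 2 + ν ^ 2 * d ^ 2) ∧
      w s * ENNReal.ofReal (1 / (α / 2) ^ 3) ≤ 8 * angularWeight s) :
    PairBound (8 * angularConst) w (combD D p q p' q') := by
  have hx := measurable_coef hD.measurable hp hq
  have hy := measurable_coef hD.measurable hp' hq'
  have hm := measurable_combD hD.measurable hp hq hp' hq'
  refine ⟨hm, fun h' hh' => ?_⟩
  have hwm : Measurable fun a : V3 × S2 => w (cosV a.1 a.2) := hw.comp measurable_cosV_pair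
  have hhm : Measurable fun a : V3 × S2 => h' (combD D p q p' q' a) := hh'.comp hm
  refine (lintegral_pair_eq (hwm.mul hhm)).trans_le ?_
  refine lintegral_comb_le hx hy hw (fun s hs => ?_) hh'
  obtain ⟨α, μ, ν, hα, hμ, hid, hle⟩ := h s hs
  refine ⟨_, _, hD.isRadial (ν := ν) (sinHalf_pos hs) hα hμ, fun ρ hρ => ?_, hle⟩
  rw [IsDefect.sq_radius, ← hid]
  rfl

theorem ofReal_eight_mul (x : ℝ≥0∞) : x * ENNReal.ofReal (1 / (1 / 2) ^ 3) = 8 * x := by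
  rw [mul_comm]; congr 1; norm_num

theorem mul_ofReal_cube {a : ℝ} (ha : 0 < a) (x : ℝ≥0∞) :
    x * ENNReal.ofReal (a ^ 3) * ENNReal.ofReal (1 / (a / 2) ^ 3) = 8 * x := by
  rw [mul_assoc, ← ENNReal.ofReal_mul (by positivity), mul_comm]
  congr 1
  rw [show a ^ 3 * (1 / (a / 2) ^ 3) = 8 by field_simp; norm_num]
  simp

/-- `tan² (θ / 2)` as a function of `cos θ`. -/
def tanSq (s : ℝ) : ℝ := (1 - s) / (1 + s)

theorem measurable_tanSq : Measurable tanSq := by unfold tanSq; fun_prop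

theorem tanSq_nonneg {s : ℝ} (hs : s ∈ Ioo (-1 : ℝ) 1) : 0 ≤ tanSq s :=
  div_nonneg (by linarith [hs.2]) (by linarith [hs.1])

theorem tanSq_mul {s : ℝ} (hs : s ∈ Ioo (-1 : ℝ) 1) : tanSq s * (1 + s) = 1 - s :=
  div_mul_cancel₀ _ (by linarith [hs.1])

/-- `(1 - l D) u`. -/
def dilate (D : ℝ → ℝ) (l : ℝ) : V3 × S2 → V3 :=
  combD D (fun _ => 1) (fun _ => -l) (fun _ => 1) (fun _ => -l)

/-- `(1 - D) u⁻`, the displacement `v - v'`. -/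
def kick (D : ℝ → ℝ) : V3 × S2 → V3 :=
  combD D (fun _ => 0) (fun _ => 0) (fun _ => 1) (fun _ => -1)

/-- `u + l D (u⁻ - tan²(θ/2) u⁺)`, with `D` times a multiple of a rotation of `u`. -/
def twist (D : ℝ → ℝ) (l : ℝ) : V3 × S2 → V3 :=
  combD D (fun _ => 1) (fun s => -(l * tanSq s)) (fun _ => 1) (fun _ => l)

/-- `u⁺ + D u⁻`, the displacement `v' - v_*`. -/
def recoil (D : ℝ → ℝ) : V3 × S2 → V3 :=
  combD D (fun _ => 1) (fun _ => 0) (fun _ => 0) (fun _ => 1)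

/-- The difference of `twist` and `recoil`. -/
def twistKick (D : ℝ → ℝ) (l : ℝ) : V3 × S2 → V3 :=
  combD D (fun _ => 0) (fun s => -(l * tanSq s)) (fun _ => 1) (fun _ => -(1 - l))

theorem twist_sub_twistKick (D : ℝ → ℝ) (l : ℝ) (a : V3 × S2) :
    twist D l a - twistKick D l a = recoil D a := by
  simp only [twist, twistKick, recoil, combD, comb, coef]
  module

theorem measurable_jac {J : ℝ → ℝ → ℝ} (hJ : Measurable (Function.uncurry J)) :
    Measurable fun a : V3 × S2 => J ‖a.1‖ (cosV a.1 a.2) := by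
  have h : Measurable fun a : V3 × S2 => (‖a.1‖, cosV a.1 a.2) :=
    (measurable_norm.comp measurable_fst).prodMk measurable_cosV_pair
  exact hJ.comp h

namespace IsDefect

variable {K : ℝ} {D : ℝ → ℝ}

theorem pairBound_dilate (hD : IsDefect K D) {l : ℝ} (hl : l ∈ Icc (0 : ℝ) 1) :
    PairBound (8 * angularConst) angularWeight (dilate D l) := by
  refine hD.pairBound (by fun_prop) (by fun_prop) (by fun_prop) (by fun_prop)
    measurable_angularWeight fun s hs => ⟨1, l, 0, one_pos, hl, fun d => by ring, ?_⟩
  exact (ofReal_eight_mul _).le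

theorem pairBound_kick (hD : IsDefect K D) :
    PairBound (8 * angularConst) sinWeight (kick D) := by
  refine hD.pairBound (by fun_prop) (by fun_prop) (by fun_prop) (by fun_prop)
    measurable_sinWeight fun s hs =>
      ⟨sinHalf s, 1, 0, sinHalf_pos hs, ⟨zero_le_one, le_rfl⟩, fun d => ?_, ?_⟩
  · rw [sinHalf_sq hs]; ring
  · exact (mul_ofReal_cube (sinHalf_pos hs) _).le

/-- The displacement is orthogonal to `u`, since tan²(θ/2)|u⁺|² = |u⁻|². Hence the squared length is
|u|²(1 + l² tan²(θ/2) D²), and no restriction on `l` is needed. -/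
theorem pairBound_twist (hD : IsDefect K D) (l : ℝ) :
    PairBound (8 * angularConst) angularWeight (twist D l) := by
  have := measurable_tanSq
  refine hD.pairBound (by fun_prop) (by fun_prop) (by fun_prop) (by fun_prop)
    measurable_angularWeight fun s hs =>
      ⟨1, 0, l * √(tanSq s), one_pos, ⟨le_rfl, zero_le_one⟩, fun d => ?_, ?_⟩
  · rw [mul_pow l, Real.sq_sqrt (tanSq_nonneg hs)]
    linear_combination (l ^ 2 * d ^ 2 * tanSq s - 2 * l * d - l ^ 2 * d ^ 2) / 2 * tanSq_mul hs
  · exact (ofReal_eight_mul _).le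

theorem pairBound_recoil (hD : IsDefect K D) :
    PairBound (8 * angularConst) cosWeight (recoil D) := by
  refine hD.pairBound (by fun_prop) (by fun_prop) (by fun_prop) (by fun_prop)
    measurable_cosWeight fun s hs =>
      ⟨cosHalf s, 0, sinHalf s, cosHalf_pos hs, ⟨le_rfl, zero_le_one⟩, fun d => ?_, ?_⟩
  · rw [sinHalf_sq hs, cosHalf_sq hs]; ring
  · exact (mul_ofReal_cube (cosHalf_pos hs) _).le

/-- Here μ = 1 - l, which is why the path parameter is confined to [0, 1]. -/
theorem pairBound_twistKick (hD : IsDefect K D) {l : ℝ} (hl : l ∈ Icc (0 : ℝ) 1) :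
    PairBound (8 * angularConst) sinWeight (twistKick D l) := by
  have := measurable_tanSq
  refine hD.pairBound (by fun_prop) (by fun_prop) (by fun_prop) (by fun_prop)
    measurable_sinWeight fun s hs =>
      ⟨sinHalf s, 1 - l, l * √(tanSq s) * sinHalf s, sinHalf_pos hs,
        ⟨by linarith [hl.2], by linarith [hl.1]⟩, fun d => ?_, ?_⟩
  · rw [mul_pow, mul_pow l, Real.sq_sqrt (tanSq_nonneg hs), sinHalf_sq hs]
    linear_combination (l ^ 2 * d ^ 2 * tanSq s) / 2 * tanSq_mul hs
  · exact (mul_ofReal_cube (sinHalf_pos hs) _).le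

theorem norm_dilate_sq (l : ℝ) (a : V3 × S2) :
    ‖dilate D l a‖ ^ 2 = ‖a.1‖ ^ 2 * (1 - l * D (sinHalf (cosV a.1 a.2) * ‖a.1‖)) ^ 2 := by
  rw [dilate, combD, norm_comb_sq, coef]
  ring

theorem norm_twist_sq (l : ℝ) {a : V3 × S2} (ha : cosV a.1 a.2 ∈ Ioo (-1 : ℝ) 1) :
    ‖twist D l a‖ ^ 2 = ‖a.1‖ ^ 2 *
      (1 + tanSq (cosV a.1 a.2) * (l * D (sinHalf (cosV a.1 a.2) * ‖a.1‖)) ^ 2) := by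
  rw [twist, combD, norm_comb_sq, coef, coef]
  set d := D (sinHalf (cosV a.1 a.2) * ‖a.1‖)
  linear_combination (‖a.1‖ ^ 2 * (l ^ 2 * d ^ 2 * tanSq (cosV a.1 a.2) - 2 * l * d - l ^ 2 * d ^ 2) / 2) *
    tanSq_mul ha

/-- The Jacobian of the dilation `u ↦ (1 - D) u`. -/
def dilateJac (D : ℝ → ℝ) (ρ s : ℝ) : ℝ :=
  (1 - D (sinHalf s * ρ)) ^ 2 *
    (1 - (D (sinHalf s * ρ) + sinHalf s * ρ * deriv D (sinHalf s * ρ)))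

/-- The Jacobian of the map `u ↦ u + D (u⁻ - tan²(θ/2) u⁺)`, with a rotation of `σ`. -/
def twistJac (D : ℝ → ℝ) (ρ s : ℝ) : ℝ :=
  √(1 + tanSq s * D (sinHalf s * ρ) ^ 2) * (1 + tanSq s * D (sinHalf s * ρ) *
    (D (sinHalf s * ρ) + sinHalf s * ρ * deriv D (sinHalf s * ρ)))

theorem measurable_dilateJac (hD : IsDefect K D) : Measurable (Function.uncurry (dilateJac D)) := by
  have h1 := measurable_sinHalf
  have h2 := hD.measurable
  have h3 := measurable_deriv D
  unfold dilateJac Function.uncurry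
  fun_prop

theorem measurable_twistJac (hD : IsDefect K D) : Measurable (Function.uncurry (twistJac D)) := by
  have h1 := measurable_sinHalf
  have h2 := hD.measurable
  have h3 := measurable_deriv D
  have h4 := measurable_tanSq
  unfold twistJac Function.uncurry
  fun_prop

/-- The dilation multiplies u and u⁻ by the same factor 1 - D and keeps the angle; the radial map is
z(ρ) = ρ(1 - D). -/
theorem lintegral_dilate (hD : IsDefect K D) {F : V3 × V3 → ℝ≥0∞} (hF : Measurable F) :
    ∫⁻ a, ENNReal.ofReal (dilateJac D ‖a.1‖ (cosV a.1 a.2)) * F (dilate D 1 a, kick D a)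
      ∂pairMeasure = ∫⁻ a, F (a.1, um a.1 a.2) ∂pairMeasure := by
  have hc1 : Measurable (Function.uncurry (coef D (fun _ => 1) fun _ => -1)) :=
    measurable_coef hD.measurable (by fun_prop) (by fun_prop)
  have hc2 : Measurable (Function.uncurry (coef D (fun _ => 0) fun _ => 0)) :=
    measurable_coef hD.measurable (by fun_prop) (by fun_prop)
  have m1 := (hD.pairBound_dilate (l := 1) ⟨zero_le_one, le_rfl⟩).measurable
  have m2 := hD.pairBound_kick.measurable
  have m3 : Measurable fun a : V3 × S2 => dilateJac D ‖a.1‖ (cosV a.1 a.2) :=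
    measurable_jac hD.measurable_dilateJac
  have m4 : Measurable fun a : V3 × S2 => um a.1 a.2 := by unfold um; fun_prop
  rw [lintegral_prod _ (by fun_prop), lintegral_prod _ (by fun_prop)]
  refine lintegral_change hc1 hc1 hc2 hc1 hD.measurable_dilateJac (fun s hs => ?_) hF
  have hμ : (1 : ℝ) ∈ Icc (0 : ℝ) 1 := ⟨zero_le_one, le_rfl⟩
  have hc := sinHalf_pos hs
  refine ⟨_, radius D (sinHalf s) 1 1 0, hD.isRadial hc one_pos hμ,
    hD.image_radius hc one_pos hμ le_rfl, fun ρ hρ => ?_⟩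
  have hz := (hD.isRadial (ν := 0) hc one_pos hμ).map_pos ρ hρ
  rw [(hD.hasDerivAt_radius hc one_pos hμ hρ).deriv]
  have hzz : radius D (sinHalf s) 1 1 0 ρ = ρ * (1 - D (sinHalf s * ρ)) := by
    have := hD.half_le_one_sub hμ (sinHalf s * ρ)
    rw [← sq_eq_sq₀ hz.le (mul_nonneg hρ.le (by linarith)), IsDefect.sq_radius]
    ring
  have hne : (1 - D (sinHalf s * ρ)) ≠ 0 := by
    have := hD.half_le_one_sub hμ (sinHalf s * ρ)
    linarith
  rw [hzz]
  simp only [coef, dilateJac]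
  refine ⟨by ring, by ring, by ring, ?_⟩
  field_simp
  ring

/-- With ũ⁺ = u⁺ + D u⁻ prescribed, ũ⁻ must be orthogonal to it with length tan(θ/2)|ũ⁺| for the
angle to survive. The choice u⁻ - D tan²(θ/2) u⁺ does this, and the sum of the two is `twist D 1`.
The radial map is ρ√(1 + tan²(θ/2) D²). -/
theorem lintegral_twist (hD : IsDefect K D) {F : V3 × V3 → ℝ≥0∞} (hF : Measurable F) :
    ∫⁻ a, ENNReal.ofReal (twistJac D ‖a.1‖ (cosV a.1 a.2)) * F (twist D 1 a, twistKick D 1 a)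
      ∂pairMeasure = ∫⁻ a, F (a.1, um a.1 a.2) ∂pairMeasure := by
  have m0 := measurable_tanSq
  have m1 := (hD.pairBound_twist 1).measurable
  have m2 := (hD.pairBound_twistKick (l := 1) ⟨zero_le_one, le_rfl⟩).measurable
  have m3 : Measurable fun a : V3 × S2 => twistJac D ‖a.1‖ (cosV a.1 a.2) :=
    measurable_jac hD.measurable_twistJac
  have m4 : Measurable fun a : V3 × S2 => um a.1 a.2 := by unfold um; fun_prop
  rw [lintegral_prod _ (by fun_prop), lintegral_prod _ (by fun_prop)]
  refine lintegral_change (measurable_coef hD.measurable (by fun_prop) (by fun_prop))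
    (measurable_coef hD.measurable (by fun_prop) (by fun_prop))
    (measurable_coef hD.measurable (by fun_prop) (by fun_prop))
    (measurable_coef hD.measurable (by fun_prop) (by fun_prop))
    hD.measurable_twistJac (fun s hs => ?_) hF
  have hμ : (0 : ℝ) ∈ Icc (0 : ℝ) 1 := ⟨le_rfl, zero_le_one⟩
  have hc := sinHalf_pos hs
  have hT := tanSq_nonneg hs
  refine ⟨_, radius D (sinHalf s) 1 0 (√(tanSq s)), hD.isRadial hc one_pos hμ,
    hD.image_radius hc one_pos hμ (Real.sqrt_nonneg _), fun ρ hρ => ?_⟩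
  have hz := (hD.isRadial (ν := √(tanSq s)) hc one_pos hμ).map_pos ρ hρ
  rw [(hD.hasDerivAt_radius hc one_pos hμ hρ).deriv]
  have hsq : radius D (sinHalf s) 1 0 (√(tanSq s)) ρ ^ 2 =
      ρ ^ 2 * (1 + tanSq s * D (sinHalf s * ρ) ^ 2) := by
    rw [IsDefect.sq_radius, Real.sq_sqrt hT]
    ring
  have hzz : radius D (sinHalf s) 1 0 (√(tanSq s)) ρ =
      ρ * √(1 + tanSq s * D (sinHalf s * ρ) ^ 2) := by
    rw [← sq_eq_sq₀ hz.le (by positivity), hsq, mul_pow, Real.sq_sqrt (by positivity)]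
  have key := tanSq_mul hs
  set d := D (sinHalf s * ρ) with hd
  refine ⟨?_, ?_, ?_, ?_⟩
  · rw [hsq]
    simp only [coef, ← hd]
    linear_combination (ρ ^ 2 * (d ^ 2 * tanSq s - 2 * d - d ^ 2) / 2) * key
  · rw [hsq]
    simp only [coef, ← hd]
    linear_combination (ρ ^ 2 * (d ^ 2 * tanSq s) / 2) * key
  · rw [hsq]
    simp only [coef, ← hd]
    linear_combination (ρ ^ 2 * (d ^ 2 * tanSq s - d) / 2) * key
  · have h1 : ∀ y : ℝ, radius D (sinHalf s) 1 0 (√(tanSq s)) ρ ^ 2 *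
        (y / radius D (sinHalf s) 1 0 (√(tanSq s)) ρ) =
        radius D (sinHalf s) 1 0 (√(tanSq s)) ρ * y := fun y => by
      field_simp
    rw [h1, hzz, Real.sq_sqrt hT, twistJac, ← hd]
    ring

end IsDefect

/-! ### Weak gradients and finite differences -/

theorem HasWeakGradient.congr {g g' : V3 → ℝ} {G G' : V3 → V3} (h : HasWeakGradient g G)
    (hg : g =ᵐ[volume] g') (hG : G =ᵐ[volume] G') : HasWeakGradient g' G' where
  locallyIntegrable := h.locallyIntegrable.congr hg
  locallyIntegrable_grad := h.locallyIntegrable_grad.congr hG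
  parts φ hφ hc w := by
    have h1 : ∫ v, g' v * fderiv ℝ φ v w = ∫ v, g v * fderiv ℝ φ v w :=
      integral_congr_ae (hg.mono fun x hx => by beta_reduce; rw [hx])
    have h2 : ∫ v, ⟪G' v, w⟫ * φ v = ∫ v, ⟪G v, w⟫ * φ v :=
      integral_congr_ae (hG.mono fun x hx => by beta_reduce; rw [hx])
    rw [h1, h2, h.parts φ hφ hc w]

/-- The unit interval as a measure space of path parameters. -/
abbrev unitMeasure : Measure ℝ := volume.restrict (Icc (0 : ℝ) 1)

theorem measurePreserving_shear (d : V3) :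
    MeasurePreserving (fun p : ℝ × V3 => (p.1, p.2 + p.1 • d)) (unitMeasure.prod volume)
      (unitMeasure.prod (volume : Measure V3)) := by
  refine (MeasurePreserving.id unitMeasure).skew_product (g := fun l x => x + l • d)
    (by fun_prop) (ae_of_all _ fun l => ?_)
  exact (measurePreserving_add_right volume (l • d)).map_eq

theorem integrable_shear {E : Type*} [NormedAddCommGroup E] [NormedSpace ℝ E] {G : V3 → E}
    (hG : Integrable G) (d : V3) :
    Integrable (fun p : ℝ × V3 => G (p.2 + p.1 • d)) (unitMeasure.prod volume) := by
  have h : Integrable (fun p : ℝ × V3 => G p.2) (unitMeasure.prod volume) := hG.comp_snd _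
  exact (measurePreserving_shear d).integrable_comp_of_integrable h

theorem integral_fderiv_segment {φ : V3 → ℝ} (hφ : ContDiff ℝ ∞ φ) (d x : V3) :
    φ (x - d) - φ x = -∫ l in Icc (0 : ℝ) 1, fderiv ℝ φ (x - l • d) d := by
  have hd : ∀ l : ℝ, HasDerivAt (fun l : ℝ => φ (x - l • d)) (-fderiv ℝ φ (x - l • d) d) l := by
    intro l
    have h1 : HasDerivAt (fun l : ℝ => x - l • d) (-d) l := by
      simpa using ((hasDerivAt_id l).smul_const d).const_sub x
    have h2 := (hφ.differentiable (by simp) (x - l • d)).hasFDerivAt.comp_hasDerivAt l h1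
    rw [map_neg] at h2
    exact h2
  have hcont : Continuous fun l : ℝ => -fderiv ℝ φ (x - l • d) d := by
    have := hφ.continuous_fderiv (by simp)
    fun_prop
  have := intervalIntegral.integral_eq_sub_of_hasDerivAt (a := 0) (b := 1) (fun l _ => hd l)
    (hcont.intervalIntegrable _ _)
  simp only [one_smul, zero_smul, sub_zero] at this
  rw [← this, intervalIntegral.integral_neg, intervalIntegral.integral_of_le zero_le_one,
    integral_Icc_eq_integral_Ioc]

/-- The translation is moved onto the test function, whose increment is the integral of its
derivative along the segment. The weak gradient is used for each translate `φ (· - l • d)`, and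
translating back puts the segment into `G`. -/
theorem HasWeakGradient.integral_sub_smul {g : V3 → ℝ} {G : V3 → V3} (h : HasWeakGradient g G)
    (d : V3) {φ : V3 → ℝ} (hφ : ContDiff ℝ ∞ φ) (hc : HasCompactSupport φ) :
    ∫ x, φ x * (g (x + d) - g x) =
      ∫ x, φ x * ∫ l in Icc (0 : ℝ) 1, ⟪G (x + l • d), d⟫ := by
  obtain ⟨R, hR⟩ := hc.isCompact.isBounded.subset_closedBall (0 : V3)
  -- The functions `g` and `G` are only locally integrable. This ball contains every segment point
  -- that meets the support of `φ`, so cutting off to it changes nothing and makes Fubini available.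
  set B : Set V3 := closedBall 0 (R + ‖d‖)
  have hB : MeasurableSet B := measurableSet_closedBall
  have hgi : Integrable (B.indicator g) :=
    (integrable_indicator_iff hB).2 (h.locallyIntegrable.integrableOn_isCompact (isCompact_closedBall _ _))
  have hGi : Integrable (B.indicator G) :=
    (integrable_indicator_iff hB).2 (h.locallyIntegrable_grad.integrableOn_isCompact (isCompact_closedBall _ _))
  have hmem : ∀ x, φ x ≠ 0 → x ∈ closedBall (0 : V3) R := fun x hx => hR (subset_tsupport _ hx)
  have hmemB : ∀ x (l : ℝ), l ∈ Icc (0 : ℝ) 1 → φ x ≠ 0 → x + l • d ∈ B := by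
    intro x l hl hx
    have h1 := hmem x hx
    simp only [B, mem_closedBall, dist_zero_right] at h1 ⊢
    refine (norm_add_le _ _).trans (add_le_add h1 ?_)
    rw [norm_smul, Real.norm_of_nonneg hl.1]
    exact mul_le_of_le_one_left (norm_nonneg _) hl.2
  have hdc : Continuous fun p : ℝ × V3 => fderiv ℝ φ (p.2 - p.1 • d) d := by
    have := hφ.continuous_fderiv (by simp)
    fun_prop
  obtain ⟨M, hM⟩ := (hc.fderiv (𝕜 := ℝ)).exists_bound_of_continuous (hφ.continuous_fderiv (by simp))
  obtain ⟨N, hN⟩ := hc.exists_bound_of_continuous hφ.continuous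
  have hint1 : Integrable (fun p : ℝ × V3 => B.indicator g p.2 * fderiv ℝ φ (p.2 - p.1 • d) d)
      (unitMeasure.prod volume) := by
    refine (hgi.comp_snd _).mul_bdd (c := M * ‖d‖) hdc.aestronglyMeasurable (ae_of_all _ fun p => ?_)
    exact (ContinuousLinearMap.le_opNorm _ _).trans
      (mul_le_mul_of_nonneg_right (hM _) (norm_nonneg _))
  have hint2 : Integrable (fun p : ℝ × V3 => φ p.2 * ⟪B.indicator G (p.2 + p.1 • d), d⟫)
      (unitMeasure.prod volume) := by
    have h1 : Integrable (fun p : ℝ × V3 => ⟪B.indicator G (p.2 + p.1 • d), d⟫)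
      (unitMeasure.prod volume) := (integrable_shear hGi d).inner_const d
    exact h1.bdd_mul (c := N) (hφ.continuous.comp continuous_snd).aestronglyMeasurable
      (ae_of_all _ fun p => hN _)
  have hφg : ∀ y : V3, ‖y‖ ≤ ‖d‖ → Integrable fun x => φ (x - y) * g x := by
    intro y hy
    have h1 : Integrable fun x => φ (x - y) * B.indicator g x :=
      hgi.bdd_mul (c := N) (by have := hφ.continuous; fun_prop) (ae_of_all _ fun p => hN _)
    refine h1.congr (ae_of_all _ fun x => ?_)
    by_cases hx : φ (x - y) = 0
    · simp [hx]
    · have h2 := hmem _ hx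
      have : x ∈ B := by
        simp only [B, mem_closedBall, dist_zero_right] at h2 ⊢
        calc ‖x‖ = ‖(x - y) + y‖ := by simp
          _ ≤ _ := (norm_add_le _ _).trans (add_le_add h2 hy)
      simp [this]
  have i0 : Integrable fun x => φ x * g x := by simpa using hφg 0 (by simp)
  have i1 : Integrable fun x => φ x * g (x + d) := by
    have := (hφg d le_rfl).comp_add_right d
    simpa using this
  calc ∫ x, φ x * (g (x + d) - g x) = ∫ x, (φ (x - d) - φ x) * g x := by
        simp only [mul_sub, sub_mul]
        rw [integral_sub i1 i0, integral_sub (hφg d le_rfl) i0,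
          ← integral_add_right_eq_self (fun x => φ (x - d) * g x) d]
        simp
    _ = ∫ x, -∫ l in Icc (0 : ℝ) 1, B.indicator g x * fderiv ℝ φ (x - l • d) d := by
        congr 1; ext x
        rw [integral_fderiv_segment hφ, neg_mul, mul_comm, ← integral_const_mul]
        congr 1
        refine setIntegral_congr_fun measurableSet_Icc fun l hl => ?_
        by_cases hx : x ∈ B
        · simp [hx]
        · have : x - l • d ∉ tsupport φ := by
            intro hx'
            apply hx
            have h1 := hR hx'
            simp only [B, mem_closedBall, dist_zero_right] at h1 ⊢
            calc ‖x‖ = ‖(x - l • d) + l • d‖ := by simp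
              _ ≤ _ := norm_add_le _ _
              _ ≤ _ := by
                refine add_le_add h1 ?_
                rw [norm_smul, Real.norm_of_nonneg hl.1]
                exact mul_le_of_le_one_left (norm_nonneg _) hl.2
          have h0 : fderiv ℝ φ (x - l • d) = 0 := by
            by_contra hne
            exact this (support_fderiv_subset ℝ hne)
          simp [h0]
    _ = -∫ l in Icc (0 : ℝ) 1, ∫ x, B.indicator g x * fderiv ℝ φ (x - l • d) d := by
        rw [integral_neg, integral_integral_swap]
        exact hint1.swap
    _ = ∫ l in Icc (0 : ℝ) 1, ∫ x, φ x * ⟪B.indicator G (x + l • d), d⟫ := by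
        rw [← integral_neg]
        refine setIntegral_congr_fun measurableSet_Icc fun l hl => ?_
        have hφl : ContDiff ℝ ∞ fun x => φ (x - l • d) := hφ.comp (contDiff_id.sub contDiff_const)
        have hcl : HasCompactSupport fun x => φ (x - l • d) :=
          hc.comp_homeomorph (Homeomorph.subRight (l • d))
        have := h.parts _ hφl hcl d
        simp only [fderiv_comp_sub] at this
        have e1 : ∀ x, B.indicator g x * fderiv ℝ φ (x - l • d) d = g x * fderiv ℝ φ (x - l • d) d := by
          intro x
          by_cases hx : fderiv ℝ φ (x - l • d) = 0
          · simp [hx]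
          · have h1 := hR (support_fderiv_subset ℝ hx)
            have : x ∈ B := by
              simp only [B, mem_closedBall, dist_zero_right] at h1 ⊢
              calc ‖x‖ = ‖(x - l • d) + l • d‖ := by simp
                _ ≤ _ := norm_add_le _ _
                _ ≤ _ := by
                  refine add_le_add h1 ?_
                  rw [norm_smul, Real.norm_of_nonneg hl.1]
                  exact mul_le_of_le_one_left (norm_nonneg _) hl.2
            simp [this]
        simp only [e1]
        rw [this, neg_neg, ← integral_add_right_eq_self _ (l • d)]
        congr 1; ext x
        simp only [add_sub_cancel_right]
        by_cases hx : φ x = 0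
        · simp [hx]
        · simp [hmemB x l hl hx, mul_comm]
    _ = ∫ x, ∫ l in Icc (0 : ℝ) 1, φ x * ⟪B.indicator G (x + l • d), d⟫ :=
        integral_integral_swap hint2
    _ = _ := by
        congr 1; ext x
        rw [← integral_const_mul]
        refine setIntegral_congr_fun measurableSet_Icc fun l hl => ?_
        by_cases hx : φ x = 0
        · simp [hx]
        · simp [hmemB x l hl hx]

theorem locallyIntegrable_segment {G : V3 → V3} (hG : LocallyIntegrable G) (d : V3) :
    LocallyIntegrable fun x => ∫ l in Icc (0 : ℝ) 1, ⟪G (x + l • d), d⟫ := by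
  rw [locallyIntegrable_iff]
  intro K hK
  obtain ⟨R, hR⟩ := hK.isBounded.subset_closedBall (0 : V3)
  set B : Set V3 := closedBall 0 (R + ‖d‖)
  have hB : MeasurableSet B := measurableSet_closedBall
  have hGi : Integrable (B.indicator G) :=
    (integrable_indicator_iff hB).2 (hG.integrableOn_isCompact (isCompact_closedBall _ _))
  have h1 : Integrable (fun p : ℝ × V3 => ⟪B.indicator G (p.2 + p.1 • d), d⟫)
    (unitMeasure.prod volume) := (integrable_shear hGi d).inner_const d
  refine (h1.integral_prod_right.integrableOn (s := K)).congr_fun (fun x hx => ?_) hK.measurableSet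
  refine setIntegral_congr_fun measurableSet_Icc fun l hl => ?_
  have : x + l • d ∈ B := by
    have h1 := hR hx
    simp only [B, mem_closedBall, dist_zero_right] at h1 ⊢
    refine (norm_add_le _ _).trans (add_le_add h1 ?_)
    rw [norm_smul, Real.norm_of_nonneg hl.1]
    exact mul_le_of_le_one_left (norm_nonneg _) hl.2
  simp [this]

/-- A Sobolev function is almost everywhere controlled along a translation by the integral of its
gradient over the segment. -/
theorem HasWeakGradient.ae_enorm_sub_le {g : V3 → ℝ} {G : V3 → V3} (h : HasWeakGradient g G)
    (d : V3) : ∀ᵐ x, ‖g (x + d) - g x‖ₑ ≤ ‖d‖ₑ * ∫⁻ l in Icc (0 : ℝ) 1, ‖G (x + l • d)‖ₑ := by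
  have hl : LocallyIntegrable fun x => g (x + d) - g x := by
    refine LocallyIntegrable.sub ?_ h.locallyIntegrable
    rw [locallyIntegrable_iff]
    intro K hK
    have h1 := h.locallyIntegrable.integrableOn_isCompact
      (hK.image (f := fun x => x + d) (by fun_prop))
    rw [← (measurePreserving_add_right volume d).integrableOn_comp_preimage
      (measurableEmbedding_addRight d)] at h1
    refine h1.mono_set (subset_preimage_image _ _)
  have key := ae_eq_of_integral_contDiff_smul_eq hl
    (locallyIntegrable_segment h.locallyIntegrable_grad d) (fun φ hφ hc => by
      simpa only [smul_eq_mul] using h.integral_sub_smul d hφ hc)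
  filter_upwards [key] with x hx
  rw [hx]
  refine (enorm_integral_le_lintegral_enorm _).trans ?_
  rw [← lintegral_const_mul' _ _ enorm_ne_top]
  refine lintegral_mono fun l => ?_
  rw [mul_comm]
  have := norm_inner_le_norm (𝕜 := ℝ) (G (x + l • d)) d
  simp only [← ofReal_norm]
  rw [← ENNReal.ofReal_mul (norm_nonneg _)]
  exact ENNReal.ofReal_le_ofReal this

/-! ### Boundedness of the angular kernel -/

theorem abs_setIntegral_mul_le {b' : ℝ → ℝ} (hb' : IntegrableOn b' (Ioo (-1 : ℝ) 1))
    {Φ : ℝ → ℝ} {M : ℝ} (hM : ∀ s, |Φ s| ≤ M) :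
    |∫ s in Ioo (-1 : ℝ) 1, b' s * Φ s| ≤ (∫ s in Ioo (-1 : ℝ) 1, |b' s|) * M := by
  rw [← integral_mul_const]
  have hi : Integrable (fun s => |b' s|) (volume.restrict (Ioo (-1 : ℝ) 1)) := hb'.abs
  rw [← Real.norm_eq_abs]
  refine norm_integral_le_of_norm_le (hi.mul_const M) (ae_of_all _ fun s => ?_)
  rw [Real.norm_eq_abs, abs_mul]
  exact mul_le_mul_of_nonneg_left (hM s) (abs_nonneg _)

/-- Subtracting from ψ a multiple of a fixed bump leaves mean zero, so the primitive Φ is a test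
function, with sup norm at most 2‖ψ‖₁. Integration by parts against Φ bounds the pairing by ‖b'‖₁,
uniformly in `a`. This is the embedding of W^{1,1} into L^∞ in dual form. -/
theorem HasWeakDeriv.exists_pairing_bound {b b' : ℝ → ℝ} (hb : IntegrableOn b (Ioo (-1 : ℝ) 1))
    (hb' : IntegrableOn b' (Ioo (-1 : ℝ) 1)) (h : HasWeakDeriv b b') :
    ∃ C : ℝ, ∀ a : ℝ, 1 / 2 ≤ a → a < 1 → ∀ ψ : ℝ → ℝ, ContDiff ℝ ∞ ψ →
      Function.support ψ ⊆ Icc (-a) a →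
      |∫ s in Ioo (-1 : ℝ) 1, b s * ψ s| ≤ C * ∫ s, |ψ s| := by
  -- The bump does not depend on `a`; its support lies in [-1/2, 1/2], hence the requirement 1/2 ≤
  -- a.
  let χ₀ : ContDiffBump (0 : ℝ) := ⟨1 / 4, 1 / 2, by norm_num, by norm_num⟩
  set χ : ℝ → ℝ := χ₀.normed volume with hχ
  have χc : ContDiff ℝ ∞ χ := χ₀.contDiff_normed
  have χi : ∫ s, χ s = 1 := χ₀.integral_normed
  have χs : Function.support χ ⊆ Icc (-(1 / 2)) (1 / 2) := by
    rw [hχ, χ₀.support_normed_eq, Real.ball_eq_Ioo]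
    simpa [χ₀] using Ioo_subset_Icc_self
  have χn : ∀ s, 0 ≤ χ s := fun s => χ₀.nonneg_normed s
  refine ⟨|∫ s in Ioo (-1 : ℝ) 1, b s * χ s| + (∫ s in Ioo (-1 : ℝ) 1, |b' s|) * 2, ?_⟩
  intro a ha ha1 ψ hψ hs
  have hcs : ∀ f : ℝ → ℝ, Function.support f ⊆ Icc (-a) a → HasCompactSupport f := fun f hf =>
    HasCompactSupport.of_support_subset_isCompact isCompact_Icc hf
  have χs' : Function.support χ ⊆ Icc (-a) a := χs.trans (Icc_subset_Icc (by linarith) ha)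
  have ψi : Integrable ψ := hψ.continuous.integrable_of_hasCompactSupport (hcs ψ hs)
  have χint : Integrable χ := χc.continuous.integrable_of_hasCompactSupport (hcs χ χs')
  set c : ℝ := ∫ s, ψ s with hc
  have hcle : |c| ≤ ∫ s, |ψ s| := abs_integral_le_integral_abs
  set ρ : ℝ → ℝ := fun s => ψ s - c * χ s with hρ
  have ρc : ContDiff ℝ ∞ ρ := hψ.sub (contDiff_const.mul χc)
  have ρi : Integrable ρ := ψi.sub (χint.const_mul c)
  have ρs : ∀ s, s ∉ Icc (-a) a → ρ s = 0 := by
    intro s hs'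
    have h1 : ψ s = 0 := by
      by_contra hne
      exact hs' (hs hne)
    have h2 : χ s = 0 := by
      by_contra hne
      exact hs' (χs' hne)
    simp [hρ, h1, h2]
  have ρ0 : ∫ s, ρ s = 0 := by
    rw [hρ, integral_sub ψi (χint.const_mul c), integral_const_mul, χi]
    simp [hc]
  set Φ : ℝ → ℝ := fun s => ∫ t in (-1 : ℝ)..s, ρ t with hΦ
  have Φd : ∀ s, HasDerivAt Φ (ρ s) s := fun s =>
    intervalIntegral.integral_hasDerivAt_right (ρc.continuous.intervalIntegrable _ _)
      (ρc.continuous.stronglyMeasurableAtFilter _ _) ρc.continuous.continuousAt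
  have Φderiv : deriv Φ = ρ := funext fun s => (Φd s).deriv
  have Φc : ContDiff ℝ ∞ Φ := by
    rw [contDiff_infty_iff_deriv, Φderiv]
    exact ⟨fun s => (Φd s).differentiableAt, ρc⟩
  have Φs : Function.support Φ ⊆ Icc (-a) a := by
    intro s hs'
    by_contra hns
    apply hs'
    rw [mem_Icc, not_and_or, not_le, not_le] at hns
    simp only [hΦ]
    rcases hns with hns | hns
    · rw [intervalIntegral.integral_congr (g := fun _ => 0), intervalIntegral.integral_zero]
      intro t ht
      refine ρs t fun hta => ?_
      rcases le_total (-1) s with h1 | h1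
      · rw [uIcc_of_le h1] at ht
        linarith [ht.2, hta.1]
      · rw [uIcc_of_ge h1] at ht
        linarith [ht.2, hta.1]
    · rw [intervalIntegral.integral_of_le (by linarith), setIntegral_eq_integral_of_forall_compl_eq_zero, ρ0]
      intro t ht
      refine ρs t fun hta => ht ⟨by linarith [hta.1], by linarith [hta.2]⟩
  have Φb : ∀ s, |Φ s| ≤ 2 * ∫ s, |ψ s| := by
    intro s
    have h1 : |Φ s| ≤ ∫ t, |ρ t| := by
      have h2 : ‖∫ t in (-1 : ℝ)..s, ρ t‖ ≤ ∫ t in uIoc (-1) s, ‖ρ t‖ :=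
        intervalIntegral.norm_integral_le_integral_norm_uIoc
      exact h2.trans (setIntegral_le_integral ρi.norm (ae_of_all _ fun t => norm_nonneg _))
    have h2 : ∫ t, |ρ t| ≤ ∫ t, (|ψ t| + |c| * χ t) := by
      refine integral_mono ρi.abs (ψi.abs.add (χint.const_mul _)) fun t => ?_
      have := abs_sub (ψ t) (c * χ t)
      rw [abs_mul, abs_of_nonneg (χn t)] at this
      exact this
    rw [integral_add ψi.abs (χint.const_mul _), integral_const_mul, χi] at h2
    linarith
  have hts : tsupport Φ ⊆ Ioo (-1) 1 :=
    (closure_minimal Φs isClosed_Icc).trans (Icc_subset_Ioo (by linarith) ha1)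
  have key := h Φ Φc (hcs Φ Φs) hts
  rw [Φderiv] at key
  obtain ⟨N1, hN1⟩ := (hcs ψ hs).exists_bound_of_continuous hψ.continuous
  obtain ⟨N2, hN2⟩ := (hcs χ χs').exists_bound_of_continuous χc.continuous
  have j1 : IntegrableOn (fun s => b s * ψ s) (Ioo (-1 : ℝ) 1) :=
    hb.mul_bdd (c := N1) hψ.continuous.aestronglyMeasurable (ae_of_all _ hN1)
  have j2 : IntegrableOn (fun s => b s * χ s) (Ioo (-1 : ℝ) 1) :=
    hb.mul_bdd (c := N2) χc.continuous.aestronglyMeasurable (ae_of_all _ hN2)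
  have e1 : ∫ s in Ioo (-1 : ℝ) 1, b s * ρ s =
      (∫ s in Ioo (-1 : ℝ) 1, b s * ψ s) - c * ∫ s in Ioo (-1 : ℝ) 1, b s * χ s := by
    rw [← integral_const_mul, ← integral_sub j1 (j2.const_mul c)]
    congr 1; ext s
    simp only [hρ]; ring
  rw [e1, sub_eq_iff_eq_add] at key
  rw [key]
  have hb'Φ := abs_setIntegral_mul_le hb' Φb
  calc _ ≤ |-∫ s in Ioo (-1 : ℝ) 1, b' s * Φ s| + |c * ∫ s in Ioo (-1 : ℝ) 1, b s * χ s| :=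
        abs_add_le _ _
    _ ≤ (∫ s in Ioo (-1 : ℝ) 1, |b' s|) * (2 * ∫ s, |ψ s|) +
        (∫ s, |ψ s|) * |∫ s in Ioo (-1 : ℝ) 1, b s * χ s| := by
        rw [abs_neg, abs_mul]
        gcongr
    _ = _ := by ring

/-- Mollifiers have L¹ norm one, so the pairing bound controls every mollification of `b` near an
interior point. By Lebesgue differentiation the mollifications converge to `b` almost everywhere. -/
theorem HasWeakDeriv.exists_ae_bound {b b' : ℝ → ℝ} (hb : IntegrableOn b (Ioo (-1 : ℝ) 1))
    (hb' : IntegrableOn b' (Ioo (-1 : ℝ) 1)) (h : HasWeakDeriv b b') :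
    ∃ C : ℝ, ∀ᵐ s ∂(volume.restrict (Ioo (-1 : ℝ) 1)), |b s| ≤ C := by
  obtain ⟨C, hC⟩ := h.exists_pairing_bound hb hb'
  refine ⟨C, ?_⟩
  set f : ℝ → ℝ := (Ioo (-1 : ℝ) 1).indicator b with hf
  have hfi : Integrable f := (integrable_indicator_iff measurableSet_Ioo).2 hb
  let φ : ℕ → ContDiffBump (0 : ℝ) := fun n =>
    ⟨1 / ((n : ℝ) + 1), 2 * (1 / ((n : ℝ) + 1)), by positivity, by
      have : 0 < 1 / ((n : ℝ) + 1) := by positivity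
      linarith⟩
  have hlim : Tendsto (fun n => (φ n).rOut) atTop (𝓝 0) := by
    have := (tendsto_one_div_add_atTop_nhds_zero_nat (𝕜 := ℝ)).const_mul 2
    rw [mul_zero] at this
    exact this
  have hae := ContDiffBump.ae_convolution_tendsto_right_of_locallyIntegrable (μ := volume)
    (φ := φ) (l := atTop) (K := 2) hlim (Eventually.of_forall fun n => le_rfl)
    hfi.locallyIntegrable
  rw [ae_restrict_iff' measurableSet_Ioo]
  filter_upwards [hae] with x hx hxI
  have hfx : f x = b x := indicator_of_mem hxI _
  rw [hfx] at hx
  refine le_of_tendsto hx.abs ?_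
  -- A number strictly between |x| and 1, leaving room for the translated bumps once their radius is
  -- small.
  set a : ℝ := max (1 / 2) ((1 + |x|) / 2) with ha
  have hx1 : |x| < 1 := abs_lt.2 hxI
  have ha1 : a < 1 := max_lt (by norm_num) (by linarith)
  have hlt : ∀ᶠ n in atTop, (φ n).rOut < a - |x| :=
    hlim.eventually_lt_const (by
      have : (1 + |x|) / 2 ≤ a := le_max_right _ _
      linarith)
  filter_upwards [hlt] with n hn
  have hψ : ContDiff ℝ ∞ fun t => (φ n).normed volume (x - t) :=
    (φ n).contDiff_normed.comp (contDiff_const.sub contDiff_id)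
  have := hC a (le_max_left _ _) ha1 _ hψ (by
    intro t ht
    have h1 : x - t ∈ Function.support ((φ n).normed volume) := ht
    rw [(φ n).support_normed_eq, mem_ball, dist_zero_right, Real.norm_eq_abs] at h1
    refine abs_le.1 ?_
    have := abs_sub_abs_le_abs_sub t x
    rw [abs_sub_comm] at this
    linarith)
  have e1 : ∫ t, |(φ n).normed volume (x - t)| = 1 := by
    simp only [abs_of_nonneg ((φ n).nonneg_normed _)]
    rw [integral_sub_left_eq_self (fun t => (φ n).normed volume t) volume x]
    exact (φ n).integral_normed
  rw [e1, mul_one] at this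
  refine (congrArg abs ?_).trans_le this
  rw [convolution_eq_swap, ← integral_indicator measurableSet_Ioo]
  congr 1; ext t
  by_cases ht : t ∈ Ioo (-1 : ℝ) 1
  · simp [hf, ht, mul_comm]
  · simp [hf, ht]

/-- Setting `b` to zero where the essential bound fails gives a measurable version bounded at every
point, so later estimates need no exceptional set for the kernel. -/
theorem IsAngularKernel.exists_bounded {b : ℝ → ℝ} (hb : IsAngularKernel b) :
    ∃ (b₁ : ℝ → ℝ) (B : ℝ), Measurable b₁ ∧ 0 ≤ B ∧ (∀ s, |b₁ s| ≤ B) ∧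
      ∀ᵐ s ∂(volume.restrict (Ioo (-1 : ℝ) 1)), b s = b₁ s := by
  obtain ⟨b', hb', h⟩ := hb.weakDeriv
  obtain ⟨C, hC⟩ := h.exists_ae_bound hb.integrable hb'
  refine ⟨{s | |b s| ≤ C}.indicator b, |C|, hb.measurable.indicator
    (measurableSet_le hb.measurable.abs measurable_const), abs_nonneg _, fun s => ?_, ?_⟩
  · by_cases hs : |b s| ≤ C
    · simpa [indicator, hs] using hs.trans (le_abs_self C)
    · simp [indicator, hs]
  · filter_upwards [hC] with s hs
    simp [indicator, hs]

/-! ### Polynomial weights -/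

theorem weight_pos (s : ℝ) (v : V3) : 0 < weight s v := by unfold weight; positivity

theorem measurable_weight (s : ℝ) : Measurable (weight s) := by unfold weight; fun_prop

theorem weight_add (s t : ℝ) (v : V3) : weight (s + t) v = weight s v * weight t v := by
  rw [weight, weight, weight, ← Real.rpow_add (by positivity)]
  ring_nf

theorem weight_mono {s t : ℝ} (h : s ≤ t) (v : V3) : weight s v ≤ weight t v := by
  refine Real.rpow_le_rpow_of_exponent_le ?_ (by linarith)
  nlinarith [norm_nonneg v]

theorem weight_zero (v : V3) : weight 0 v = 1 := by simp [weight]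

theorem weight_neg_mul (s : ℝ) (v : V3) : weight (-s) v * weight s v = 1 := by
  rw [← weight_add, neg_add_cancel, weight_zero]

theorem weight_eq_rpow (s : ℝ) (v : V3) : weight s v = weight 1 v ^ s := by
  rw [weight, weight, ← Real.rpow_mul (by positivity)]
  ring_nf

theorem one_le_weight {s : ℝ} (hs : 0 ≤ s) (v : V3) : 1 ≤ weight s v := by
  rw [← weight_zero v]
  exact weight_mono hs v

theorem weight_one_sq (v : V3) : weight 1 v ^ 2 = 1 + ‖v‖ ^ 2 := by
  rw [weight, ← Real.sqrt_eq_rpow, Real.sq_sqrt (by positivity)]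

theorem norm_le_weight_one (v : V3) : ‖v‖ ≤ weight 1 v :=
  le_of_sq_le_sq (by rw [weight_one_sq]; linarith) (weight_pos 1 v).le

theorem weight_one_le (v : V3) : weight 1 v ≤ 1 + ‖v‖ :=
  le_of_sq_le_sq (by rw [weight_one_sq]; nlinarith [norm_nonneg v]) (by positivity)

/-- The weights of two incoming velocities dominate powers of the relative speed and the weight of
an outgoing velocity. -/
theorem one_add_rpow_le {p q ρ : ℝ} (hp : 0 ≤ p) (hq : 0 ≤ q) (hρ : 0 ≤ ρ) {x y z : V3}
    (hxy : ρ ≤ 2 * ‖x - y‖) (hz : ‖z - x‖ ≤ 2 * ρ) :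
    (1 + ρ) ^ p ≤ 5 ^ p * 10 ^ q * (weight (q + p) x * weight (q + p) y * weight (-q) z) := by
  set A := weight 1 x
  set B := weight 1 y
  have hA : 1 ≤ A := one_le_weight zero_le_one x
  have hB : 1 ≤ B := one_le_weight zero_le_one y
  have hxA : ‖x‖ ≤ A := norm_le_weight_one x
  have hyB : ‖y‖ ≤ B := norm_le_weight_one y
  have hAB : A ≤ A * B := le_mul_of_one_le_right (by linarith) hB
  have hBA : B ≤ A * B := le_mul_of_one_le_left (by linarith) hA
  have hsub := norm_sub_le x y
  -- As A, B ≥ 1, one has ρ ≤ 2(A + B) ≤ 4AB, hence 5AB; then ‖z‖ ≤ 2ρ + A ≤ 9AB, hence 10AB for the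
  -- weight of z.
  have h1 : 1 + ρ ≤ 5 * (A * B) := by linarith
  have h2 : weight 1 z ≤ 10 * (A * B) := by
    have := weight_one_le z
    have h3 : ‖z‖ ≤ ‖z - x‖ + ‖x‖ := by simpa using norm_add_le (z - x) x
    linarith
  have h3 : (1 + ρ) ^ p * weight q z ≤ (5 * (A * B)) ^ p * (10 * (A * B)) ^ q := by
    rw [weight_eq_rpow q z]
    have := (weight_pos 1 z).le
    gcongr
  have h4 : (5 * (A * B)) ^ p * (10 * (A * B)) ^ q =
      5 ^ p * 10 ^ q * (weight (q + p) x * weight (q + p) y) := by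
    have hA0 : 0 < A := by linarith
    have hB0 : 0 < B := by linarith
    rw [weight_eq_rpow _ x, weight_eq_rpow _ y, Real.rpow_add hA0, Real.rpow_add hB0,
      Real.mul_rpow (x := 5) (by norm_num) (mul_pos hA0 hB0).le,
      Real.mul_rpow (x := 10) (by norm_num) (mul_pos hA0 hB0).le,
      Real.mul_rpow hA0.le hB0.le, Real.mul_rpow hA0.le hB0.le]
    ring
  calc (1 + ρ) ^ p = (1 + ρ) ^ p * weight q z * weight (-q) z := by
        rw [mul_assoc, mul_comm (weight q z), weight_neg_mul, mul_one]
    _ ≤ 5 ^ p * 10 ^ q * (weight (q + p) x * weight (q + p) y) * weight (-q) z := by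
        rw [← h4]
        exact mul_le_mul_of_nonneg_right h3 (weight_pos _ _).le
    _ = _ := by ring

/-- The weight as an extended nonnegative real. -/
def eweight (s : ℝ) (v : V3) : ℝ≥0∞ := ENNReal.ofReal (weight s v)

theorem measurable_eweight (s : ℝ) : Measurable (eweight s) := (measurable_weight s).ennreal_ofReal

theorem eweight_add (s t : ℝ) (v : V3) : eweight (s + t) v = eweight s v * eweight t v := by
  rw [eweight, weight_add, ENNReal.ofReal_mul (weight_pos _ _).le]; rfl

theorem eweight_mono {s t : ℝ} (h : s ≤ t) (v : V3) : eweight s v ≤ eweight t v :=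
  ENNReal.ofReal_le_ofReal (weight_mono h v)

/-- The weighted Lebesgue norm of a nonnegative function. -/
def weightNorm (p s : ℝ) (h : V3 → ℝ≥0∞) : ℝ≥0∞ := (∫⁻ v, (eweight s v * h v) ^ p) ^ (1 / p)

theorem eLpNorm_eq_weightNorm {E : Type*} [NormedAddCommGroup E] [NormedSpace ℝ E] {p : ℝ}
    (hp : 0 < p) (s : ℝ) (f : V3 → E) :
    eLpNorm (fun v => weight s v • f v) (ENNReal.ofReal p) volume =
      weightNorm p s fun v => ‖f v‖ₑ := by
  rw [eLpNorm_eq_lintegral_rpow_enorm_toReal (by simpa using hp) ENNReal.ofReal_ne_top,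
    ENNReal.toReal_ofReal hp.le, weightNorm]
  simp only [enorm_smul, Real.enorm_of_nonneg (weight_pos _ _).le]
  rfl

theorem normLpW_one_eq (s : ℝ) (f : V3 → ℝ) :
    normLpW 1 s f = weightNorm 1 s fun v => ‖f v‖ₑ := by
  rw [← eLpNorm_eq_weightNorm one_pos]; simp [normLpW]

theorem normLpW_two_eq (s : ℝ) (f : V3 → ℝ) :
    normLpW 2 s f = weightNorm 2 s fun v => ‖f v‖ₑ := by
  rw [← eLpNorm_eq_weightNorm two_pos]; simp [normLpW]

theorem weightNorm_mono {p s t : ℝ} (hp : 0 < p) (hst : s ≤ t) (h : V3 → ℝ≥0∞) :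
    weightNorm p s h ≤ weightNorm p t h := by
  unfold weightNorm
  gcongr with v
  exact eweight_mono hst v

theorem lintegral_eweight_lt_top {s : ℝ} (hs : s < -3) : ∫⁻ v, eweight s v < ⊤ := by
  have h := integrable_rpow_neg_one_add_norm_sq (E := V3) (μ := volume) (r := -s)
    (by simp; linarith)
  simp only [neg_neg] at h
  exact h.lintegral_lt_top

theorem eweight_rpow (s : ℝ) {p : ℝ} (hp : 0 ≤ p) (v : V3) : eweight s v ^ p = eweight (s * p) v := by
  rw [eweight, ENNReal.ofReal_rpow_of_nonneg (weight_pos _ _).le hp, eweight, weight_eq_rpow,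
    ← Real.rpow_mul (weight_pos _ _).le, ← weight_eq_rpow]

/-- Hölder's inequality trades weights for integrability. -/
theorem weightNorm_le_two {p r s t : ℝ} (hp : 0 < p) (hr : 0 < r) (hpr : 1 / p = 1 / 2 + 1 / r)
    {h : V3 → ℝ≥0∞} (hh : Measurable h) :
    weightNorm p s h ≤ (∫⁻ v, eweight ((s - t) * r) v) ^ (1 / r) * weightNorm 2 t h := by
  have hp2 : p < 2 := by
    rw [← one_div_lt_one_div two_pos hp]
    have : 0 < 1 / r := by positivity
    linarith
  have m1 : Measurable fun v => eweight t v * h v := (measurable_eweight t).mul hh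
  have key := ENNReal.lintegral_Lp_mul_le_Lq_mul_Lr hp hp2 hpr volume
    m1.aemeasurable (measurable_eweight (s - t)).aemeasurable
  rw [mul_comm]
  unfold weightNorm
  simp only [Pi.mul_apply, eweight_rpow _ hr.le] at key
  convert key using 5 with v
  rw [mul_right_comm, ← eweight_add, add_sub_cancel]

/-! ### Weighted trilinear estimates -/

namespace IsDefect

variable {K : ℝ} {D : ℝ → ℝ}

theorem norm_kick_le (hD : IsDefect K D) {a : V3 × S2} (ha : cosV a.1 a.2 ∈ Ioo (-1 : ℝ) 1) :
    ‖kick D a‖ ≤ 2 * ‖a.1‖ := by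
  refine le_of_sq_le_sq ?_ (by positivity)
  rw [kick, combD, norm_comb_sq, coef, coef]
  have h0 := hD.nonneg (sinHalf (cosV a.1 a.2) * ‖a.1‖)
  have h1 := hD.le_half (sinHalf (cosV a.1 a.2) * ‖a.1‖)
  have : (1 + -1 * D (sinHalf (cosV a.1 a.2) * ‖a.1‖)) ^ 2 ≤ 1 := by nlinarith
  rw [mul_pow, mul_comm (2 ^ 2 : ℝ)]
  refine mul_le_mul_of_nonneg_left ?_ (sq_nonneg _)
  nlinarith [ha.1, ha.2]

theorem norm_recoil_le (hD : IsDefect K D) {a : V3 × S2} (ha : cosV a.1 a.2 ∈ Ioo (-1 : ℝ) 1) :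
    ‖recoil D a‖ ≤ 2 * ‖a.1‖ := by
  refine le_of_sq_le_sq ?_ (by positivity)
  rw [recoil, combD, norm_comb_sq, coef, coef]
  have h0 := hD.nonneg (sinHalf (cosV a.1 a.2) * ‖a.1‖)
  have h1 := hD.le_half (sinHalf (cosV a.1 a.2) * ‖a.1‖)
  have : (0 + 1 * D (sinHalf (cosV a.1 a.2) * ‖a.1‖)) ^ 2 ≤ 1 := by nlinarith
  rw [mul_pow, mul_comm (2 ^ 2 : ℝ)]
  refine mul_le_mul_of_nonneg_left ?_ (sq_nonneg _)
  nlinarith [ha.1, ha.2]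

theorem le_norm_dilate (hD : IsDefect K D) {l : ℝ} (hl : l ∈ Icc (0 : ℝ) 1) (a : V3 × S2) :
    ‖a.1‖ ≤ 2 * ‖dilate D l a‖ := by
  refine le_of_sq_le_sq ?_ (by positivity)
  rw [mul_pow, norm_dilate_sq]
  have := hD.half_le_one_sub hl (sinHalf (cosV a.1 a.2) * ‖a.1‖)
  have h2 : 1 ≤ 4 * (1 - l * D (sinHalf (cosV a.1 a.2) * ‖a.1‖)) ^ 2 := by nlinarith
  nlinarith [sq_nonneg ‖a.1‖]

theorem le_norm_twist (l : ℝ) {a : V3 × S2} (ha : cosV a.1 a.2 ∈ Ioo (-1 : ℝ) 1) :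
    ‖a.1‖ ≤ ‖twist D l a‖ := by
  refine le_of_sq_le_sq ?_ (by positivity)
  rw [norm_twist_sq l ha]
  refine le_mul_of_one_le_right (sq_nonneg _) ?_
  have := mul_nonneg (tanSq_nonneg ha) (sq_nonneg (l * D (sinHalf (cosV a.1 a.2) * ‖a.1‖)))
  linarith

end IsDefect

/-- The growth factor `(1 + |u|)^p`. -/
def growth (p : ℝ) (u : V3) : ℝ≥0∞ := ENNReal.ofReal ((1 + ‖u‖) ^ p)

theorem measurable_growth (p : ℝ) : Measurable (growth p) := by unfold growth; fun_prop

/-- The constant in the comparison of weights. -/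
def weightConst (p q : ℝ) : ℝ≥0∞ := ENNReal.ofReal (5 ^ p * 10 ^ q)

theorem growth_le {p q : ℝ} (hp : 0 ≤ p) (hq : 0 ≤ q) {u x y z : V3}
    (hxy : ‖u‖ ≤ 2 * ‖x - y‖) (hz : ‖z - x‖ ≤ 2 * ‖u‖) :
    growth p u ≤ weightConst p q * (eweight (q + p) x * eweight (q + p) y * eweight (-q) z) := by
  have h1 := (weight_pos (q + p) x).le
  have h2 := (weight_pos (q + p) y).le
  have h3 := (weight_pos (-q) z).le
  rw [growth, weightConst, eweight, eweight, eweight, ← ENNReal.ofReal_mul h1,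
    ← ENNReal.ofReal_mul (by positivity), ← ENNReal.ofReal_mul (by positivity)]
  exact ENNReal.ofReal_le_ofReal (one_add_rpow_le hp hq (norm_nonneg u) hxy hz)

theorem ae_triple_cosV_mem : ∀ᵐ q ∂tripleMeasure, cosV q.2.1 q.2.2 ∈ Ioo (-1 : ℝ) 1 :=
  Measure.quasiMeasurePreserving_snd.ae ae_cosV_mem

/-- The powers of |u| and the weight dual to that of v' are both charged to the two other
velocities. This is legitimate because the dilated vector is at least half as long as u and the kick
is at most twice as long. -/
theorem IsDefect.weighted_one {K : ℝ} {D : ℝ → ℝ} (hD : IsDefect K D) {l p q : ℝ}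
    (hl : l ∈ Icc (0 : ℝ) 1) (hp : 0 ≤ p) (hq : 0 ≤ q) {F H Ψ : V3 → ℝ≥0∞}
    (hF : Measurable F) (hH : Measurable H) (hΨ : Measurable Ψ) :
    ∫⁻ a, growth p a.2.1 * (F a.1 * H (a.1 - dilate D l a.2) * Ψ (a.1 - kick D a.2))
      ∂tripleMeasure ≤ weightConst p q * (32 * angularConst) * weightNorm 1 (q + p) F *
        weightNorm 2 (q + p) H * weightNorm 2 (-q) Ψ := by
  have mF : Measurable fun v => eweight (q + p) v * F v := (measurable_eweight _).mul hF
  have mH : Measurable fun v => eweight (q + p) v * H v := (measurable_eweight _).mul hH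
  have mΨ : Measurable fun v => eweight (-q) v * Ψ v := (measurable_eweight _).mul hΨ
  have key := lintegral_trilinear_one (hD.pairBound_dilate hl) hD.pairBound_kick mF mH mΨ
  calc _ ≤ ∫⁻ a, weightConst p q * ((eweight (q + p) a.1 * F a.1) *
        (eweight (q + p) (a.1 - dilate D l a.2) * H (a.1 - dilate D l a.2)) *
        (eweight (-q) (a.1 - kick D a.2) * Ψ (a.1 - kick D a.2))) ∂tripleMeasure := by
        refine lintegral_mono_ae ?_
        filter_upwards [ae_triple_cosV_mem] with a ha
        have h1 : ‖a.2.1‖ ≤ 2 * ‖a.1 - (a.1 - dilate D l a.2)‖ := by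
          rw [sub_sub_cancel]; exact hD.le_norm_dilate hl a.2
        have h2 : ‖(a.1 - kick D a.2) - a.1‖ ≤ 2 * ‖a.2.1‖ := by
          rw [sub_sub_cancel_left, norm_neg]; exact hD.norm_kick_le ha
        calc _ ≤ _ := mul_le_mul_left (growth_le hp hq h1 h2) _
          _ = _ := by ring
    _ = weightConst p q * ∫⁻ a, ((eweight (q + p) a.1 * F a.1) *
        (eweight (q + p) (a.1 - dilate D l a.2) * H (a.1 - dilate D l a.2)) *
        (eweight (-q) (a.1 - kick D a.2) * Ψ (a.1 - kick D a.2))) ∂tripleMeasure :=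
        lintegral_const_mul' _ _ ENNReal.ofReal_ne_top
    _ ≤ weightConst p q * _ := mul_le_mul_right key _
    _ = _ := by
        unfold weightNorm
        simp only [ENNReal.rpow_one, div_one]
        ring

theorem IsDefect.weighted_two {K : ℝ} {D : ℝ → ℝ} (hD : IsDefect K D) {l p q : ℝ}
    (hl : l ∈ Icc (0 : ℝ) 1) (hp : 0 ≤ p) (hq : 0 ≤ q) {F H Ψ : V3 → ℝ≥0∞}
    (hF : Measurable F) (hH : Measurable H) (hΨ : Measurable Ψ) :
    ∫⁻ a, secHalf (cosV a.2.1 a.2.2) * (growth p a.2.1 *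
      (F a.1 * H (a.1 + twist D l a.2) * Ψ (a.1 + recoil D a.2)))
      ∂tripleMeasure ≤ weightConst p q * (32 * angularConst) * weightNorm (4 / 3) (q + p) F *
        weightNorm (4 / 3) (q + p) H * weightNorm 2 (-q) Ψ := by
  have mF : Measurable fun v => eweight (q + p) v * F v := (measurable_eweight _).mul hF
  have mH : Measurable fun v => eweight (q + p) v * H v := (measurable_eweight _).mul hH
  have mΨ : Measurable fun v => eweight (-q) v * Ψ v := (measurable_eweight _).mul hΨ
  have key := lintegral_trilinear_two (hD.pairBound_twist l) hD.pairBound_recoil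
    (hD.pairBound_twistKick hl) (twist_sub_twistKick D l) mF mH mΨ
  calc _ ≤ ∫⁻ a, weightConst p q * (secHalf (cosV a.2.1 a.2.2) * ((eweight (q + p) a.1 * F a.1) *
        (eweight (q + p) (a.1 + twist D l a.2) * H (a.1 + twist D l a.2)) *
        (eweight (-q) (a.1 + recoil D a.2) * Ψ (a.1 + recoil D a.2)))) ∂tripleMeasure := by
        refine lintegral_mono_ae ?_
        filter_upwards [ae_triple_cosV_mem] with a ha
        have h1 : ‖a.2.1‖ ≤ 2 * ‖a.1 - (a.1 + twist D l a.2)‖ := by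
          rw [sub_add_cancel_left, norm_neg]
          linarith [IsDefect.le_norm_twist (D := D) l ha, norm_nonneg (twist D l a.2)]
        have h2 : ‖(a.1 + recoil D a.2) - a.1‖ ≤ 2 * ‖a.2.1‖ := by
          rw [add_sub_cancel_left]; exact hD.norm_recoil_le ha
        calc _ ≤ secHalf (cosV a.2.1 a.2.2) * _ :=
              mul_le_mul_right (mul_le_mul_left (growth_le hp hq h1 h2) _) _
          _ = _ := by ring
    _ = weightConst p q * ∫⁻ a, (secHalf (cosV a.2.1 a.2.2) * ((eweight (q + p) a.1 * F a.1) *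
        (eweight (q + p) (a.1 + twist D l a.2) * H (a.1 + twist D l a.2)) *
        (eweight (-q) (a.1 + recoil D a.2) * Ψ (a.1 + recoil D a.2)))) ∂tripleMeasure :=
        lintegral_const_mul' _ _ ENNReal.ofReal_ne_top
    _ ≤ weightConst p q * _ := mul_le_mul_right key _
    _ = _ := by
        unfold weightNorm
        norm_num
        ring

/-! ### Existence of the gain term -/

/-- The parametrisation of collisions by `(v, (u, σ))` with `u = v - v_*`. -/
def tripleCoord (a : V3 × (V3 × S2)) : (V3 × V3) × S2 := ((a.1, a.1 - a.2.1), a.2.2)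

/-- The measure `dv dv_* dσ`. -/
abbrev collisionMeasure : Measure ((V3 × V3) × S2) :=
  ((volume : Measure V3).prod (volume : Measure V3)).prod surface

theorem measurePreserving_tripleCoord :
    MeasurePreserving tripleCoord tripleMeasure collisionMeasure := by
  have h1 : MeasurePreserving (fun p : V3 × V3 => (p.1, p.1 - p.2)) (volume.prod volume)
      ((volume : Measure V3).prod volume) := by
    refine (MeasurePreserving.id volume).skew_product (g := fun v u => v - u)
      (by fun_prop) (ae_of_all _ fun v => ?_)
    exact (Measure.measurePreserving_sub_left volume v).map_eq
  have h2 : MeasurePreserving (MeasurableEquiv.prodAssoc.symm : V3 × (V3 × S2) ≃ᵐ (V3 × V3) × S2)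
      tripleMeasure collisionMeasure :=
    (measurePreserving_prodAssoc (volume : Measure V3) (volume : Measure V3) surface).symm
  exact (h1.prod (MeasurePreserving.id surface)).comp h2

theorem collisionDensity_tripleCoord (b : ℝ → ℝ) (f g : V3 → ℝ) (a : V3 × (V3 × S2)) :
    collisionDensity b f g (tripleCoord a) =
      f a.1 * g (a.1 - a.2.1) * ‖a.2.1‖ * b (cosV a.2.1 a.2.2) := by
  simp only [collisionDensity, tripleCoord, sub_sub_cancel]
  rfl

/-- Since (1 + e)/2 = 1 - D, the displacement is (1 - D)u⁻, with the impact speed written as |u|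
sin(θ/2). -/
theorem postVelocity_eq {e D : ℝ → ℝ} (hDe : ∀ r, 0 ≤ r → e r = 1 - 2 * D r)
    (a : V3 × (V3 × S2)) :
    postVelocity e (tripleCoord a).1.1 (tripleCoord a).1.2 (tripleCoord a).2 =
      a.1 - kick D a.2 := by
  have h : impact a.2.1 a.2.2 = sinHalf (cosV a.2.1 a.2.2) * ‖a.2.1‖ := mul_comm _ _
  simp only [postVelocity, tripleCoord, sub_sub_cancel, h, kick, combD, comb, coef, um]
  rw [hDe _ (mul_nonneg (sinHalf_nonneg _) (norm_nonneg _))]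
  module

/-- The density sought is the Radon–Nikodym derivative of the image of `m μ` under `P`, which is
absolutely continuous because `P` is nonsingular. -/
theorem exists_pushforward_of_nonneg {α : Type*} [MeasurableSpace α] {μ : Measure α} {m : α → ℝ}
    (hm : Integrable m μ) (h0 : ∀ a, 0 ≤ m a) {P : α → V3}
    (hP : Measure.QuasiMeasurePreserving P μ volume) :
    ∃ Q : V3 → ℝ, Integrable Q ∧ ∀ ψ : V3 → ℝ, Measurable ψ →
      ∫ v, Q v * ψ v = ∫ a, m a * ψ (P a) ∂μ := by
  set ν := (μ.withDensity fun a => ENNReal.ofReal (m a)).map P with hν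
  have hfin : IsFiniteMeasure (μ.withDensity fun a => ENNReal.ofReal (m a)) :=
    isFiniteMeasure_withDensity_ofReal hm.2
  have hac : ν ≪ volume :=
    ((withDensity_absolutelyContinuous μ _).map hP.measurable).trans hP.absolutelyContinuous
  refine ⟨fun v => (ν.rnDeriv volume v).toReal, Measure.integrable_toReal_rnDeriv, fun ψ hψ => ?_⟩
  have h1 := integral_rnDeriv_smul hac (f := ψ)
  simp only [smul_eq_mul] at h1
  rw [h1, hν, integral_map hP.measurable.aemeasurable hψ.aestronglyMeasurable,
    integral_withDensity_eq_integral_toReal_smul₀ hm.1.aemeasurable.ennreal_ofReal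
      (ae_of_all _ fun _ => ENNReal.ofReal_lt_top)]
  simp [ENNReal.toReal_ofReal, h0]

/-- An integrable density is transported to an integrable density by a nonsingular map. -/
theorem exists_pushforward {α : Type*} [MeasurableSpace α] {μ : Measure α} {m : α → ℝ}
    (hm : Integrable m μ) {P : α → V3} (hP : Measure.QuasiMeasurePreserving P μ volume) :
    ∃ Q : V3 → ℝ, Integrable Q ∧ ∀ ψ : V3 → ℝ, Measurable ψ → ∀ M : ℝ, (∀ v, |ψ v| ≤ M) →
      ∫ v, Q v * ψ v = ∫ a, m a * ψ (P a) ∂μ := by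
  obtain ⟨Q₁, hi₁, h₁⟩ := exists_pushforward_of_nonneg hm.pos_part (fun _ => le_max_right _ _) hP
  obtain ⟨Q₂, hi₂, h₂⟩ := exists_pushforward_of_nonneg hm.neg_part (fun _ => le_max_right _ _) hP
  refine ⟨fun v => Q₁ v - Q₂ v, hi₁.sub hi₂, fun ψ hψ M hM => ?_⟩
  have hM' : ∀ v, ‖ψ v‖ ≤ M := hM
  have hψP : AEStronglyMeasurable (fun a => ψ (P a)) μ :=
    (hψ.comp hP.measurable).aestronglyMeasurable
  simp only [sub_mul]
  rw [integral_sub (hi₁.mul_bdd (c := M) hψ.aestronglyMeasurable (ae_of_all _ hM'))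
    (hi₂.mul_bdd (c := M) hψ.aestronglyMeasurable (ae_of_all _ hM')), h₁ ψ hψ, h₂ ψ hψ,
    ← integral_sub (hm.pos_part.mul_bdd (c := M) hψP (ae_of_all _ fun a => hM' _))
      (hm.neg_part.mul_bdd (c := M) hψP (ae_of_all _ fun a => hM' _))]
  congr 1; ext a
  rw [← sub_mul, max_comm, max_comm (-m a), ← max_zero_sub_max_neg_zero_eq_self (m a)]
  simp [max_comm]

/-- For frozen (u, σ) the map is a translation in v, so preimages of null sets are null for any
measurable `X`. The collision map itself needs no Jacobian. -/
theorem quasiMeasurePreserving_translate {X : V3 × S2 → V3} (hX : Measurable X) :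
    Measure.QuasiMeasurePreserving (fun a : V3 × (V3 × S2) => a.1 + X a.2) tripleMeasure volume := by
  refine ⟨by fun_prop, Measure.AbsolutelyContinuous.mk fun s hs h0 => ?_⟩
  have hm : Measurable fun a : V3 × (V3 × S2) => a.1 + X a.2 := by fun_prop
  rw [Measure.map_apply hm hs, Measure.prod_apply_symm (hm hs), lintegral_eq_zero_iff
    (measurable_measure_prodMk_right (hm hs))]
  refine ae_of_all _ fun p => ?_
  change volume ((fun x => x + X p) ⁻¹' s) = 0
  rw [measure_preimage_add_right, h0]

/-- The gain term exists as an integrable function, and its weak form extends to bounded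
measurable test functions. -/
theorem exists_isGain {e b D : ℝ → ℝ} {f g : V3 → ℝ} (hD : Measurable D)
    (hDe : ∀ r, 0 ≤ r → e r = 1 - 2 * D r)
    (hi : Integrable (collisionDensity b f g) collisionMeasure) :
    ∃ Q, IsGain e b f g Q ∧ Integrable Q ∧ ∀ ψ : V3 → ℝ, Measurable ψ → ∀ M : ℝ,
      (∀ v, |ψ v| ≤ M) → ∫ v, Q v * ψ v =
        ∫ a, collisionDensity b f g (tripleCoord a) * ψ (a.1 - kick D a.2) ∂tripleMeasure := by
  have hk : Measurable (kick D) :=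
    measurable_combD hD (by fun_prop) (by fun_prop) (by fun_prop) (by fun_prop)
  have hP : Measure.QuasiMeasurePreserving (fun a : V3 × (V3 × S2) => a.1 - kick D a.2)
      tripleMeasure volume := by
    simp only [sub_eq_add_neg]
    exact quasiMeasurePreserving_translate hk.neg
  have hi' := measurePreserving_tripleCoord.integrable_comp_of_integrable hi
  obtain ⟨Q, hQ, h⟩ := exists_pushforward hi' hP
  refine ⟨Q, ⟨hi, hQ.locallyIntegrable, fun ψ hψ hc => ?_⟩, hQ, h⟩
  obtain ⟨M, hM⟩ := hc.exists_bound_of_continuous hψ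
  rw [h ψ hψ.measurable M hM]
  have hcoll : AEStronglyMeasurable (fun p => collisionDensity b f g p *
      ψ (postVelocity e p.1.1 p.1.2 p.2)) collisionMeasure := by
    refine hi.1.mul (AEStronglyMeasurable.congr (f := fun p : (V3 × V3) × S2 =>
      ψ (p.1.1 - kick D (p.1.1 - p.1.2, p.2))) ?_ (ae_of_all _ fun p => ?_))
    · refine Measurable.aestronglyMeasurable (hψ.measurable.comp (measurable_fst.fst.sub
        (hk.comp ((measurable_fst.fst.sub measurable_fst.snd).prodMk measurable_snd))))
    · have := postVelocity_eq hDe (p.1.1, (p.1.1 - p.1.2, p.2))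
      simp only [tripleCoord, sub_sub_cancel] at this
      simp only [this]
  rw [← measurePreserving_tripleCoord.map_eq] at hcoll
  change _ = ∫ p, collisionDensity b f g p * ψ (postVelocity e p.1.1 p.1.2 p.2) ∂collisionMeasure
  rw [← measurePreserving_tripleCoord.map_eq,
    integral_map measurePreserving_tripleCoord.measurable.aemeasurable hcoll]
  simp only [postVelocity_eq hDe]
  rfl

theorem IsGain.gain {e b : ℝ → ℝ} {f g Q : V3 → ℝ} (h : IsGain e b f g Q) :
    IsGain e b f g (Granular.gain e b f g) := by
  have hex : ∃ Q, IsGain e b f g Q := ⟨Q, h⟩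
  rw [Granular.gain, dif_pos hex]
  exact hex.choose_spec

/-- Equality of the predicates themselves, not mere equivalence for each candidate, makes the choice
in `gain` return the same function. Data may then be replaced by measurable or bounded versions. -/
theorem isGain_congr {b b' : ℝ → ℝ} {f g f' g' : V3 → ℝ}
    (h : collisionDensity b f g =ᵐ[collisionMeasure] collisionDensity b' f' g') (e : ℝ → ℝ) :
    IsGain e b f g = IsGain e b' f' g' := by
  have hψ : ∀ ψ : V3 → ℝ, ∫ p, collisionDensity b f g p * ψ (postVelocity e p.1.1 p.1.2 p.2)
      ∂collisionMeasure = ∫ p, collisionDensity b' f' g' p * ψ (postVelocity e p.1.1 p.1.2 p.2)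
      ∂collisionMeasure := fun ψ =>
    integral_congr_ae (h.mono fun p hp => by beta_reduce; rw [hp])
  funext Q
  refine propext ⟨fun hQ => ⟨(integrable_congr h).1 hQ.1, hQ.2, fun ψ h1 h2 => ?_⟩,
    fun hQ => ⟨(integrable_congr h).2 hQ.1, hQ.2, fun ψ h1 h2 => ?_⟩⟩
  · rw [hQ.3 ψ h1 h2]; exact hψ ψ
  · rw [hQ.3 ψ h1 h2]; exact (hψ ψ).symm

open Classical in
theorem gain_congr {b b' : ℝ → ℝ} {f g f' g' : V3 → ℝ}
    (h : collisionDensity b f g =ᵐ[collisionMeasure] collisionDensity b' f' g') (e : ℝ → ℝ) :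
    gain e b f g = gain e b' f' g' := by
  have key : ∀ P P' : (V3 → ℝ) → Prop, P = P' →
      (if h : ∃ Q, P Q then h.choose else 0) = if h : ∃ Q, P' Q then h.choose else 0 := by
    rintro P _ rfl
    rfl
  exact key _ _ (isGain_congr h e)

theorem ae_cosV {P : ℝ → Prop} (hm : MeasurableSet {s | P s})
    (hP : ∀ᵐ s ∂(volume.restrict (Ioo (-1 : ℝ) 1)), P s) :
    ∀ᵐ p ∂pairMeasure, P (cosV p.1 p.2) := by
  have hm' : MeasurableSet {p : V3 × S2 | P (cosV p.1 p.2)} := measurable_cosV_pair hm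
  rw [Measure.ae_prod_iff_ae_ae hm']
  filter_upwards [compl_mem_ae_iff.2 (measure_singleton (0 : V3))] with u hu
  have hu : u ≠ 0 := hu
  refine ae_dot ⟨‖u‖⁻¹ • u, ?_⟩ hP
  simp [norm_smul, hu]

theorem collisionDensity_congr {b b' : ℝ → ℝ} {f g f' g' : V3 → ℝ} (hb : Measurable b)
    (hb' : Measurable b') (hbb : ∀ᵐ s ∂(volume.restrict (Ioo (-1 : ℝ) 1)), b s = b' s)
    (hf : f =ᵐ[volume] f') (hg : g =ᵐ[volume] g') :
    collisionDensity b f g =ᵐ[collisionMeasure] collisionDensity b' f' g' := by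
  have h1 : ∀ᵐ p ∂collisionMeasure, f p.1.1 = f' p.1.1 :=
    (Measure.quasiMeasurePreserving_fst.comp Measure.quasiMeasurePreserving_fst).ae hf
  have h2 : ∀ᵐ p ∂collisionMeasure, g p.1.2 = g' p.1.2 :=
    (Measure.quasiMeasurePreserving_snd.comp Measure.quasiMeasurePreserving_fst).ae hg
  have hmc : Measurable fun p : (V3 × V3) × S2 => cosAngle (p.1.1 - p.1.2) p.2 := by
    unfold cosAngle; fun_prop
  have hset : MeasurableSet {s | b s = b' s} := measurableSet_eq_fun hb hb'
  have h3 : ∀ᵐ p ∂collisionMeasure, b (cosAngle (p.1.1 - p.1.2) p.2) =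
      b' (cosAngle (p.1.1 - p.1.2) p.2) := by
    have hset' : MeasurableSet {p : (V3 × V3) × S2 | b (cosAngle (p.1.1 - p.1.2) p.2) =
      b' (cosAngle (p.1.1 - p.1.2) p.2)} := hmc hset
    rw [← measurePreserving_tripleCoord.map_eq,
      ae_map_iff measurePreserving_tripleCoord.measurable.aemeasurable hset']
    have : ∀ᵐ a ∂tripleMeasure, b (cosV a.2.1 a.2.2) = b' (cosV a.2.1 a.2.2) :=
      Measure.quasiMeasurePreserving_snd.ae (ae_cosV hset hbb)
    filter_upwards [this] with a ha
    simp only [tripleCoord, sub_sub_cancel]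
    exact ha
  filter_upwards [h1, h2, h3] with p e1 e2 e3
  rw [collisionDensity, collisionDensity, e1, e2, e3]

theorem integrable_collisionDensity {b : ℝ → ℝ} {B : ℝ} (hb : Measurable b) (hB : ∀ s, |b s| ≤ B)
    {f g : V3 → ℝ} (hf : MemLpW 1 1 f) (hg : MemLpW 1 1 g) :
    Integrable (collisionDensity b f g) collisionMeasure := by
  have h1 : Integrable (fun p : V3 × V3 => (weight 1 p.1 * f p.1) * (weight 1 p.2 * g p.2))
      (volume.prod volume) := (memLp_one_iff_integrable.1 hf).mul_prod (memLp_one_iff_integrable.1 hg)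
  have h2 : Integrable (fun p : (V3 × V3) × S2 => (weight 1 p.1.1 * f p.1.1) *
      (weight 1 p.1.2 * g p.1.2)) collisionMeasure := h1.comp_fst _
  have hmc : Measurable fun p : (V3 × V3) × S2 => cosAngle (p.1.1 - p.1.2) p.2 := by
    unfold cosAngle; fun_prop
  have hw := measurable_weight 1
  have h3 : Measurable fun p : (V3 × V3) × S2 => ‖p.1.1 - p.1.2‖ / (weight 1 p.1.1 * weight 1 p.1.2) *
      b (cosAngle (p.1.1 - p.1.2) p.2) := by
    have := hb.comp hmc
    exact Measurable.mul (by fun_prop) this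
  refine (h2.mul_bdd (c := 2 * B) h3.aestronglyMeasurable (ae_of_all _ fun p => ?_)).congr
    (ae_of_all _ fun p => ?_)
  · rw [norm_mul, Real.norm_eq_abs, Real.norm_eq_abs]
    refine mul_le_mul ?_ (hB _) (abs_nonneg _) zero_le_two
    have w1 := one_le_weight zero_le_one p.1.1
    have w2 := one_le_weight zero_le_one p.1.2
    rw [abs_of_nonneg (by positivity), div_le_iff₀ (by positivity)]
    have n1 := norm_le_weight_one p.1.1
    have n2 := norm_le_weight_one p.1.2
    have := norm_sub_le p.1.1 p.1.2
    nlinarith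
  · have w1 := (weight_pos 1 p.1.1).ne'
    have w2 := (weight_pos 1 p.1.2).ne'
    simp only [collisionDensity]
    field_simp

/-! ### Duality -/

theorem weightNorm_congr {h h' : V3 → ℝ≥0∞} (hh : h =ᵐ[volume] h') (p s : ℝ) :
    weightNorm p s h = weightNorm p s h' := by
  unfold weightNorm
  congr 1
  exact lintegral_congr_ae (hh.mono fun v hv => by beta_reduce; rw [hv])

/-- Testing with the truncation of weight^(2q) Q to a set where Q and the weight are bounded gives I
≤ N √I, where I is the truncated squared norm. Dividing by √I and removing the truncation by
monotone convergence gives the claim. -/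
theorem weightNorm_le_of_dual_of_measurable {Q : V3 → ℝ} (hQ : Integrable Q) (hm : Measurable Q)
    {q : ℝ} {N : ℝ≥0∞}
    (h : ∀ ψ : V3 → ℝ, Measurable ψ → ∀ M : ℝ, (∀ v, |ψ v| ≤ M) →
      ‖∫ v, Q v * ψ v‖ₑ ≤ N * weightNorm 2 (-q) fun v => ‖ψ v‖ₑ) :
    weightNorm 2 q (fun v => ‖Q v‖ₑ) ≤ N := by
  have hw := measurable_weight (q + q)
  set k : V3 → ℝ≥0∞ := fun v => (eweight q v * ‖Q v‖ₑ) ^ (2 : ℝ) with hk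
  have mk : Measurable k := ((measurable_eweight q).mul hm.enorm).pow_const _
  have kreal : ∀ v, k v = ENNReal.ofReal (weight (q + q) v * Q v ^ 2) := by
    intro v
    simp only [hk]
    rw [eweight, ← ofReal_norm, ← ENNReal.ofReal_mul (weight_pos _ _).le,
      ENNReal.ofReal_rpow_of_nonneg (mul_nonneg (weight_pos _ _).le (norm_nonneg _)) (by norm_num),
      weight_add, Real.norm_eq_abs]
    congr 1
    rw [Real.rpow_two, mul_pow, sq_abs]
    ring
  set E : ℕ → Set V3 := fun n => {v | |Q v| ≤ n ∧ weight (q + q) v ≤ n} with hE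
  have mE : ∀ n, MeasurableSet (E n) := fun n =>
    (measurableSet_le hm.abs measurable_const).inter (measurableSet_le hw measurable_const)
  have bound : ∀ n, (∫⁻ v, (E n).indicator k v) ^ (1 / 2 : ℝ) ≤ N := by
    intro n
    set ψ : V3 → ℝ := (E n).indicator fun v => weight (q + q) v * Q v with hψ
    have mψ : Measurable ψ := (hw.mul hm).indicator (mE n)
    have bψ : ∀ v, |ψ v| ≤ n * n := by
      intro v
      by_cases hv : v ∈ E n
      · simp only [hψ, indicator_of_mem hv, abs_mul]
        rw [abs_of_pos (weight_pos _ _)]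
        exact mul_le_mul hv.2 hv.1 (abs_nonneg _) (by positivity)
      · simp only [hψ, indicator_of_notMem hv, abs_zero]
        positivity
    have hint : Integrable fun v => Q v * ψ v :=
      hQ.mul_bdd (c := n * n) mψ.aestronglyMeasurable (ae_of_all _ bψ)
    have e0 : ∀ v, Q v * ψ v = (E n).indicator (fun v => weight (q + q) v * Q v ^ 2) v := by
      intro v
      by_cases hv : v ∈ E n
      · simp only [hψ, indicator_of_mem hv]; ring
      · simp [hψ, indicator_of_notMem hv]
    have nn : ∀ v, 0 ≤ Q v * ψ v := fun v => by
      rw [e0]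
      exact indicator_nonneg (fun v _ => mul_nonneg (weight_pos _ _).le (sq_nonneg _)) v
    have e1 : ∀ v, ENNReal.ofReal (Q v * ψ v) = (E n).indicator k v := by
      intro v
      rw [e0]
      by_cases hv : v ∈ E n
      · simp only [indicator_of_mem hv, kreal]
      · simp [indicator_of_notMem hv]
    have e2 : ‖∫ v, Q v * ψ v‖ₑ = ∫⁻ v, (E n).indicator k v := by
      rw [Real.enorm_of_nonneg (integral_nonneg nn),
        ofReal_integral_eq_lintegral_ofReal hint (ae_of_all _ nn)]
      exact lintegral_congr e1
    have e3 : weightNorm 2 (-q) (fun v => ‖ψ v‖ₑ) = (∫⁻ v, (E n).indicator k v) ^ (1 / 2 : ℝ) := by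
      unfold weightNorm
      congr 1
      refine lintegral_congr fun v => ?_
      by_cases hv : v ∈ E n
      · simp only [hψ, indicator_of_mem hv, hk]
        rw [enorm_mul, Real.enorm_of_nonneg (weight_pos _ _).le, ← mul_assoc]
        congr 2
        rw [← eweight, ← eweight_add]
        congr 1
        ring
      · simp [hψ, indicator_of_notMem hv]
    -- Finiteness holds because this is the absolute value of a real integral; without it √I could
    -- not be cancelled.
    have fin : ∫⁻ v, (E n).indicator k v ≠ ⊤ := by
      rw [← e2]; exact enorm_ne_top
    have key := h ψ mψ _ bψ
    rw [e2, e3] at key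
    set I := ∫⁻ v, (E n).indicator k v
    rcases eq_or_ne I 0 with h0 | h0
    · rw [h0, ENNReal.zero_rpow_of_pos (by norm_num)]
      exact zero_le
    · have hs : I = I ^ (1 / 2 : ℝ) * I ^ (1 / 2 : ℝ) := by
        rw [← ENNReal.rpow_add _ _ h0 fin]
        norm_num
      have s0 : I ^ (1 / 2 : ℝ) ≠ 0 := (ENNReal.rpow_pos (pos_iff_ne_zero.2 h0) fin).ne'
      have st : I ^ (1 / 2 : ℝ) ≠ ⊤ := ENNReal.rpow_ne_top_of_nonneg (by norm_num) fin
      conv_lhs at key => rw [hs]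
      exact (ENNReal.mul_le_mul_iff_left s0 st).1 key
  have lim : Tendsto (fun n => ∫⁻ v, (E n).indicator k v) atTop (𝓝 (∫⁻ v, k v)) := by
    refine lintegral_tendsto_of_tendsto_of_monotone (fun n => (mk.indicator (mE n)).aemeasurable)
      (ae_of_all _ fun v m n hmn => ?_) (ae_of_all _ fun v => ?_)
    · have hsub : E m ⊆ E n := fun x hx =>
        ⟨hx.1.trans (Nat.cast_le.2 hmn), hx.2.trans (Nat.cast_le.2 hmn)⟩
      exact indicator_le_indicator_of_subset hsub (fun _ => zero_le) v
    · refine tendsto_const_nhds.congr' ?_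
      obtain ⟨n₀, hn₀⟩ := exists_nat_ge (max |Q v| (weight (q + q) v))
      filter_upwards [eventually_ge_atTop n₀] with n hn
      have hnn : (n₀ : ℝ) ≤ n := Nat.cast_le.2 hn
      rw [indicator_of_mem]
      exact ⟨(le_max_left _ _).trans (hn₀.trans hnn), (le_max_right _ _).trans (hn₀.trans hnn)⟩
  refine le_of_tendsto' ((ENNReal.continuous_rpow_const (y := 1 / 2)).continuousAt.tendsto.comp lim)
    bound

theorem weightNorm_le_of_dual {Q : V3 → ℝ} (hQ : Integrable Q) {q : ℝ} {N : ℝ≥0∞}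
    (h : ∀ ψ : V3 → ℝ, Measurable ψ → ∀ M : ℝ, (∀ v, |ψ v| ≤ M) →
      ‖∫ v, Q v * ψ v‖ₑ ≤ N * weightNorm 2 (-q) fun v => ‖ψ v‖ₑ) :
    weightNorm 2 q (fun v => ‖Q v‖ₑ) ≤ N := by
  have hae := hQ.1.ae_eq_mk
  rw [weightNorm_congr (h' := fun v => ‖hQ.1.mk Q v‖ₑ) (hae.mono fun v hv => by beta_reduce; rw [hv])]
  refine weightNorm_le_of_dual_of_measurable (hQ.congr hae) hQ.1.stronglyMeasurable_mk.measurable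
    fun ψ hψ M hM => ?_
  have e : ∫ v, Q v * ψ v = ∫ v, hQ.1.mk Q v * ψ v := by
    refine integral_congr_ae ?_
    filter_upwards [hae] with v hv
    rw [← hv]
  rw [← e]
  exact h ψ hψ M hM

/-! ### The defect of a restitution coefficient -/

/-- The defect `(1 - e(ℓ r)) / 2`, extended to negative `r` by a constant. -/
def defect (e : ℝ → ℝ) (ℓ : ℝ) : ℝ → ℝ := fun r => (1 - e (ℓ * max r 0)) / 2

theorem rescale_eq_defect (e : ℝ → ℝ) (ℓ : ℝ) {r : ℝ} (hr : 0 ≤ r) :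
    rescale ℓ e r = 1 - 2 * defect e ℓ r := by
  simp only [rescale, defect, max_eq_left hr]
  ring

namespace IsRestitution

variable {γ : ℝ} {e : ℝ → ℝ}

theorem hasDerivAt_defect (he : IsRestitution γ e) {ℓ r : ℝ} (hℓ : 0 < ℓ) (hr : 0 < r) :
    HasDerivAt (defect e ℓ) (-(ℓ * deriv e (ℓ * r)) / 2) r := by
  have h1 : HasDerivAt e (deriv e (ℓ * r)) (ℓ * r) :=
    (he.differentiable _ (mul_pos hℓ hr)).hasDerivAt
  have h2 : HasDerivAt (fun r => ℓ * r) ℓ r := by simpa using (hasDerivAt_id r).const_mul ℓ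
  have h3 : HasDerivAt (fun r => (1 - e (ℓ * r)) / 2) (-(ℓ * deriv e (ℓ * r)) / 2) r := by
    have := ((h1.comp r h2).const_sub 1).div_const 2
    rw [mul_comm ℓ]
    exact this
  refine h3.congr_of_eventuallyEq ?_
  filter_upwards [lt_mem_nhds hr] with x hx
  simp only [defect, max_eq_left (le_of_lt hx)]

theorem deriv_mul_self (he : IsRestitution γ e) {r : ℝ} (hr : 0 < r) :
    deriv (fun x => x * e x) r = e r + r * deriv e r := by
  have h := (hasDerivAt_id r).mul (he.differentiable r hr).hasDerivAt
  have h2 : HasDerivAt (fun x => x * e x) (1 * e r + r * deriv e r) r := h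
  rw [h2.deriv, one_mul]

/-- With η' = e + r e', the lower bound η' ≥ 0 is D + r D' ≤ 1/2, and |η' - e| ≤ C(1 - e) gives r D'
≤ C D. Both are unchanged when r is scaled by ℓ, so a single `K` serves all ℓ. -/
theorem isDefect (he : IsRestitution γ e) :
    ∃ K : ℝ, ∀ ℓ : ℝ, 0 < ℓ → IsDefect K (defect e ℓ) := by
  obtain ⟨C, hC, hclose⟩ := he.jacobian_close
  obtain ⟨α, c, -, hc, hlow⟩ := he.jacobian_lower
  have hanti : ∀ ℓ : ℝ, 0 < ℓ → Antitone fun r : ℝ => e (ℓ * max r 0) := fun ℓ hℓ x y hxy =>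
    he.antitone (mul_nonneg hℓ.le (le_max_right _ _)) (mul_nonneg hℓ.le (le_max_right _ _))
      (mul_le_mul_of_nonneg_left (max_le_max_right 0 hxy) hℓ.le)
  have hmem : ∀ ℓ : ℝ, 0 < ℓ → ∀ r : ℝ, 0 ≤ ℓ * max r 0 := fun ℓ hℓ r =>
    mul_nonneg hℓ.le (le_max_right _ _)
  have hmono : ∀ ℓ : ℝ, 0 < ℓ → Monotone (defect e ℓ) := fun ℓ hℓ x y hxy => by
    have := hanti ℓ hℓ hxy
    simp only [defect]
    linarith
  refine ⟨C, fun ℓ hℓ => ⟨hC.le, (hmono ℓ hℓ).measurable, fun r => ?_, fun r => ?_,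
    (hmono ℓ hℓ).monotoneOn _, fun r hr => (he.hasDerivAt_defect hℓ hr).differentiableAt,
    fun r hr => (hmono ℓ hℓ).deriv_nonneg, fun r hr => ?_, fun r hr => ?_⟩⟩
  · have := (he.range _ (hmem ℓ hℓ r)).2
    simp only [defect]
    linarith
  · have := (he.range _ (hmem ℓ hℓ r)).1
    simp only [defect]
    linarith
  · have hx := mul_pos hℓ hr
    have h1 := hclose _ hx
    have h2 := he.range _ hx.le
    rw [he.deriv_mul_self hx, add_sub_cancel_left, abs_of_nonneg (by linarith : 0 ≤ 1 - e (ℓ * r))] at h1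
    have h3 := neg_abs_le (ℓ * r * deriv e (ℓ * r))
    rw [(he.hasDerivAt_defect hℓ hr).deriv]
    simp only [defect, max_eq_left hr.le]
    linarith
  · have hx := mul_pos hℓ hr
    have h1 := hlow _ hx
    have h2 := he.range _ hx.le
    rw [he.deriv_mul_self hx] at h1
    have h3 : 0 ≤ c * e (ℓ * r) ^ α := mul_nonneg hc.le (Real.rpow_nonneg h2.1.le _)
    rw [(he.hasDerivAt_defect hℓ hr).deriv]
    simp only [defect, max_eq_left hr.le]
    linarith

/-- For ℓr ≤ 1 the expansion at zero applies, with the remainder exponent larger than γ; for ℓr ≥ 1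
the defect is at most 1/2 while (ℓr)^γ ≥ 1. -/
theorem defect_le (he : IsRestitution γ e) (hγ : 0 < γ) :
    ∃ A : ℝ, 0 < A ∧ ∀ ℓ : ℝ, 0 < ℓ → ∀ r : ℝ, 0 ≤ r → defect e ℓ r ≤ A * ℓ ^ γ * r ^ γ := by
  obtain ⟨a, b, γ', ha, hb, hγ', hexp⟩ := he.expansion
  refine ⟨a + b + 1, by positivity, fun ℓ hℓ r hr => ?_⟩
  have hx : 0 ≤ ℓ * r := mul_nonneg hℓ.le hr
  rw [mul_assoc, ← Real.mul_rpow hℓ.le hr, defect, max_eq_left hr]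
  set x := ℓ * r
  have h1 := he.range x hx
  have hxγ : 0 ≤ x ^ γ := Real.rpow_nonneg hx _
  rcases le_total x 1 with h | h
  · have h2 := neg_abs_le (e x - 1 + a * x ^ γ)
    have h3 := hexp x hx
    have h4 : x ^ γ' ≤ x ^ γ := by
      rcases hx.eq_or_lt with h0 | h0
      · rw [← h0, Real.zero_rpow hγ.ne', Real.zero_rpow (by linarith)]
      · exact Real.rpow_le_rpow_of_exponent_ge h0 h (by linarith)
    nlinarith
  · have h2 : 1 ≤ x ^ γ := Real.one_le_rpow h hγ.le
    nlinarith

end IsRestitution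

/-! ### Embeddings of weighted spaces -/

theorem exists_embedding {p r s t : ℝ} (hp : 0 < p) (hr : 0 < r) (hpr : 1 / p = 1 / 2 + 1 / r)
    (hs : (s - t) * r < -3) : ∃ E : ℝ≥0∞, E ≠ ⊤ ∧ ∀ h : V3 → ℝ≥0∞, Measurable h →
      weightNorm p s h ≤ E * weightNorm 2 t h :=
  ⟨_, ENNReal.rpow_ne_top_of_nonneg (by positivity) (lintegral_eweight_lt_top hs).ne,
    fun _ hh => weightNorm_le_two hp hr hpr hh⟩

theorem MemLpW.mono {p : ℝ≥0∞} {s t : ℝ} (hst : s ≤ t) {f : V3 → ℝ} (hf : MemLpW p t f)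
    (hm : AEStronglyMeasurable f) : MemLpW p s f := by
  refine MemLp.mono hf ((measurable_weight s).aestronglyMeasurable.mul hm) (ae_of_all _ fun v => ?_)
  rw [norm_mul, norm_mul, Real.norm_of_nonneg (weight_pos _ _).le,
    Real.norm_of_nonneg (weight_pos _ _).le]
  exact mul_le_mul_of_nonneg_right (weight_mono hst v) (norm_nonneg _)

theorem MemLpW.aestronglyMeasurable {p : ℝ≥0∞} {s : ℝ} {f : V3 → ℝ} (hf : MemLpW p s f) :
    AEStronglyMeasurable f := by
  have h := (measurable_weight (-s)).aestronglyMeasurable.mul hf.1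
  refine h.congr (ae_of_all _ fun v => ?_)
  simp only [Pi.mul_apply, ← mul_assoc, weight_neg_mul, one_mul]

theorem memLpW_one_of_two {s t : ℝ} (hst : (s - t) * 2 < -3) {f : V3 → ℝ} (hf : MemLpW 2 t f)
    (hm : Measurable f) : MemLpW 1 s f := by
  obtain ⟨E, hE, h⟩ := exists_embedding one_pos two_pos (by norm_num) hst
  refine ⟨((measurable_weight s).mul hm).aestronglyMeasurable, ?_⟩
  change normLpW 1 s f < ⊤
  rw [normLpW_one_eq]
  refine (h _ hm.enorm).trans_lt (ENNReal.mul_lt_top hE.lt_top ?_)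
  rw [← normLpW_two_eq]
  exact hf.2

/-! ### Transfer of changes of variables -/

theorem integral_eq_of_lintegral_eq {α β : Type*} [MeasurableSpace α] [MeasurableSpace β]
    {μ : Measure α} {S T : α → β} {J : α → ℝ} (hS : Measurable S) (hJ : Measurable J)
    (hJ0 : ∀ᵐ a ∂μ, 0 ≤ J a)
    (h : ∀ F : β → ℝ≥0∞, Measurable F →
      ∫⁻ a, ENNReal.ofReal (J a) * F (S a) ∂μ = ∫⁻ a, F (T a) ∂μ)
    {F : β → ℝ} (hF : Measurable F) (hi : Integrable (fun a => F (T a)) μ) :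
    Integrable (fun a => J a * F (S a)) μ ∧ ∫ a, J a * F (S a) ∂μ = ∫ a, F (T a) ∂μ := by
  have hi' : Integrable (fun a => J a * F (S a)) μ := by
    refine ⟨(hJ.mul (hF.comp hS)).aestronglyMeasurable, ?_⟩
    have h1 := h (fun x => ‖F x‖ₑ) hF.enorm
    have h2 : ∫⁻ a, ‖J a * F (S a)‖ₑ ∂μ = ∫⁻ a, ENNReal.ofReal (J a) * ‖F (S a)‖ₑ ∂μ := by
      refine lintegral_congr_ae (hJ0.mono fun a ha => ?_)
      simp only [enorm_mul, Real.enorm_of_nonneg ha]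
    rw [hasFiniteIntegral_iff_enorm, h2, h1]
    exact hi.2
  refine ⟨hi', ?_⟩
  rw [integral_eq_lintegral_pos_part_sub_lintegral_neg_part hi',
    integral_eq_lintegral_pos_part_sub_lintegral_neg_part hi,
    ← h (fun x => ENNReal.ofReal (F x)) hF.ennreal_ofReal,
    ← h (fun x => ENNReal.ofReal (-F x)) hF.neg.ennreal_ofReal]
  congr 2
  · refine lintegral_congr_ae (hJ0.mono fun a ha => ?_)
    simp only [ENNReal.ofReal_mul ha]
  · refine lintegral_congr_ae (hJ0.mono fun a ha => ?_)
    simp only [← mul_neg, ENNReal.ofReal_mul ha]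

theorem measurable_um_pair : Measurable fun a : V3 × S2 => um a.1 a.2 :=
  measurable_pair (U := um) measurable_um

namespace IsDefect

variable {K : ℝ} {D : ℝ → ℝ}

theorem measurable_dilate (hD : IsDefect K D) : Measurable (dilate D 1) :=
  (hD.pairBound_dilate ⟨zero_le_one, le_rfl⟩).measurable

theorem measurable_kick (hD : IsDefect K D) : Measurable (kick D) := hD.pairBound_kick.measurable

theorem measurable_twist (hD : IsDefect K D) : Measurable (twist D 1) := (hD.pairBound_twist 1).measurable

theorem measurable_recoil (hD : IsDefect K D) : Measurable (recoil D) :=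
  hD.pairBound_recoil.measurable

theorem measurable_twistKick (hD : IsDefect K D) : Measurable (twistKick D 1) :=
  (hD.pairBound_twistKick ⟨zero_le_one, le_rfl⟩).measurable

theorem measurable_dilateJac_pair (hD : IsDefect K D) :
    Measurable fun a : V3 × S2 => dilateJac D ‖a.1‖ (cosV a.1 a.2) :=
  measurable_jac hD.measurable_dilateJac

theorem measurable_twistJac_pair (hD : IsDefect K D) :
    Measurable fun a : V3 × S2 => twistJac D ‖a.1‖ (cosV a.1 a.2) :=
  measurable_jac hD.measurable_twistJac

theorem lintegral_triple_dilate (hD : IsDefect K D) {F : V3 × (V3 × V3) → ℝ≥0∞}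
    (hF : Measurable F) :
    ∫⁻ a, ENNReal.ofReal (dilateJac D ‖a.2.1‖ (cosV a.2.1 a.2.2)) *
      F (a.1, (dilate D 1 a.2, kick D a.2)) ∂tripleMeasure =
    ∫⁻ a, F (a.1, (a.2.1, um a.2.1 a.2.2)) ∂tripleMeasure := by
  have m1 : Measurable fun a : V3 × (V3 × S2) => (a.1, (dilate D 1 a.2, kick D a.2)) :=
    measurable_fst.prodMk ((hD.measurable_dilate.comp measurable_snd).prodMk
      (hD.measurable_kick.comp measurable_snd))
  have m2 : Measurable fun a : V3 × (V3 × S2) =>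
      ENNReal.ofReal (dilateJac D ‖a.2.1‖ (cosV a.2.1 a.2.2)) :=
    (hD.measurable_dilateJac_pair.comp measurable_snd).ennreal_ofReal
  have m3 : Measurable fun a : V3 × (V3 × S2) => (a.1, (a.2.1, um a.2.1 a.2.2)) :=
    measurable_fst.prodMk (measurable_snd.fst.prodMk (measurable_um_pair.comp measurable_snd))
  refine (lintegral_prod _ (m2.mul (hF.comp m1)).aemeasurable).trans
    (Eq.trans ?_ (lintegral_prod _ (hF.comp m3).aemeasurable).symm)
  refine lintegral_congr fun v => ?_
  exact hD.lintegral_dilate (F := fun y => F (v, y)) (hF.comp measurable_prodMk_left)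

theorem lintegral_triple_twist (hD : IsDefect K D) {F : V3 × (V3 × V3) → ℝ≥0∞}
    (hF : Measurable F) :
    ∫⁻ a, ENNReal.ofReal (twistJac D ‖a.2.1‖ (cosV a.2.1 a.2.2)) *
      F (a.1, (twist D 1 a.2, twistKick D 1 a.2)) ∂tripleMeasure =
    ∫⁻ a, F (a.1, (a.2.1, um a.2.1 a.2.2)) ∂tripleMeasure := by
  have m1 : Measurable fun a : V3 × (V3 × S2) => (a.1, (twist D 1 a.2, twistKick D 1 a.2)) :=
    measurable_fst.prodMk ((hD.measurable_twist.comp measurable_snd).prodMk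
      (hD.measurable_twistKick.comp measurable_snd))
  have m2 : Measurable fun a : V3 × (V3 × S2) =>
      ENNReal.ofReal (twistJac D ‖a.2.1‖ (cosV a.2.1 a.2.2)) :=
    (hD.measurable_twistJac_pair.comp measurable_snd).ennreal_ofReal
  have m3 : Measurable fun a : V3 × (V3 × S2) => (a.1, (a.2.1, um a.2.1 a.2.2)) :=
    measurable_fst.prodMk (measurable_snd.fst.prodMk (measurable_um_pair.comp measurable_snd))
  refine (lintegral_prod _ (m2.mul (hF.comp m1)).aemeasurable).trans
    (Eq.trans ?_ (lintegral_prod _ (hF.comp m3).aemeasurable).symm)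
  refine lintegral_congr fun v => ?_
  exact hD.lintegral_twist (F := fun y => F (v, y)) (hF.comp measurable_prodMk_left)

end IsDefect

/-- For fixed (u, σ) the displacement is a constant vector, so `ae_enorm_sub_le` holds for almost
every v. Measurability of the set of good points lets Fubini assemble the slices. -/
theorem HasWeakGradient.ae_triple_sub_le {g : V3 → ℝ} {G : V3 → V3} (h : HasWeakGradient g G)
    (hg : Measurable g) (hG : Measurable G) {X d : V3 × S2 → V3} (hX : Measurable X)
    (hd : Measurable d) :
    ∀ᵐ a ∂tripleMeasure, ‖g (a.1 + X a.2 + d a.2) - g (a.1 + X a.2)‖ₑ ≤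
      ‖d a.2‖ₑ * ∫⁻ l in Icc (0 : ℝ) 1, ‖G (a.1 + X a.2 + l • d a.2)‖ₑ := by
  have m1 : Measurable fun q : (V3 × (V3 × S2)) × ℝ => ‖G (q.1.1 + X q.1.2 + q.2 • d q.1.2)‖ₑ :=
    (hG.comp (by fun_prop)).enorm
  have m2 : Measurable fun a : V3 × (V3 × S2) =>
      ∫⁻ l in Icc (0 : ℝ) 1, ‖G (a.1 + X a.2 + l • d a.2)‖ₑ := m1.lintegral_prod_right'
  have hset : MeasurableSet {a : V3 × (V3 × S2) | ‖g (a.1 + X a.2 + d a.2) - g (a.1 + X a.2)‖ₑ ≤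
      ‖d a.2‖ₑ * ∫⁻ l in Icc (0 : ℝ) 1, ‖G (a.1 + X a.2 + l • d a.2)‖ₑ} := by
    refine measurableSet_le ?_ ((hd.comp measurable_snd).enorm.mul m2)
    exact ((hg.comp (by fun_prop)).sub (hg.comp (by fun_prop))).enorm
  rw [show tripleMeasure = (pairMeasure.prod volume).map Prod.swap from Measure.prod_swap.symm,
    ae_map_iff measurable_swap.aemeasurable hset]
  refine (Measure.ae_prod_iff_ae_ae (measurable_swap hset)).2 ?_
  refine ae_of_all _ fun p => ?_
  exact (measurePreserving_add_right volume (X p)).quasiMeasurePreserving.ae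
    (h.ae_enorm_sub_le (d p))

/-- The identity ρ g₁ - jρ g₂ = ρ(1 - j)g₂ - ρ(g₂ - g₁) separates the Jacobian error from the
increment of g. -/
theorem enorm_difference_le {f b ψ g₁ g₂ ρ j B d : ℝ} {I : ℝ≥0∞} (hb : |b| ≤ B) (hρ : 0 ≤ ρ)
    (h : ‖g₂ - g₁‖ₑ ≤ ENNReal.ofReal d * I) :
    ‖f * b * ψ * (ρ * g₁ - j * ρ * g₂)‖ₑ ≤ ENNReal.ofReal B *
      (ENNReal.ofReal (ρ * d) * (‖f‖ₑ * I * ‖ψ‖ₑ) +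
        ENNReal.ofReal (ρ * |1 - j|) * (‖f‖ₑ * ‖g₂‖ₑ * ‖ψ‖ₑ)) := by
  have e1 : ρ * g₁ - j * ρ * g₂ = ρ * (1 - j) * g₂ - ρ * (g₂ - g₁) := by ring
  have hB : ‖b‖ₑ ≤ ENNReal.ofReal B := by
    rw [← ofReal_norm]
    exact ENNReal.ofReal_le_ofReal hb
  rw [e1, enorm_mul, enorm_mul, enorm_mul]
  calc _ ≤ ‖f‖ₑ * ENNReal.ofReal B * ‖ψ‖ₑ * (‖ρ * (1 - j) * g₂‖ₑ + ‖ρ * (g₂ - g₁)‖ₑ) := by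
        gcongr
        exact enorm_sub_le
    _ ≤ ‖f‖ₑ * ENNReal.ofReal B * ‖ψ‖ₑ * (ENNReal.ofReal (ρ * |1 - j|) * ‖g₂‖ₑ +
        ENNReal.ofReal (ρ * d) * I) := by
        gcongr
        · rw [enorm_mul, ← ofReal_norm, Real.norm_eq_abs, abs_mul, abs_of_nonneg hρ]
        · rw [enorm_mul, Real.enorm_of_nonneg hρ, ENNReal.ofReal_mul hρ, mul_assoc]
          gcongr
    _ = _ := by ring

/-! ### Comparison of the weak forms: gradient on the second argument -/

/-- The Sobolev-type quantity that controls both terms of a comparison. -/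
def gradNorm (p s : ℝ) (g : V3 → ℝ) (G : V3 → V3) : ℝ≥0∞ :=
  weightNorm p s (fun v => ‖g v‖ₑ) + weightNorm p s fun v => ‖G v‖ₑ

theorem kick_zero (a : V3 × S2) : kick (fun _ => 0) a = um a.1 a.2 := by
  simp [kick, combD, comb, coef]

theorem dilate_eq (D : ℝ → ℝ) (l : ℝ) (a : V3 × S2) :
    dilate D l a = a.1 - (l * D (sinHalf (cosV a.1 a.2) * ‖a.1‖)) • a.1 := by
  have h : dilate D l a = (1 + -l * D (sinHalf (cosV a.1 a.2) * ‖a.1‖)) • (up a.1 a.2 + um a.1 a.2) := by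
    simp only [dilate, combD, comb, coef]
    module
  rw [h, up_add_um]
  module

theorem dilate_path (D : ℝ → ℝ) (l : ℝ) (a : V3 × S2) :
    dilate D l a = a.1 - l • (a.1 - dilate D 1 a) := by
  rw [dilate_eq, dilate_eq]
  module

theorem norm_kick_sq (D : ℝ → ℝ) (a : V3 × S2) :
    ‖kick D a‖ ^ 2 = ‖a.1‖ ^ 2 * (1 - D (sinHalf (cosV a.1 a.2) * ‖a.1‖)) ^ 2 *
      ((1 - cosV a.1 a.2) / 2) := by
  rw [kick, combD, norm_comb_sq, coef, coef]
  ring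

theorem growth_bound {A ρ γ d : ℝ} (hA : 0 ≤ A) (hγ : 0 < γ) (hρ : 0 ≤ ρ) (hd : d ≤ A * ρ ^ γ) :
    ρ * d ≤ A * (1 + ρ) ^ (2 + γ) ∧ ρ * (ρ * d) ≤ A * (1 + ρ) ^ (2 + γ) := by
  have h0 : ρ ^ γ ≤ (1 + ρ) ^ γ := Real.rpow_le_rpow hρ (by linarith) hγ.le
  have h1 : (1 + ρ) ^ (2 + γ) = (1 + ρ) ^ 2 * (1 + ρ) ^ γ := by
    rw [Real.rpow_add (by linarith), Real.rpow_two]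
  have h2 : 0 ≤ (1 + ρ) ^ γ := Real.rpow_nonneg (by linarith) _
  have h3 : d ≤ A * (1 + ρ) ^ γ := hd.trans (mul_le_mul_of_nonneg_left h0 hA)
  have h4 : 0 ≤ A * (1 + ρ) ^ γ := mul_nonneg hA h2
  rw [h1]
  constructor
  · calc ρ * d ≤ ρ * (A * (1 + ρ) ^ γ) := mul_le_mul_of_nonneg_left h3 hρ
      _ ≤ (1 + ρ) ^ 2 * (A * (1 + ρ) ^ γ) := mul_le_mul_of_nonneg_right (by nlinarith) h4
      _ = _ := by ring
  · calc ρ * (ρ * d) = ρ ^ 2 * d := by ring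
      _ ≤ ρ ^ 2 * (A * (1 + ρ) ^ γ) := mul_le_mul_of_nonneg_left h3 (sq_nonneg _)
      _ ≤ (1 + ρ) ^ 2 * (A * (1 + ρ) ^ γ) := mul_le_mul_of_nonneg_right (by nlinarith) h4
      _ = _ := by ring

theorem IsDefect.measurable_path {K : ℝ} {D : ℝ → ℝ} (hD : IsDefect K D) :
    Measurable fun q : (V3 × (V3 × S2)) × ℝ => dilate D q.2 q.1.2 := by
  have h : (fun q : (V3 × (V3 × S2)) × ℝ => dilate D q.2 q.1.2) =
      fun q => q.1.2.1 - q.2 • (q.1.2.1 - dilate D 1 q.1.2) := funext fun q => dilate_path D q.2 q.1.2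
  rw [h]
  have := hD.measurable_dilate
  fun_prop

instance : SFinite pairMeasure := Measure.prod.instSFinite

instance : SFinite tripleMeasure := Measure.prod.instSFinite

/-- Averaging the weighted estimate over the dilation path. -/
theorem IsDefect.weighted_one_path {K : ℝ} {D : ℝ → ℝ} (hD : IsDefect K D) {p q : ℝ}
    (hp : 0 ≤ p) (hq : 0 ≤ q) {F H Ψ : V3 → ℝ≥0∞}
    (hF : Measurable F) (hH : Measurable H) (hΨ : Measurable Ψ) :
    ∫⁻ a, growth p a.2.1 * (F a.1 * (∫⁻ l in Icc (0 : ℝ) 1, H (a.1 - dilate D l a.2)) *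
      Ψ (a.1 - kick D a.2)) ∂tripleMeasure ≤ weightConst p q * (32 * angularConst) *
        weightNorm 1 (q + p) F * weightNorm 2 (q + p) H * weightNorm 2 (-q) Ψ := by
  have mk := hD.measurable_kick
  have mg := measurable_growth p
  have m1 : Measurable fun q : (V3 × (V3 × S2)) × ℝ => H (q.1.1 - dilate D q.2 q.1.2) :=
    hH.comp (measurable_fst.fst.sub hD.measurable_path)
  have m2 : Measurable fun q : (V3 × (V3 × S2)) × ℝ => growth p q.1.2.1 *
      (F q.1.1 * H (q.1.1 - dilate D q.2 q.1.2) * Ψ (q.1.1 - kick D q.1.2)) := by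
    have h1 : Measurable fun q : (V3 × (V3 × S2)) × ℝ => Ψ (q.1.1 - kick D q.1.2) :=
      hΨ.comp (by fun_prop)
    exact (mg.comp (by fun_prop)).mul (((hF.comp (by fun_prop)).mul m1).mul h1)
  calc _ = ∫⁻ a, (∫⁻ l in Icc (0 : ℝ) 1, growth p a.2.1 *
        (F a.1 * H (a.1 - dilate D l a.2) * Ψ (a.1 - kick D a.2))) ∂tripleMeasure := by
        refine lintegral_congr fun a => ?_
        have m3 : Measurable fun l => H (a.1 - dilate D l a.2) := m1.comp measurable_prodMk_left
        rw [lintegral_const_mul _ ((m3.const_mul _).mul_const _),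
          lintegral_mul_const _ (m3.const_mul _), lintegral_const_mul _ m3]
    _ = ∫⁻ l, (∫⁻ a, growth p a.2.1 *
        (F a.1 * H (a.1 - dilate D l a.2) * Ψ (a.1 - kick D a.2)) ∂tripleMeasure) ∂unitMeasure :=
        lintegral_lintegral_swap m2.aemeasurable
    _ ≤ ∫⁻ l in Icc (0 : ℝ) 1, weightConst p q * (32 * angularConst) *
        weightNorm 1 (q + p) F * weightNorm 2 (q + p) H * weightNorm 2 (-q) Ψ :=
        setLIntegral_mono measurable_const fun l hl => hD.weighted_one hl hp hq hF hH hΨ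
    _ = _ := by simp

/-- The extra factor 1 - D comes from |u| in the collision kernel. The product is (1 - D)³(1 - (D +
r D')), with all factors in [0, 1]; the deviation from 1 is at most 3D from the cube and (1 + K)D
from the rest. -/
theorem IsDefect.abs_one_sub_dilateJac_le {K : ℝ} {D : ℝ → ℝ} (hD : IsDefect K D) {ρ s : ℝ}
    (hρ : 0 < ρ) (hs : s ∈ Ioo (-1 : ℝ) 1) :
    |1 - dilateJac D ρ s * (1 - D (sinHalf s * ρ))| ≤ (4 + K) * D (sinHalf s * ρ) := by
  have hr : 0 < sinHalf s * ρ := mul_pos (sinHalf_pos hs) hρ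
  unfold dilateJac
  set r := sinHalf s * ρ
  have h0 := hD.nonneg r
  have h1 := hD.le_half r
  have h2 := hD.deriv_le r hr
  have h3 := hD.deriv_le_half r hr
  have h4 := mul_nonneg hr.le (hD.deriv_nonneg r hr)
  set x := D r
  set y := r * deriv D r
  have e : 1 - (1 - x) ^ 2 * (1 - (x + y)) * (1 - x) = 1 - (1 - x) ^ 3 * (1 - (x + y)) := by ring
  have h5 : (1 - x) ^ 3 ≤ 1 := pow_le_one₀ (by linarith) (by linarith)
  have h6 : 1 - 3 * x ≤ (1 - x) ^ 3 := by nlinarith [sq_nonneg x]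
  have h7 : 0 ≤ (1 - x) ^ 3 := pow_nonneg (by linarith) 3
  rw [e, abs_le]
  constructor <;> nlinarith

theorem IsDefect.dilateJac_nonneg {K : ℝ} {D : ℝ → ℝ} (hD : IsDefect K D) (ρ s : ℝ) (hρ : 0 ≤ ρ) :
    0 ≤ dilateJac D ρ s := by
  refine mul_nonneg (sq_nonneg _) ?_
  rcases (mul_nonneg (sinHalf_nonneg s) hρ).eq_or_lt with h | h
  · rw [← h]
    linarith [hD.le_half 0, zero_mul (deriv D 0)]
  · linarith [hD.deriv_le_half _ h]

/-- The quantity that is integrated against the angular measure, as a function of `v`, `u`, `u⁻`. -/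
def firstKernel (b : ℝ → ℝ) (f g ψ : V3 → ℝ) (x : V3 × (V3 × V3)) : ℝ :=
  f x.1 * g (x.1 - x.2.1) * ‖x.2.1‖ * b (1 - 2 * (‖x.2.2‖ ^ 2 / ‖x.2.1‖ ^ 2)) * ψ (x.1 - x.2.2)

theorem measurable_firstKernel {b : ℝ → ℝ} {f g ψ : V3 → ℝ} (hb : Measurable b) (hf : Measurable f)
    (hg : Measurable g) (hψ : Measurable ψ) : Measurable (firstKernel b f g ψ) := by
  have h1 : Measurable fun x : V3 × (V3 × V3) => b (1 - 2 * (‖x.2.2‖ ^ 2 / ‖x.2.1‖ ^ 2)) :=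
    hb.comp (by fun_prop)
  have h2 : Measurable fun x : V3 × (V3 × V3) => g (x.1 - x.2.1) := hg.comp (by fun_prop)
  have h3 : Measurable fun x : V3 × (V3 × V3) => ψ (x.1 - x.2.2) := hψ.comp (by fun_prop)
  exact ((((hf.comp measurable_fst).mul h2).mul (by fun_prop)).mul h1).mul h3

/-- The cosine is recovered from |u⁻|²/|u|² = (1 - cos θ)/2, so the integrand becomes a function of
(u, u⁻) as `lintegral_dilate` requires. At u = 0 the factor |u| hides the value of the quotient. -/
theorem firstKernel_um (b : ℝ → ℝ) (f g ψ : V3 → ℝ) (a : V3 × (V3 × S2)) :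
    firstKernel b f g ψ (a.1, (a.2.1, um a.2.1 a.2.2)) =
      collisionDensity b f g (tripleCoord a) * ψ (a.1 - kick (fun _ => 0) a.2) := by
  rw [collisionDensity_tripleCoord, kick_zero, firstKernel]
  by_cases hu : ‖a.2.1‖ = 0
  · simp [hu]
  · have : 1 - 2 * (‖um a.2.1 a.2.2‖ ^ 2 / ‖a.2.1‖ ^ 2) = cosV a.2.1 a.2.2 := by
      rw [norm_um_sq]
      field_simp
      ring
    simp only [this]

theorem IsDefect.firstKernel_dilate {K : ℝ} {D : ℝ → ℝ} (hD : IsDefect K D) (b : ℝ → ℝ)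
    (f g ψ : V3 → ℝ) (a : V3 × (V3 × S2)) :
    firstKernel b f g ψ (a.1, (dilate D 1 a.2, kick D a.2)) =
      f a.1 * g (a.1 - dilate D 1 a.2) *
        ((1 - D (sinHalf (cosV a.2.1 a.2.2) * ‖a.2.1‖)) * ‖a.2.1‖) * b (cosV a.2.1 a.2.2) *
        ψ (a.1 - kick D a.2) := by
  have h := hD.le_half (sinHalf (cosV a.2.1 a.2.2) * ‖a.2.1‖)
  have hn : ‖dilate D 1 a.2‖ =
      (1 - D (sinHalf (cosV a.2.1 a.2.2) * ‖a.2.1‖)) * ‖a.2.1‖ := by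
    rw [← sq_eq_sq₀ (norm_nonneg _) (mul_nonneg (by linarith) (norm_nonneg _)), norm_dilate_sq]
    ring
  rw [firstKernel]
  by_cases hu : ‖a.2.1‖ = 0
  · simp [hn, hu]
  · have : 1 - 2 * (‖kick D a.2‖ ^ 2 / ‖dilate D 1 a.2‖ ^ 2) = cosV a.2.1 a.2.2 := by
      have hne : 1 - D (sinHalf (cosV a.2.1 a.2.2) * ‖a.2.1‖) ≠ 0 := by linarith
      rw [norm_kick_sq, hn]
      generalize 1 - D (sinHalf (cosV a.2.1 a.2.2) * ‖a.2.1‖) = y at hne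
      field_simp
      ring
    rw [this, hn]

theorem integrable_mul_bounded {b : ℝ → ℝ} {f g ψ : V3 → ℝ} {D : ℝ → ℝ} {K M : ℝ}
    (hD : IsDefect K D) (hi : Integrable (collisionDensity b f g) collisionMeasure)
    (hψ : Measurable ψ) (hM : ∀ v, |ψ v| ≤ M) :
    Integrable (fun a => collisionDensity b f g (tripleCoord a) * ψ (a.1 - kick D a.2))
      tripleMeasure := by
  have hk := hD.measurable_kick
  exact (measurePreserving_tripleCoord.integrable_comp_of_integrable hi).mul_bdd (c := M)
    (hψ.comp (by fun_prop)).aestronglyMeasurable (ae_of_all _ fun a => hM _)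

/-- The elastic integral is pulled back by the dilation, which matches the arguments of ψ. The
increment of g costs |u|·|u|D and the Jacobian error |u|D, both at most a multiple of (1 +
|u|)^(2+γ). The increment is integrated over the whole path `dilate D l`, the Jacobian error only at
l = 1. -/
theorem IsDefect.compare_one {K A B γ q M : ℝ} {D b : ℝ → ℝ} {f g ψ : V3 → ℝ} {G : V3 → V3}
    (hD : IsDefect K D) (hA : 0 ≤ A) (hDA : ∀ r, 0 ≤ r → D r ≤ A * r ^ γ) (hγ : 0 < γ) (hq : 0 ≤ q)
    (hb : Measurable b) (hB : ∀ s, |b s| ≤ B) (hf : Measurable f) (hg : Measurable g)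
    (hG : Measurable G) (hgG : HasWeakGradient g G)
    (hi : Integrable (collisionDensity b f g) collisionMeasure)
    (hψ : Measurable ψ) (hM : ∀ v, |ψ v| ≤ M) :
    ‖(∫ a, collisionDensity b f g (tripleCoord a) * ψ (a.1 - kick D a.2) ∂tripleMeasure) -
      ∫ a, collisionDensity b f g (tripleCoord a) * ψ (a.1 - kick (fun _ => 0) a.2)
        ∂tripleMeasure‖ₑ ≤
      ENNReal.ofReal B * (ENNReal.ofReal ((4 + K) * A) * (weightConst (2 + γ) q *
        (32 * angularConst) * weightNorm 1 (q + (2 + γ)) (fun v => ‖f v‖ₑ) *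
        gradNorm 2 (q + (2 + γ)) g G * weightNorm 2 (-q) fun v => ‖ψ v‖ₑ)) := by
  have i1 := integrable_mul_bounded hD hi hψ hM
  have i0 := integrable_mul_bounded isDefect_zero hi hψ hM
  have mF := measurable_firstKernel hb hf hg hψ
  have md := hD.measurable_dilate
  have mk := hD.measurable_kick
  have mS : Measurable fun a : V3 × (V3 × S2) => (a.1, (dilate D 1 a.2, kick D a.2)) := by fun_prop
  have change := integral_eq_of_lintegral_eq (μ := tripleMeasure)
    (T := fun a : V3 × (V3 × S2) => (a.1, (a.2.1, um a.2.1 a.2.2)))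
    (J := fun a => dilateJac D ‖a.2.1‖ (cosV a.2.1 a.2.2)) mS
    (hD.measurable_dilateJac_pair.comp measurable_snd)
    (ae_of_all _ fun a => hD.dilateJac_nonneg _ _ (norm_nonneg _))
    (fun F hF => hD.lintegral_triple_dilate hF) mF (by simp only [firstKernel_um]; exact i0)
  obtain ⟨i2, e2⟩ := change
  simp only [firstKernel_um] at e2
  rw [← e2, ← integral_sub i1 i2]
  refine (enorm_integral_le_lintegral_enorm _).trans ?_
  have hgrad := hgG.ae_triple_sub_le hg hG (X := fun p => -p.1) (d := fun p => p.1 - dilate D 1 p)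
    (by fun_prop) (by fun_prop)
  have hnn : ∀ᵐ a ∂tripleMeasure, a.2.1 ≠ (0 : V3) :=
    (Measure.quasiMeasurePreserving_fst.comp Measure.quasiMeasurePreserving_snd).ae
      (compl_mem_ae_iff.2 (measure_singleton (0 : V3)))
  set I : V3 × (V3 × S2) → ℝ≥0∞ := fun a => ∫⁻ l in Icc (0 : ℝ) 1, ‖G (a.1 - dilate D l a.2)‖ₑ with hI
  have mI : Measurable I := by
    have : Measurable fun q : (V3 × (V3 × S2)) × ℝ => ‖G (q.1.1 - dilate D q.2 q.1.2)‖ₑ :=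
      (hG.comp (measurable_fst.fst.sub hD.measurable_path)).enorm
    exact this.lintegral_prod_right'
  have hp : 0 ≤ 2 + γ := by linarith
  have hKA : 0 ≤ (4 + K) * A := mul_nonneg (by linarith [hD.const_nonneg]) hA
  have mgr := measurable_growth (2 + γ)
  have mgr' : Measurable fun a : V3 × (V3 × S2) => growth (2 + γ) a.2.1 := mgr.comp measurable_snd.fst
  have mψ : Measurable fun a : V3 × (V3 × S2) => ‖ψ (a.1 - kick D a.2)‖ₑ :=
    (hψ.comp (by fun_prop)).enorm
  have mf : Measurable fun a : V3 × (V3 × S2) => ‖f a.1‖ₑ := (hf.comp measurable_fst).enorm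
  calc _ ≤ ∫⁻ a, ENNReal.ofReal B * (ENNReal.ofReal ((4 + K) * A) *
        (growth (2 + γ) a.2.1 * (‖f a.1‖ₑ * I a * ‖ψ (a.1 - kick D a.2)‖ₑ) +
          growth (2 + γ) a.2.1 * (‖f a.1‖ₑ * ‖g (a.1 - dilate D 1 a.2)‖ₑ *
            ‖ψ (a.1 - kick D a.2)‖ₑ))) ∂tripleMeasure := by
        refine lintegral_mono_ae ?_
        filter_upwards [hgrad, hnn, ae_triple_cosV_mem] with a h1 h2 h3
        have hρ : 0 < ‖a.2.1‖ := norm_pos_iff.2 h2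
        set s := cosV a.2.1 a.2.2 with hs
        set ρ := ‖a.2.1‖ with hρdef
        have hDn := hD.nonneg (sinHalf s * ρ)
        have hr : D (sinHalf s * ρ) ≤ A * ρ ^ γ := by
          refine (hDA _ (mul_nonneg (sinHalf_nonneg s) hρ.le)).trans ?_
          have : sinHalf s * ρ ≤ ρ := mul_le_of_le_one_left hρ.le (sinHalf_le_one h3)
          exact mul_le_mul_of_nonneg_left (Real.rpow_le_rpow
            (mul_nonneg (sinHalf_nonneg s) hρ.le) this hγ.le) hA
        have hdn : ‖a.2.1 - dilate D 1 a.2‖ = ρ * D (sinHalf s * ρ) := by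
          rw [dilate_eq, sub_sub_cancel, norm_smul, one_mul, Real.norm_of_nonneg hDn, mul_comm]
        have h1' : ‖g (a.1 - dilate D 1 a.2) - g (a.1 - a.2.1)‖ₑ ≤
            ENNReal.ofReal (ρ * D (sinHalf s * ρ)) * I a := by
          rw [← hdn, ofReal_norm, hI]
          have e1 : a.1 + -a.2.1 + (a.2.1 - dilate D 1 a.2) = a.1 - dilate D 1 a.2 := by abel
          have e2 : ∀ l : ℝ, a.1 + -a.2.1 + l • (a.2.1 - dilate D 1 a.2) = a.1 - dilate D l a.2 := by
            intro l
            rw [dilate_path D l]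
            abel
          beta_reduce at h1
          rw [e1] at h1
          simp only [e2] at h1
          rw [← sub_eq_add_neg] at h1
          exact h1
        have main := enorm_difference_le (f := f a.1) (ψ := ψ (a.1 - kick D a.2))
          (j := dilateJac D ρ s * (1 - D (sinHalf s * ρ))) (hB s) hρ.le h1'
        rw [hD.firstKernel_dilate, collisionDensity_tripleCoord, ← hs, ← hρdef]
        have e3 : f a.1 * g (a.1 - a.2.1) * ρ * b s * ψ (a.1 - kick D a.2) -
            dilateJac D ρ s * (f a.1 * g (a.1 - dilate D 1 a.2) * ((1 - D (sinHalf s * ρ)) * ρ) *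
              b s * ψ (a.1 - kick D a.2)) =
            f a.1 * b s * ψ (a.1 - kick D a.2) * (ρ * g (a.1 - a.2.1) -
              dilateJac D ρ s * (1 - D (sinHalf s * ρ)) * ρ * g (a.1 - dilate D 1 a.2)) := by ring
        rw [e3]
        refine main.trans (mul_le_mul_right ?_ _)
        rw [mul_add, ← mul_assoc (ENNReal.ofReal ((4 + K) * A)),
          ← mul_assoc (ENNReal.ofReal ((4 + K) * A)), growth, ← ENNReal.ofReal_mul hKA]
        obtain ⟨g1, g2⟩ := growth_bound hA hγ hρ.le hr
        have hpow : 0 ≤ A * (1 + ρ) ^ (2 + γ) := by positivity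
        have hK := hD.const_nonneg
        refine add_le_add (mul_le_mul_left (ENNReal.ofReal_le_ofReal ?_) _)
          (mul_le_mul_left (ENNReal.ofReal_le_ofReal ?_) _)
        · nlinarith
        · calc ρ * |1 - dilateJac D ρ s * (1 - D (sinHalf s * ρ))| ≤
                ρ * ((4 + K) * D (sinHalf s * ρ)) :=
                mul_le_mul_of_nonneg_left (hD.abs_one_sub_dilateJac_le hρ h3) hρ.le
            _ = (4 + K) * (ρ * D (sinHalf s * ρ)) := by ring
            _ ≤ (4 + K) * (A * (1 + ρ) ^ (2 + γ)) := mul_le_mul_of_nonneg_left g1 (by linarith)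
            _ = _ := by ring
    _ = ENNReal.ofReal B * (ENNReal.ofReal ((4 + K) * A) *
        (∫⁻ a, growth (2 + γ) a.2.1 * (‖f a.1‖ₑ * I a * ‖ψ (a.1 - kick D a.2)‖ₑ) ∂tripleMeasure +
          ∫⁻ a, growth (2 + γ) a.2.1 * (‖f a.1‖ₑ * ‖g (a.1 - dilate D 1 a.2)‖ₑ *
            ‖ψ (a.1 - kick D a.2)‖ₑ) ∂tripleMeasure)) := by
        rw [lintegral_const_mul' _ _ ENNReal.ofReal_ne_top,
          lintegral_const_mul' _ _ ENNReal.ofReal_ne_top, lintegral_add_left]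
        exact mgr'.mul ((mf.mul mI).mul mψ)
    _ ≤ ENNReal.ofReal B * (ENNReal.ofReal ((4 + K) * A) *
        (weightConst (2 + γ) q * (32 * angularConst) *
          weightNorm 1 (q + (2 + γ)) (fun v => ‖f v‖ₑ) * weightNorm 2 (q + (2 + γ)) (fun v => ‖G v‖ₑ) *
          weightNorm 2 (-q) (fun v => ‖ψ v‖ₑ) +
        weightConst (2 + γ) q * (32 * angularConst) *
          weightNorm 1 (q + (2 + γ)) (fun v => ‖f v‖ₑ) * weightNorm 2 (q + (2 + γ)) (fun v => ‖g v‖ₑ) *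
          weightNorm 2 (-q) (fun v => ‖ψ v‖ₑ))) := by
        gcongr
        · exact hD.weighted_one_path hp hq hf.enorm hG.enorm hψ.enorm
        · exact hD.weighted_one ⟨zero_le_one, le_rfl⟩ hp hq hf.enorm hg.enorm hψ.enorm
    _ = _ := by
        rw [gradNorm]
        ring

/-! ### Comparison of the weak forms: gradient on the first argument -/

theorem twist_zero (l : ℝ) (a : V3 × S2) : twist (fun _ => 0) l a = a.1 := by
  simp [twist, combD, comb, coef, up_add_um]

theorem sub_kick (D : ℝ → ℝ) (a : V3 × S2) : a.1 - kick D a = recoil D a := by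
  nth_rewrite 1 [← up_add_um a.1 a.2]
  simp only [kick, recoil, combD, comb, coef]
  module

theorem twist_sub (D : ℝ → ℝ) (l : ℝ) (a : V3 × S2) :
    twist D l a - a.1 = combD D (fun _ => 0) (fun s => -(l * tanSq s)) (fun _ => 0) (fun _ => l) a := by
  nth_rewrite 1 [← up_add_um a.1 a.2]
  simp only [twist, combD, comb, coef]
  module

theorem twist_path (D : ℝ → ℝ) (l : ℝ) (a : V3 × S2) :
    twist D l a = a.1 + l • (twist D 1 a - a.1) := by
  rw [← sub_eq_iff_eq_add', twist_sub, twist_sub]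
  simp only [combD, comb, coef]
  module

theorem norm_twist_sub_sq (D : ℝ → ℝ) {a : V3 × S2} (ha : cosV a.1 a.2 ∈ Ioo (-1 : ℝ) 1) :
    ‖twist D 1 a - a.1‖ ^ 2 =
      (‖a.1‖ * (√(tanSq (cosV a.1 a.2)) * D (sinHalf (cosV a.1 a.2) * ‖a.1‖))) ^ 2 := by
  rw [twist_sub, combD, norm_comb_sq, coef, coef, mul_pow, mul_pow, Real.sq_sqrt (tanSq_nonneg ha)]
  set d := D (sinHalf (cosV a.1 a.2) * ‖a.1‖)
  linear_combination (‖a.1‖ ^ 2 * d ^ 2 * (tanSq (cosV a.1 a.2) - 1) / 2) * tanSq_mul ha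

theorem norm_twistKick_sq (D : ℝ → ℝ) {a : V3 × S2} (ha : cosV a.1 a.2 ∈ Ioo (-1 : ℝ) 1) :
    ‖twistKick D 1 a‖ ^ 2 = ‖twist D 1 a‖ ^ 2 * ((1 - cosV a.1 a.2) / 2) := by
  rw [IsDefect.norm_twist_sq 1 ha, twistKick, combD, norm_comb_sq, coef, coef]
  set d := D (sinHalf (cosV a.1 a.2) * ‖a.1‖)
  linear_combination (‖a.1‖ ^ 2 * d ^ 2 * tanSq (cosV a.1 a.2) / 2) * tanSq_mul ha

theorem sqrt_tanSq_le {s : ℝ} (hs : s ∈ Ioo (-1 : ℝ) 1) : √(tanSq s) ≤ 1 / cosHalf s := by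
  have hc := cosHalf_pos hs
  refine Real.sqrt_le_iff.2 ⟨by positivity, ?_⟩
  rw [div_pow, cosHalf_sq hs, tanSq, div_le_div_iff₀ (by linarith [hs.1]) (by linarith [hs.1])]
  nlinarith [hs.1, hs.2]

namespace IsDefect

variable {K : ℝ} {D : ℝ → ℝ}

theorem measurable_twist_path (hD : IsDefect K D) :
    Measurable fun q : (V3 × (V3 × S2)) × ℝ => twist D q.2 q.1.2 := by
  have h : (fun q : (V3 × (V3 × S2)) × ℝ => twist D q.2 q.1.2) =
      fun q => q.1.2.1 + q.2 • (twist D 1 q.1.2 - q.1.2.1) := funext fun q => twist_path D q.2 q.1.2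
  rw [h]
  have := hD.measurable_twist
  fun_prop

theorem measurable_secHalf_triple :
    Measurable fun a : V3 × (V3 × S2) => secHalf (cosV a.2.1 a.2.2) :=
  measurable_secHalf.comp (measurable_cosV_pair.comp measurable_snd)

/-- Averaging the weighted estimate over the twisted path. -/
theorem weighted_two_path (hD : IsDefect K D) {p q : ℝ} (hp : 0 ≤ p) (hq : 0 ≤ q)
    {F H Ψ : V3 → ℝ≥0∞} (hF : Measurable F) (hH : Measurable H) (hΨ : Measurable Ψ) :
    ∫⁻ a, secHalf (cosV a.2.1 a.2.2) * (growth p a.2.1 *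
      (F a.1 * (∫⁻ l in Icc (0 : ℝ) 1, H (a.1 + twist D l a.2)) * Ψ (a.1 + recoil D a.2)))
      ∂tripleMeasure ≤ weightConst p q * (32 * angularConst) * weightNorm (4 / 3) (q + p) F *
        weightNorm (4 / 3) (q + p) H * weightNorm 2 (-q) Ψ := by
  have mk := hD.measurable_recoil
  have mg := measurable_growth p
  have m1 : Measurable fun q : (V3 × (V3 × S2)) × ℝ => H (q.1.1 + twist D q.2 q.1.2) :=
    hH.comp (measurable_fst.fst.add hD.measurable_twist_path)
  have m2 : Measurable fun q : (V3 × (V3 × S2)) × ℝ => secHalf (cosV q.1.2.1 q.1.2.2) *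
      (growth p q.1.2.1 * (F q.1.1 * H (q.1.1 + twist D q.2 q.1.2) * Ψ (q.1.1 + recoil D q.1.2))) := by
    have h1 : Measurable fun q : (V3 × (V3 × S2)) × ℝ => Ψ (q.1.1 + recoil D q.1.2) :=
      hΨ.comp (by fun_prop)
    exact (measurable_secHalf_triple.comp measurable_fst).mul
      ((mg.comp (by fun_prop)).mul (((hF.comp (by fun_prop)).mul m1).mul h1))
  calc _ = ∫⁻ a, (∫⁻ l in Icc (0 : ℝ) 1, secHalf (cosV a.2.1 a.2.2) * (growth p a.2.1 *
        (F a.1 * H (a.1 + twist D l a.2) * Ψ (a.1 + recoil D a.2)))) ∂tripleMeasure := by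
        refine lintegral_congr fun a => ?_
        have m3 : Measurable fun l => H (a.1 + twist D l a.2) := m1.comp measurable_prodMk_left
        rw [lintegral_const_mul _ (((m3.const_mul _).mul_const _).const_mul _),
          lintegral_const_mul _ ((m3.const_mul _).mul_const _),
          lintegral_mul_const _ (m3.const_mul _), lintegral_const_mul _ m3]
    _ = ∫⁻ l, (∫⁻ a, secHalf (cosV a.2.1 a.2.2) * (growth p a.2.1 *
        (F a.1 * H (a.1 + twist D l a.2) * Ψ (a.1 + recoil D a.2))) ∂tripleMeasure) ∂unitMeasure :=
        lintegral_lintegral_swap m2.aemeasurable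
    _ ≤ ∫⁻ l in Icc (0 : ℝ) 1, weightConst p q * (32 * angularConst) *
        weightNorm (4 / 3) (q + p) F * weightNorm (4 / 3) (q + p) H * weightNorm 2 (-q) Ψ :=
        setLIntegral_mono measurable_const fun l hl => hD.weighted_two hl hp hq hF hH hΨ
    _ = _ := by simp

theorem twistJac_nonneg (hD : IsDefect K D) {ρ s : ℝ} (hρ : 0 < ρ) (hs : s ∈ Ioo (-1 : ℝ) 1) :
    0 ≤ twistJac D ρ s := by
  have hr : 0 < sinHalf s * ρ := mul_pos (sinHalf_pos hs) hρ
  have h1 := hD.nonneg (sinHalf s * ρ)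
  have h2 := mul_nonneg hr.le (hD.deriv_nonneg _ hr)
  have h3 := tanSq_nonneg hs
  unfold twistJac
  positivity

/-- The Jacobian blows up with tan(θ/2), so an error bound by D alone is impossible. With z =
tan(θ/2)D the product is P = (1 + z²)(1 + z² + y), where 0 ≤ y ≤ K z², and P - 1 ≤ (2 + K)zP.
Keeping P on the right allows the change of variables to be undone. -/
theorem abs_one_sub_twistJac_le (hD : IsDefect K D) {ρ s : ℝ} (hρ : 0 < ρ)
    (hs : s ∈ Ioo (-1 : ℝ) 1) :
    |1 - twistJac D ρ s * √(1 + tanSq s * D (sinHalf s * ρ) ^ 2)| ≤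
      (2 + K) * (twistJac D ρ s * √(1 + tanSq s * D (sinHalf s * ρ) ^ 2)) *
        (√(tanSq s) * D (sinHalf s * ρ)) := by
  have hr : 0 < sinHalf s * ρ := mul_pos (sinHalf_pos hs) hρ
  unfold twistJac
  set r := sinHalf s * ρ
  have hK := hD.const_nonneg
  have h1 := hD.nonneg r
  have h2 := mul_nonneg hr.le (hD.deriv_nonneg r hr)
  have h3 := hD.deriv_le r hr
  have hT := Real.sq_sqrt (tanSq_nonneg hs)
  have hτ := Real.sqrt_nonneg (tanSq s)
  set τ := √(tanSq s)
  set x := D r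
  set w := r * deriv D r
  have hκ : √(1 + tanSq s * x ^ 2) * (1 + tanSq s * x * (x + w)) * √(1 + tanSq s * x ^ 2) =
      (1 + (τ * x) ^ 2) * (1 + τ ^ 2 * x * (x + w)) := by
    rw [mul_right_comm, Real.mul_self_sqrt (by nlinarith [sq_nonneg τ, sq_nonneg x, sq_nonneg (τ * x)]),
      ← hT]
    ring
  rw [hκ]
  have hz : 0 ≤ τ * x := mul_nonneg hτ h1
  set z := τ * x with hzdef
  have hy : τ ^ 2 * x * (x + w) = z ^ 2 + τ ^ 2 * x * w := by rw [hzdef]; ring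
  have hy0 : 0 ≤ τ ^ 2 * x * w := by positivity
  have hy1 : τ ^ 2 * x * w ≤ K * z ^ 2 := by
    calc τ ^ 2 * x * w ≤ τ ^ 2 * x * (K * x) := mul_le_mul_of_nonneg_left h3 (by positivity)
      _ = _ := by rw [hzdef]; ring
  rw [hy]
  set y := τ ^ 2 * x * w
  have hP : (1 + z ^ 2) ^ 2 ≤ (1 + z ^ 2) * (1 + (z ^ 2 + y)) := by nlinarith [sq_nonneg z]
  have hP1 : 1 ≤ (1 + z ^ 2) * (1 + (z ^ 2 + y)) := by nlinarith [sq_nonneg z]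
  have hz1 : z ≤ 1 + z ^ 2 := by nlinarith [sq_nonneg (z - 1)]
  set P := (1 + z ^ 2) * (1 + (z ^ 2 + y)) with hPdef
  rw [abs_sub_comm, abs_of_nonneg (by linarith)]
  have hs0 : 0 ≤ z ^ 2 := sq_nonneg z
  have hzP : z ≤ P := by nlinarith
  have a1 : z ^ 2 ≤ z * P := by nlinarith
  have a2 : (1 + z ^ 2) * z ≤ P := by nlinarith
  have a3 : (1 + z ^ 2) * (z ^ 2 + y) ≤ (1 + K) * z * P := by
    calc (1 + z ^ 2) * (z ^ 2 + y) ≤ (1 + z ^ 2) * (z ^ 2 + K * z ^ 2) := by gcongr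
      _ = (1 + K) * z * ((1 + z ^ 2) * z) := by ring
      _ ≤ _ := mul_le_mul_of_nonneg_left a2 (by positivity)
  calc P - 1 = z ^ 2 + (1 + z ^ 2) * (z ^ 2 + y) := by rw [hPdef]; ring
    _ ≤ z * P + (1 + K) * z * P := add_le_add a1 a3
    _ = _ := by ring

end IsDefect

/-- The collision integrand in terms of `v_*`, `u` and `u⁻`. -/
def secondKernel (b : ℝ → ℝ) (f g ψ : V3 → ℝ) (x : V3 × (V3 × V3)) : ℝ :=
  f x.1 * g (x.1 + x.2.1) * ‖x.2.1‖ * b (1 - 2 * (‖x.2.2‖ ^ 2 / ‖x.2.1‖ ^ 2)) *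
    ψ (x.1 + (x.2.1 - x.2.2))

theorem measurable_secondKernel {b : ℝ → ℝ} {f g ψ : V3 → ℝ} (hb : Measurable b) (hf : Measurable f)
    (hg : Measurable g) (hψ : Measurable ψ) : Measurable (secondKernel b f g ψ) := by
  have h1 : Measurable fun x : V3 × (V3 × V3) => b (1 - 2 * (‖x.2.2‖ ^ 2 / ‖x.2.1‖ ^ 2)) :=
    hb.comp (by fun_prop)
  have h2 : Measurable fun x : V3 × (V3 × V3) => g (x.1 + x.2.1) := hg.comp (by fun_prop)
  have h3 : Measurable fun x : V3 × (V3 × V3) => ψ (x.1 + (x.2.1 - x.2.2)) := hψ.comp (by fun_prop)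
  exact ((((hf.comp measurable_fst).mul h2).mul (by fun_prop)).mul h1).mul h3

theorem cosV_eq_of_um {a : V3 × S2} (ha : a.1 ≠ 0) :
    1 - 2 * (‖um a.1 a.2‖ ^ 2 / ‖a.1‖ ^ 2) = cosV a.1 a.2 := by
  have := norm_ne_zero_iff.2 ha
  rw [norm_um_sq]
  field_simp
  ring

theorem cosV_eq_of_twist (D : ℝ → ℝ) {a : V3 × S2} (h0 : a.1 ≠ 0)
    (ha : cosV a.1 a.2 ∈ Ioo (-1 : ℝ) 1) :
    1 - 2 * (‖twistKick D 1 a‖ ^ 2 / ‖twist D 1 a‖ ^ 2) = cosV a.1 a.2 := by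
  have := (norm_pos_iff.2 h0).trans_le (IsDefect.le_norm_twist (D := D) 1 ha)
  rw [norm_twistKick_sq D ha]
  field_simp
  ring

theorem um_eq_sub_recoil (a : V3 × S2) : a.1 - um a.1 a.2 = recoil (fun _ => 0) a := by
  rw [← kick_zero, sub_kick]

/-- The collision integrand after the translation `v = v_* + u`. -/
def shiftedDensity (b : ℝ → ℝ) (f g : V3 → ℝ) (a : V3 × (V3 × S2)) : ℝ :=
  f a.1 * g (a.1 + a.2.1) * ‖a.2.1‖ * b (cosV a.2.1 a.2.2)

theorem measurePreserving_translate :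
    MeasurePreserving (fun a : V3 × (V3 × S2) => (a.1 + a.2.1, a.2)) tripleMeasure tripleMeasure := by
  have h1 : MeasurePreserving (fun q : (V3 × S2) × V3 => (q.1, q.2 + q.1.1))
      (pairMeasure.prod volume) (pairMeasure.prod (volume : Measure V3)) := by
    refine (MeasurePreserving.id pairMeasure).skew_product (g := fun p x => x + p.1)
      (by fun_prop) (ae_of_all _ fun p => ?_)
    exact (measurePreserving_add_right volume p.1).map_eq
  exact (Measure.measurePreserving_swap.comp h1).comp
    (Measure.measurePreserving_swap (μ := (volume : Measure V3)) (ν := pairMeasure))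

/-- With v_* as base point, g is evaluated at v_* + u and ψ at v_* + u⁺ + D u⁻; u can then be
deformed while f stays fixed. -/
theorem integral_translate {b D : ℝ → ℝ} {f g ψ : V3 → ℝ}
    (hi : Integrable (fun a => collisionDensity b g f (tripleCoord a) * ψ (a.1 - kick D a.2))
      tripleMeasure) :
    Integrable (fun a => shiftedDensity b f g a * ψ (a.1 + recoil D a.2)) tripleMeasure ∧
    ∫ a, collisionDensity b g f (tripleCoord a) * ψ (a.1 - kick D a.2) ∂tripleMeasure =
      ∫ a, shiftedDensity b f g a * ψ (a.1 + recoil D a.2) ∂tripleMeasure := by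
  have e : ∀ a : V3 × (V3 × S2), collisionDensity b g f (tripleCoord (a.1 + a.2.1, a.2)) *
      ψ (a.1 + a.2.1 - kick D a.2) = shiftedDensity b f g a * ψ (a.1 + recoil D a.2) := by
    intro a
    have h : a.1 + a.2.1 - kick D a.2 = a.1 + recoil D a.2 := by rw [add_sub_assoc, sub_kick]
    rw [collisionDensity_tripleCoord, h, shiftedDensity]
    simp only [add_sub_cancel_right]
    ring
  have h := measurePreserving_translate.integrable_comp_of_integrable hi
  refine ⟨h.congr (ae_of_all _ e), ?_⟩
  nth_rewrite 1 [← measurePreserving_translate.map_eq]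
  rw [integral_map measurePreserving_translate.measurable.aemeasurable
    (by rw [measurePreserving_translate.map_eq]; exact hi.1)]
  exact integral_congr_ae (ae_of_all _ e)

theorem secondKernel_um (b : ℝ → ℝ) (f g ψ : V3 → ℝ) (a : V3 × (V3 × S2)) :
    secondKernel b f g ψ (a.1, (a.2.1, um a.2.1 a.2.2)) =
      shiftedDensity b f g a * ψ (a.1 + recoil (fun _ => 0) a.2) := by
  rw [secondKernel, shiftedDensity]
  by_cases hu : a.2.1 = 0
  · simp [hu]
  · simp only [cosV_eq_of_um hu, um_eq_sub_recoil]

theorem secondKernel_twist (D b : ℝ → ℝ) (f g ψ : V3 → ℝ) {a : V3 × (V3 × S2)} (h0 : a.2.1 ≠ 0)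
    (ha : cosV a.2.1 a.2.2 ∈ Ioo (-1 : ℝ) 1) :
    secondKernel b f g ψ (a.1, (twist D 1 a.2, twistKick D 1 a.2)) =
      f a.1 * g (a.1 + twist D 1 a.2) * ‖twist D 1 a.2‖ * b (cosV a.2.1 a.2.2) *
        ψ (a.1 + recoil D a.2) := by
  simp only [secondKernel, cosV_eq_of_twist D h0 ha, twist_sub_twistKick]

/-- The majorant of the error from the Jacobian, as a function of `v_*`, `u` and `u⁻`. -/
def errorKernel (D : ℝ → ℝ) (F H Ψ : V3 → ℝ≥0∞) (x : V3 × (V3 × V3)) : ℝ≥0∞ :=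
  ENNReal.ofReal (‖x.2.1‖ * (√(tanSq (1 - 2 * (‖x.2.2‖ ^ 2 / ‖x.2.1‖ ^ 2))) *
    D (sinHalf (1 - 2 * (‖x.2.2‖ ^ 2 / ‖x.2.1‖ ^ 2)) * ‖x.2.1‖))) *
  (F x.1 * H (x.1 + x.2.1) * Ψ (x.1 + (x.2.1 - x.2.2)))

theorem measurable_errorKernel {D : ℝ → ℝ} {F H Ψ : V3 → ℝ≥0∞} (hD : Measurable D)
    (hF : Measurable F) (hH : Measurable H) (hΨ : Measurable Ψ) :
    Measurable (errorKernel D F H Ψ) := by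
  have h0 : Measurable fun x : V3 × (V3 × V3) => 1 - 2 * (‖x.2.2‖ ^ 2 / ‖x.2.1‖ ^ 2) := by fun_prop
  have hn : Measurable fun x : V3 × (V3 × V3) => ‖x.2.1‖ := by fun_prop
  have h2 : Measurable fun x : V3 × (V3 × V3) => H (x.1 + x.2.1) := hH.comp (by fun_prop)
  have h3 : Measurable fun x : V3 × (V3 × V3) => Ψ (x.1 + (x.2.1 - x.2.2)) := hΨ.comp (by fun_prop)
  exact (hn.mul ((measurable_tanSq.comp h0).sqrt.mul
    (hD.comp ((measurable_sinHalf.comp h0).mul hn)))).ennreal_ofReal.mul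
    (((hF.comp measurable_fst).mul h2).mul h3)

theorem defect_speed_le {A γ ρ s : ℝ} {D : ℝ → ℝ} (hA : 0 ≤ A)
    (hDA : ∀ r, 0 ≤ r → D r ≤ A * r ^ γ) (hγ : 0 < γ) (hρ : 0 ≤ ρ)
    (hs : s ∈ Ioo (-1 : ℝ) 1) : D (sinHalf s * ρ) ≤ A * ρ ^ γ := by
  refine (hDA _ (mul_nonneg (sinHalf_nonneg s) hρ)).trans ?_
  have : sinHalf s * ρ ≤ ρ := mul_le_of_le_one_left hρ (sinHalf_le_one hs)
  exact mul_le_mul_of_nonneg_left (Real.rpow_le_rpow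
    (mul_nonneg (sinHalf_nonneg s) hρ) this hγ.le) hA

/-- The majorant is integrated in undeformed variables, so the trilinear estimate is used for zero
defect, where twist and recoil reduce to u and u⁺. The factor tan(θ/2) is at most 1/cos(θ/2). -/
theorem IsDefect.lintegral_errorKernel_le {K A γ q : ℝ} {D : ℝ → ℝ} (hD : IsDefect K D)
    (hA : 0 ≤ A) (hDA : ∀ r, 0 ≤ r → D r ≤ A * r ^ γ) (hγ : 0 < γ) (hq : 0 ≤ q)
    {F H Ψ : V3 → ℝ≥0∞} (hF : Measurable F) (hH : Measurable H) (hΨ : Measurable Ψ) :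
    ∫⁻ a, errorKernel D F H Ψ (a.1, (a.2.1, um a.2.1 a.2.2)) ∂tripleMeasure ≤
      ENNReal.ofReal A * (weightConst (2 + γ) q * (32 * angularConst) *
        weightNorm (4 / 3) (q + (2 + γ)) F * weightNorm (4 / 3) (q + (2 + γ)) H *
        weightNorm 2 (-q) Ψ) := by
  have key := isDefect_zero.weighted_two (l := 0) ⟨le_rfl, zero_le_one⟩
    (by linarith : 0 ≤ 2 + γ) hq hF hH hΨ
  refine le_trans ?_ (mul_le_mul_right key _)
  rw [← lintegral_const_mul' _ _ ENNReal.ofReal_ne_top]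
  refine lintegral_mono_ae ?_
  have hnn : ∀ᵐ a ∂tripleMeasure, a.2.1 ≠ (0 : V3) :=
    (Measure.quasiMeasurePreserving_fst.comp Measure.quasiMeasurePreserving_snd).ae
      (compl_mem_ae_iff.2 (measure_singleton (0 : V3)))
  filter_upwards [hnn, ae_triple_cosV_mem] with a h0 ha
  have hu : 1 - 2 * (‖um a.2.1 a.2.2‖ ^ 2 / ‖a.2.1‖ ^ 2) = cosV a.2.1 a.2.2 :=
    cosV_eq_of_um (a := a.2) h0
  have hr := um_eq_sub_recoil a.2
  simp only [errorKernel, hu, hr, twist_zero]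
  rw [← mul_assoc (secHalf _), ← mul_assoc (ENNReal.ofReal A)]
  refine mul_le_mul_left ?_ _
  have hc := cosHalf_pos ha
  rw [secHalf, growth, ← ENNReal.ofReal_mul (by positivity), ← ENNReal.ofReal_mul hA]
  refine ENNReal.ofReal_le_ofReal ?_
  have g1 := (growth_bound hA hγ (norm_nonneg a.2.1)
    (defect_speed_le hA hDA hγ (norm_nonneg a.2.1) ha)).1
  set s := cosV a.2.1 a.2.2
  set ρ := ‖a.2.1‖
  have hDn := hD.nonneg (sinHalf s * ρ)
  have hρ : 0 ≤ ρ := norm_nonneg _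
  calc ρ * (√(tanSq s) * D (sinHalf s * ρ)) = √(tanSq s) * (ρ * D (sinHalf s * ρ)) := by ring
    _ ≤ 1 / cosHalf s * (A * (1 + ρ) ^ (2 + γ)) :=
        mul_le_mul (sqrt_tanSq_le ha) g1 (mul_nonneg hρ hDn) (by positivity)
    _ = _ := by ring

/-- The elastic integral is pulled back by the twist. The increment of g is integrated over the path
`twist D l`, with the singular factor 1/cos(θ/2). The Jacobian error retains the Jacobian, so
`lintegral_triple_twist` returns it to the undeformed variables, where `lintegral_errorKernel_le`
bounds it. -/
theorem IsDefect.compare_two {K A B γ q M : ℝ} {D b : ℝ → ℝ} {f g ψ : V3 → ℝ} {G : V3 → V3}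
    (hD : IsDefect K D) (hA : 0 ≤ A) (hDA : ∀ r, 0 ≤ r → D r ≤ A * r ^ γ) (hγ : 0 < γ) (hq : 0 ≤ q)
    (hb : Measurable b) (hB : ∀ s, |b s| ≤ B) (hf : Measurable f) (hg : Measurable g)
    (hG : Measurable G) (hgG : HasWeakGradient g G)
    (hi : Integrable (collisionDensity b g f) collisionMeasure)
    (hψ : Measurable ψ) (hM : ∀ v, |ψ v| ≤ M) :
    ‖(∫ a, collisionDensity b g f (tripleCoord a) * ψ (a.1 - kick D a.2) ∂tripleMeasure) -
      ∫ a, collisionDensity b g f (tripleCoord a) * ψ (a.1 - kick (fun _ => 0) a.2)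
        ∂tripleMeasure‖ₑ ≤
      ENNReal.ofReal B * (ENNReal.ofReal ((2 + K) * A) * (weightConst (2 + γ) q *
        (32 * angularConst) * weightNorm (4 / 3) (q + (2 + γ)) (fun v => ‖f v‖ₑ) *
        gradNorm (4 / 3) (q + (2 + γ)) g G * weightNorm 2 (-q) fun v => ‖ψ v‖ₑ)) := by
  obtain ⟨i1, e1⟩ := integral_translate (integrable_mul_bounded hD hi hψ hM)
  obtain ⟨i0, e0⟩ := integral_translate (integrable_mul_bounded isDefect_zero hi hψ hM)
  rw [e1, e0]
  have mF := measurable_secondKernel hb hf hg hψ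
  have md := hD.measurable_twist
  have mk := hD.measurable_twistKick
  have mr := hD.measurable_recoil
  have mS : Measurable fun a : V3 × (V3 × S2) => (a.1, (twist D 1 a.2, twistKick D 1 a.2)) := by
    fun_prop
  have hnn : ∀ᵐ a ∂tripleMeasure, a.2.1 ≠ (0 : V3) :=
    (Measure.quasiMeasurePreserving_fst.comp Measure.quasiMeasurePreserving_snd).ae
      (compl_mem_ae_iff.2 (measure_singleton (0 : V3)))
  have mJ : Measurable fun a : V3 × (V3 × S2) => twistJac D ‖a.2.1‖ (cosV a.2.1 a.2.2) :=
    hD.measurable_twistJac_pair.comp measurable_snd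
  obtain ⟨i2, e2⟩ := integral_eq_of_lintegral_eq (μ := tripleMeasure)
    (T := fun a : V3 × (V3 × S2) => (a.1, (a.2.1, um a.2.1 a.2.2)))
    (J := fun a => twistJac D ‖a.2.1‖ (cosV a.2.1 a.2.2)) mS mJ
    (by
      filter_upwards [hnn, ae_triple_cosV_mem] with a h0 ha
      exact hD.twistJac_nonneg (norm_pos_iff.2 h0) ha)
    (fun F hF => hD.lintegral_triple_twist hF) mF (by simp only [secondKernel_um]; exact i0)
  simp only [secondKernel_um] at e2
  rw [← e2, ← integral_sub i1 i2]
  refine (enorm_integral_le_lintegral_enorm _).trans ?_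
  have hgrad := hgG.ae_triple_sub_le hg hG (X := fun p => p.1) (d := fun p => twist D 1 p - p.1)
    (by fun_prop) (by fun_prop)
  set I : V3 × (V3 × S2) → ℝ≥0∞ := fun a => ∫⁻ l in Icc (0 : ℝ) 1, ‖G (a.1 + twist D l a.2)‖ₑ with hI
  have mI : Measurable I := by
    have : Measurable fun q : (V3 × (V3 × S2)) × ℝ => ‖G (q.1.1 + twist D q.2 q.1.2)‖ₑ :=
      (hG.comp (measurable_fst.fst.add hD.measurable_twist_path)).enorm
    exact this.lintegral_prod_right'
  have hp : 0 ≤ 2 + γ := by linarith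
  have hK := hD.const_nonneg
  have mgr' : Measurable fun a : V3 × (V3 × S2) => growth (2 + γ) a.2.1 :=
    (measurable_growth (2 + γ)).comp measurable_snd.fst
  have mψ : Measurable fun a : V3 × (V3 × S2) => ‖ψ (a.1 + recoil D a.2)‖ₑ :=
    (hψ.comp (by fun_prop)).enorm
  have mf : Measurable fun a : V3 × (V3 × S2) => ‖f a.1‖ₑ := (hf.comp measurable_fst).enorm
  set E := errorKernel D (fun v => ‖f v‖ₑ) (fun v => ‖g v‖ₑ) (fun v => ‖ψ v‖ₑ) with hE
  have mE : Measurable E := measurable_errorKernel hD.measurable hf.enorm hg.enorm hψ.enorm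
  calc _ ≤ ∫⁻ a, ENNReal.ofReal B * (ENNReal.ofReal A * (secHalf (cosV a.2.1 a.2.2) *
        (growth (2 + γ) a.2.1 * (‖f a.1‖ₑ * I a * ‖ψ (a.1 + recoil D a.2)‖ₑ))) +
          ENNReal.ofReal (2 + K) * (ENNReal.ofReal (twistJac D ‖a.2.1‖ (cosV a.2.1 a.2.2)) *
            E (a.1, (twist D 1 a.2, twistKick D 1 a.2)))) ∂tripleMeasure := by
        refine lintegral_mono_ae ?_
        filter_upwards [hgrad, hnn, ae_triple_cosV_mem] with a h1 h2 h3
        rw [secondKernel_twist D b f g ψ h2 h3, shiftedDensity]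
        have hs' := cosV_eq_of_twist D (a := a.2) h2 h3
        have hJ := hD.twistJac_nonneg (norm_pos_iff.2 h2) h3
        have hjac := hD.abs_one_sub_twistJac_le (norm_pos_iff.2 h2) h3
        have hspeed := (growth_bound hA hγ (norm_nonneg a.2.1)
          (defect_speed_le hA hDA hγ (norm_nonneg a.2.1) h3)).2
        have htw : ‖twist D 1 a.2‖ = ‖a.2.1‖ * √(1 + tanSq (cosV a.2.1 a.2.2) *
            D (sinHalf (cosV a.2.1 a.2.2) * ‖a.2.1‖) ^ 2) := by
          have hT := tanSq_nonneg h3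
          rw [← sq_eq_sq₀ (norm_nonneg _) (by positivity), IsDefect.norm_twist_sq 1 h3, one_mul,
            mul_pow, Real.sq_sqrt (by positivity)]
        have hd : ‖twist D 1 a.2 - a.2.1‖ = ‖a.2.1‖ * (√(tanSq (cosV a.2.1 a.2.2)) *
            D (sinHalf (cosV a.2.1 a.2.2) * ‖a.2.1‖)) := by
          rw [← sq_eq_sq₀ (norm_nonneg _) (mul_nonneg (norm_nonneg _)
            (mul_nonneg (Real.sqrt_nonneg _) (hD.nonneg _))), norm_twist_sub_sq D h3]
        -- The error carries D at the speed of `u`, whereas the pulled-back kernel has D at the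
        -- speed of the twisted vector. The twist only lengthens `u`, so monotonicity of D goes in
        -- the right direction.
        have hmono : D (sinHalf (cosV a.2.1 a.2.2) * ‖a.2.1‖) ≤
            D (sinHalf (cosV a.2.1 a.2.2) * ‖twist D 1 a.2‖) := by
          have hle := IsDefect.le_norm_twist (D := D) 1 h3
          have hpos := norm_pos_iff.2 h2
          exact hD.mono (mul_pos (sinHalf_pos h3) hpos)
            (mul_pos (sinHalf_pos h3) (hpos.trans_le hle))
            (mul_le_mul_of_nonneg_left hle (sinHalf_nonneg _))
        have h1' : ‖g (a.1 + twist D 1 a.2) - g (a.1 + a.2.1)‖ₑ ≤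
            ENNReal.ofReal ‖twist D 1 a.2 - a.2.1‖ * I a := by
          have e1 : a.1 + a.2.1 + (twist D 1 a.2 - a.2.1) = a.1 + twist D 1 a.2 := by abel
          have e2 : ∀ l : ℝ, a.1 + a.2.1 + l • (twist D 1 a.2 - a.2.1) = a.1 + twist D l a.2 := by
            intro l
            rw [twist_path D l, add_assoc]
          beta_reduce at h1
          rw [e1] at h1
          simp only [e2] at h1
          rw [ofReal_norm, hI]
          exact h1
        have hEa : E (a.1, (twist D 1 a.2, twistKick D 1 a.2)) =
            ENNReal.ofReal (‖twist D 1 a.2‖ * (√(tanSq (cosV a.2.1 a.2.2)) *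
              D (sinHalf (cosV a.2.1 a.2.2) * ‖twist D 1 a.2‖))) *
            (‖f a.1‖ₑ * ‖g (a.1 + twist D 1 a.2)‖ₑ * ‖ψ (a.1 + recoil D a.2)‖ₑ) := by
          simp only [hE, errorKernel, hs', twist_sub_twistKick]
        rw [hEa]
        have hsec := sqrt_tanSq_le h3
        have hcos := cosHalf_pos h3
        have hDn := hD.nonneg (sinHalf (cosV a.2.1 a.2.2) * ‖a.2.1‖)
        have hρ := norm_nonneg a.2.1
        rw [secHalf, growth]
        set s := cosV a.2.1 a.2.2
        set ρ := ‖a.2.1‖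
        set J := twistJac D ρ s
        set κ := √(1 + tanSq s * D (sinHalf s * ρ) ^ 2)
        have hκ : 0 ≤ κ := Real.sqrt_nonneg _
        have main := enorm_difference_le (f := f a.1) (ψ := ψ (a.1 + recoil D a.2))
          (j := J * κ) (hB s) hρ h1'
        have e3 : f a.1 * g (a.1 + a.2.1) * ρ * b s * ψ (a.1 + recoil D a.2) -
            J * (f a.1 * g (a.1 + twist D 1 a.2) * ‖twist D 1 a.2‖ * b s *
              ψ (a.1 + recoil D a.2)) =
            f a.1 * b s * ψ (a.1 + recoil D a.2) * (ρ * g (a.1 + a.2.1) -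
              J * κ * ρ * g (a.1 + twist D 1 a.2)) := by rw [htw]; ring
        rw [e3]
        refine main.trans (mul_le_mul_right (add_le_add ?_ ?_) _)
        · rw [← mul_assoc (ENNReal.ofReal (1 / cosHalf s)), ← mul_assoc (ENNReal.ofReal A),
            ← ENNReal.ofReal_mul (by positivity), ← ENNReal.ofReal_mul hA]
          refine mul_le_mul_left (ENNReal.ofReal_le_ofReal ?_) _
          rw [hd]
          calc ρ * (ρ * (√(tanSq s) * D (sinHalf s * ρ))) =
                √(tanSq s) * (ρ * (ρ * D (sinHalf s * ρ))) := by ring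
            _ ≤ 1 / cosHalf s * (A * (1 + ρ) ^ (2 + γ)) :=
                mul_le_mul hsec hspeed (by positivity) (by positivity)
            _ = _ := by ring
        · rw [← mul_assoc (ENNReal.ofReal J), ← mul_assoc (ENNReal.ofReal (2 + K)),
            ← ENNReal.ofReal_mul hJ, ← ENNReal.ofReal_mul (by linarith)]
          refine mul_le_mul_left (ENNReal.ofReal_le_ofReal ?_) _
          calc ρ * |1 - J * κ| ≤ ρ * ((2 + K) * (J * κ) * (√(tanSq s) * D (sinHalf s * ρ))) :=
                mul_le_mul_of_nonneg_left hjac hρ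
            _ = (2 + K) * (J * (ρ * κ * (√(tanSq s) * D (sinHalf s * ρ)))) := by ring
            _ ≤ (2 + K) * (J * (ρ * κ * (√(tanSq s) * D (sinHalf s * ‖twist D 1 a.2‖)))) := by
                gcongr
            _ = _ := by rw [← htw]
    _ = ENNReal.ofReal B * (ENNReal.ofReal A * (∫⁻ a, secHalf (cosV a.2.1 a.2.2) *
        (growth (2 + γ) a.2.1 * (‖f a.1‖ₑ * I a * ‖ψ (a.1 + recoil D a.2)‖ₑ)) ∂tripleMeasure) +
        ENNReal.ofReal (2 + K) * ∫⁻ a, E (a.1, (a.2.1, um a.2.1 a.2.2)) ∂tripleMeasure) := by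
        rw [lintegral_const_mul' _ _ ENNReal.ofReal_ne_top, lintegral_add_left,
          lintegral_const_mul' _ _ ENNReal.ofReal_ne_top,
          lintegral_const_mul' _ _ ENNReal.ofReal_ne_top, hD.lintegral_triple_twist mE]
        exact ((measurable_secHalf_triple).mul (mgr'.mul ((mf.mul mI).mul mψ))).const_mul _
    _ ≤ ENNReal.ofReal B * (ENNReal.ofReal ((2 + K) * A) *
        (weightConst (2 + γ) q * (32 * angularConst) *
          weightNorm (4 / 3) (q + (2 + γ)) (fun v => ‖f v‖ₑ) *
          weightNorm (4 / 3) (q + (2 + γ)) (fun v => ‖G v‖ₑ) *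
          weightNorm 2 (-q) (fun v => ‖ψ v‖ₑ)) + ENNReal.ofReal (2 + K) * (ENNReal.ofReal A *
        (weightConst (2 + γ) q * (32 * angularConst) *
          weightNorm (4 / 3) (q + (2 + γ)) (fun v => ‖f v‖ₑ) *
          weightNorm (4 / 3) (q + (2 + γ)) (fun v => ‖g v‖ₑ) *
          weightNorm 2 (-q) (fun v => ‖ψ v‖ₑ)))) := by
        gcongr
        · nlinarith
        · exact hD.weighted_two_path hp hq hf.enorm hG.enorm hψ.enorm
        · exact hD.lintegral_errorKernel_le hA hDA hγ hq hf.enorm hg.enorm hψ.enorm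
    _ = _ := by
        rw [gradNorm, ENNReal.ofReal_mul (by linarith)]
        ring

/-! ### The difference of the gain operators -/

/-- The chosen gains agree almost everywhere with the Radon–Nikodym densities. For those, the weak
form extends to bounded measurable ψ, and duality turns a bound on the difference of weak forms into
the weighted L² bound. -/
theorem gain_difference_le {e D b b₁ : ℝ → ℝ} {K : ℝ} {f g f₁ g₁ : V3 → ℝ} (hD : IsDefect K D)
    (hDe : ∀ r, 0 ≤ r → e r = 1 - 2 * D r)
    (hc : collisionDensity b f g =ᵐ[collisionMeasure] collisionDensity b₁ f₁ g₁)
    (hi : Integrable (collisionDensity b₁ f₁ g₁) collisionMeasure) :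
    IsGain e b f g (gain e b f g) ∧ IsGain elastic b f g (gain elastic b f g) ∧
    ∀ (q : ℝ) (N : ℝ≥0∞), (∀ ψ : V3 → ℝ, Measurable ψ → ∀ M : ℝ, (∀ v, |ψ v| ≤ M) →
      ‖(∫ a, collisionDensity b₁ f₁ g₁ (tripleCoord a) * ψ (a.1 - kick D a.2) ∂tripleMeasure) -
        ∫ a, collisionDensity b₁ f₁ g₁ (tripleCoord a) * ψ (a.1 - kick (fun _ => 0) a.2)
          ∂tripleMeasure‖ₑ ≤ N * weightNorm 2 (-q) fun v => ‖ψ v‖ₑ) →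
      normLpW 2 q (fun v => gain e b f g v - gain elastic b f g v) ≤ N := by
  obtain ⟨Q, hQ, iQ, eQ⟩ := exists_isGain hD.measurable hDe hi
  obtain ⟨R, hR, iR, eR⟩ := exists_isGain (e := elastic) isDefect_zero.measurable
    (by simp [elastic]) hi
  rw [gain_congr hc e, gain_congr hc elastic, isGain_congr hc e, isGain_congr hc elastic]
  refine ⟨hQ.gain, hR.gain, fun q N h => ?_⟩
  have hae : (fun v => ‖gain e b₁ f₁ g₁ v - gain elastic b₁ f₁ g₁ v‖ₑ) =ᵐ[volume]
      fun v => ‖Q v - R v‖ₑ := by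
    filter_upwards [hQ.gain.ae_eq hQ, hR.gain.ae_eq hR] with v h1 h2
    rw [h1, h2]
  rw [normLpW_two_eq, weightNorm_congr hae]
  refine weightNorm_le_of_dual (Q := fun v => Q v - R v) (iQ.sub iR) fun ψ hψ M hM => ?_
  have hM' : ∀ v, ‖ψ v‖ ≤ M := hM
  simp only [sub_mul]
  rw [integral_sub (iQ.mul_bdd (c := M) hψ.aestronglyMeasurable (ae_of_all _ hM'))
    (iR.mul_bdd (c := M) hψ.aestronglyMeasurable (ae_of_all _ hM')), eQ ψ hψ M hM, eR ψ hψ M hM]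
  exact h ψ hψ M hM

/-- The estimate is shown for each weak gradient and then passed to the infimum, so uniqueness of
the gradient plays no part. -/
theorem le_mul_normW12 {x a : ℝ≥0∞} {s : ℝ} {g : V3 → ℝ} (ha : a ≠ ⊤)
    (hne : ∃ G, HasWeakGradient g G)
    (h : ∀ G, HasWeakGradient g G → Measurable G →
      x ≤ a * (weightNorm 2 s (fun v => ‖g v‖ₑ) + weightNorm 2 s fun v => ‖G v‖ₑ)) :
    x ≤ a * normW12 s g := by
  have h' : ∀ G, HasWeakGradient g G →
      x ≤ a * (normLpW 2 s g + eLpNorm (fun v => weight s v • G v) 2 volume) := by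
    intro G hG
    have hm := hG.locallyIntegrable_grad.aestronglyMeasurable
    have key := h _ (hG.congr (ae_eq_refl _) hm.ae_eq_mk) hm.stronglyMeasurable_mk.measurable
    have e1 : weightNorm 2 s (fun v => ‖hm.mk G v‖ₑ) = eLpNorm (fun v => weight s v • G v) 2 volume := by
      have h2 := eLpNorm_eq_weightNorm two_pos s G
      rw [ENNReal.ofReal_ofNat] at h2
      rw [h2]
      refine weightNorm_congr ?_ _ _
      filter_upwards [hm.ae_eq_mk] with v hv
      rw [← hv]
    rwa [e1, ← normLpW_two_eq] at key
  -- Division by `a` is impossible when it vanishes; there an existing gradient is needed to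
  -- conclude x = 0.
  rcases eq_or_ne a 0 with h0 | h0
  · obtain ⟨G, hG⟩ := hne
    have := h' G hG
    rw [h0, zero_mul] at this
    rw [h0, zero_mul]
    exact this
  · rw [← ENNReal.div_le_iff' h0 ha, normW12, ← tsub_le_iff_left]
    refine le_iInf₂ fun G hG => ?_
    rw [tsub_le_iff_left, ENNReal.div_le_iff' h0 ha]
    exact h' G hG

theorem normLpW_congr {p : ℝ≥0∞} {s : ℝ} {f f' : V3 → ℝ} (h : f =ᵐ[volume] f') :
    normLpW p s f = normLpW p s f' :=
  eLpNorm_congr_ae (h.mono fun v hv => by beta_reduce; rw [hv])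

theorem MemLpW.congr {p : ℝ≥0∞} {s : ℝ} {f f' : V3 → ℝ} (hf : MemLpW p s f)
    (h : f =ᵐ[volume] f') : MemLpW p s f' :=
  (memLp_congr_ae (h.mono fun v hv => by rw [hv])).1 hf

theorem gradNorm_two_mono {s t : ℝ} (hst : s ≤ t) (g : V3 → ℝ) (G : V3 → V3) :
    gradNorm 2 s g G ≤ weightNorm 2 t (fun v => ‖g v‖ₑ) + weightNorm 2 t fun v => ‖G v‖ₑ :=
  add_le_add (weightNorm_mono two_pos hst _) (weightNorm_mono two_pos hst _)

/-- The total constant of the two comparison estimates at `ℓ = 1`. -/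
def gainConst (A B K p q : ℝ) : ℝ≥0∞ :=
  ENNReal.ofReal B * ENNReal.ofReal ((4 + K) * A) * (weightConst p q * (32 * angularConst))

theorem gainConst_ne_top (A B K p q : ℝ) : gainConst A B K p q ≠ ⊤ := by
  have := angularConst_lt_top.ne
  unfold gainConst weightConst
  finiteness

theorem IsRestitution.gain_estimate_one {γ A B K ℓ q : ℝ} (hγ : 0 < γ) {e b b₁ : ℝ → ℝ}
    (hℓ : 0 < ℓ) (hD : IsDefect K (defect e ℓ)) (hA : 0 ≤ A)
    (hDA : ∀ r, 0 ≤ r → defect e ℓ r ≤ A * ℓ ^ γ * r ^ γ) (hq : 0 ≤ q) (hb : Measurable b)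
    (hb₁ : Measurable b₁) (hbb : ∀ᵐ s ∂(volume.restrict (Ioo (-1 : ℝ) 1)), b s = b₁ s)
    (hB : ∀ s, |b₁ s| ≤ B) {f g : V3 → ℝ} (hf : MemLpW 1 (q + 3 + γ) f)
    (hg : MemW12 (q + 3 + γ) g) :
    IsGain (rescale ℓ e) b f g (gain (rescale ℓ e) b f g) ∧
    IsGain elastic b f g (gain elastic b f g) ∧
    normLpW 2 q (fun v => gain (rescale ℓ e) b f g v - gain elastic b f g v) ≤
      gainConst A B K (2 + γ) q * ENNReal.ofReal (ℓ ^ γ) * normLpW 1 (q + 3 + γ) f *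
        normW12 (q + 3 + γ) g := by
  obtain ⟨hg2, G₀, hG₀, -⟩ := hg
  have hfm := hf.aestronglyMeasurable
  have hgm := hg2.aestronglyMeasurable
  have mf := hfm.stronglyMeasurable_mk.measurable
  have mg := hgm.stronglyMeasurable_mk.measurable
  have hf' := hf.congr hfm.ae_eq_mk
  have hg' := hg2.congr hgm.ae_eq_mk
  set f₁ := hfm.mk f
  set g₁ := hgm.mk g
  have hi : Integrable (collisionDensity b₁ f₁ g₁) collisionMeasure :=
    integrable_collisionDensity hb₁ hB (hf'.mono (by linarith) mf.aestronglyMeasurable)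
      (memLpW_one_of_two (by linarith) hg' mg)
  obtain ⟨h1, h2, h3⟩ := gain_difference_le (e := rescale ℓ e) hD
    (fun r hr => rescale_eq_defect e ℓ hr)
    (collisionDensity_congr hb hb₁ hbb hfm.ae_eq_mk hgm.ae_eq_mk) hi
  refine ⟨h1, h2, le_mul_normW12 ?_ ⟨G₀, hG₀⟩ fun G hG mG => h3 q _ fun ψ hψ M hM => ?_⟩
  · have := hf.2.ne
    have := gainConst_ne_top A B K (2 + γ) q
    unfold normLpW
    finiteness
  · have hAl : 0 ≤ A * ℓ ^ γ := mul_nonneg hA (Real.rpow_nonneg hℓ.le _)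
    refine (hD.compare_one hAl hDA hγ hq hb₁ hB mf mg mG (hG.congr hgm.ae_eq_mk (ae_eq_refl _)) hi
      hψ hM).trans ?_
    have hgn : weightNorm 2 (q + 3 + γ) (fun v => ‖g v‖ₑ) =
        weightNorm 2 (q + 3 + γ) fun v => ‖g₁ v‖ₑ := by
      rw [← normLpW_two_eq, ← normLpW_two_eq, normLpW_congr hgm.ae_eq_mk]
    rw [hgn, normLpW_congr hfm.ae_eq_mk, normLpW_one_eq, gainConst]
    have hs : q + (2 + γ) ≤ q + 3 + γ := by linarith
    have hK := hD.const_nonneg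
    calc _ ≤ ENNReal.ofReal B * (ENNReal.ofReal ((4 + K) * (A * ℓ ^ γ)) * (weightConst (2 + γ) q *
          (32 * angularConst) * weightNorm 1 (q + 3 + γ) (fun v => ‖f₁ v‖ₑ) *
          (weightNorm 2 (q + 3 + γ) (fun v => ‖g₁ v‖ₑ) + weightNorm 2 (q + 3 + γ) fun v => ‖G v‖ₑ) *
          weightNorm 2 (-q) fun v => ‖ψ v‖ₑ)) := by
          gcongr
          · exact weightNorm_mono one_pos hs _
          · exact gradNorm_two_mono hs _ _
      _ = _ := by
          rw [← mul_assoc (4 + K), ENNReal.ofReal_mul (mul_nonneg (by linarith) hA)]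
          ring

/-- The comparison needs L^(4/3) norms of f and of g with its gradient. Each is traded for a
weighted L² norm by `hemb`, which accounts for the factor `E * E`. -/
theorem IsRestitution.gain_estimate_two {γ A B K ℓ q : ℝ} (hγ : 0 < γ) {e b b₁ : ℝ → ℝ}
    (hℓ : 0 < ℓ) (hD : IsDefect K (defect e ℓ)) (hA : 0 ≤ A)
    (hDA : ∀ r, 0 ≤ r → defect e ℓ r ≤ A * ℓ ^ γ * r ^ γ) (hq : 0 ≤ q) (hb : Measurable b)
    (hb₁ : Measurable b₁) (hbb : ∀ᵐ s ∂(volume.restrict (Ioo (-1 : ℝ) 1)), b s = b₁ s)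
    (hB : ∀ s, |b₁ s| ≤ B) {E : ℝ≥0∞} (hE : E ≠ ⊤)
    (hemb : ∀ h : V3 → ℝ≥0∞, Measurable h →
      weightNorm (4 / 3) (q + (2 + γ)) h ≤ E * weightNorm 2 (q + 3 + γ) h)
    {f g : V3 → ℝ} (hf : MemLpW 2 (q + 3 + γ) f) (hg : MemW12 (q + 3 + γ) g) :
    IsGain (rescale ℓ e) b g f (gain (rescale ℓ e) b g f) ∧
    IsGain elastic b g f (gain elastic b g f) ∧
    normLpW 2 q (fun v => gain (rescale ℓ e) b g f v - gain elastic b g f v) ≤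
      gainConst A B K (2 + γ) q * (E * E) * ENNReal.ofReal (ℓ ^ γ) * normLpW 2 (q + 3 + γ) f *
        normW12 (q + 3 + γ) g := by
  obtain ⟨hg2, G₀, hG₀, -⟩ := hg
  have hfm := hf.aestronglyMeasurable
  have hgm := hg2.aestronglyMeasurable
  have mf := hfm.stronglyMeasurable_mk.measurable
  have mg := hgm.stronglyMeasurable_mk.measurable
  have hf' := hf.congr hfm.ae_eq_mk
  have hg' := hg2.congr hgm.ae_eq_mk
  set f₁ := hfm.mk f
  set g₁ := hgm.mk g
  have hi : Integrable (collisionDensity b₁ g₁ f₁) collisionMeasure :=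
    integrable_collisionDensity hb₁ hB (memLpW_one_of_two (by linarith) hg' mg)
      (memLpW_one_of_two (by linarith) hf' mf)
  obtain ⟨h1, h2, h3⟩ := gain_difference_le (e := rescale ℓ e) hD
    (fun r hr => rescale_eq_defect e ℓ hr)
    (collisionDensity_congr hb hb₁ hbb hgm.ae_eq_mk hfm.ae_eq_mk) hi
  refine ⟨h1, h2, le_mul_normW12 ?_ ⟨G₀, hG₀⟩ fun G hG mG => h3 q _ fun ψ hψ M hM => ?_⟩
  · have := hf.2.ne
    have := gainConst_ne_top A B K (2 + γ) q
    unfold normLpW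
    finiteness
  · have hAl : 0 ≤ A * ℓ ^ γ := mul_nonneg hA (Real.rpow_nonneg hℓ.le _)
    refine (hD.compare_two hAl hDA hγ hq hb₁ hB mf mg mG (hG.congr hgm.ae_eq_mk (ae_eq_refl _)) hi
      hψ hM).trans ?_
    have hgn : weightNorm 2 (q + 3 + γ) (fun v => ‖g v‖ₑ) =
        weightNorm 2 (q + 3 + γ) fun v => ‖g₁ v‖ₑ := by
      rw [← normLpW_two_eq, ← normLpW_two_eq, normLpW_congr hgm.ae_eq_mk]
    rw [hgn, normLpW_congr hfm.ae_eq_mk, normLpW_two_eq, gainConst]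
    have hK := hD.const_nonneg
    calc _ ≤ ENNReal.ofReal B * (ENNReal.ofReal ((4 + K) * (A * ℓ ^ γ)) * (weightConst (2 + γ) q *
          (32 * angularConst) * (E * weightNorm 2 (q + 3 + γ) (fun v => ‖f₁ v‖ₑ)) *
          (E * weightNorm 2 (q + 3 + γ) (fun v => ‖g₁ v‖ₑ) +
            E * weightNorm 2 (q + 3 + γ) fun v => ‖G v‖ₑ) *
          weightNorm 2 (-q) fun v => ‖ψ v‖ₑ)) := by
          gcongr
          · norm_num
          · exact hemb _ mf.enorm
          · exact add_le_add (hemb _ mg.enorm) (hemb _ mG.enorm)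
      _ = _ := by
          rw [← mul_assoc (4 + K), ENNReal.ofReal_mul (mul_nonneg (by linarith) hA)]
          ring

end Granular

end

/-! ### Choice of a constant uniform in ℓ. -/

theorem proposition2p6 (γ : ℝ) (hγ : 0 < γ) (e b : ℝ → ℝ)
    (he : Granular.IsRestitution γ e) (hb : Granular.IsAngularKernel b) (q : ℝ) (hq : 0 ≤ q) :
    ∃ C : ℝ, 0 < C ∧ ∀ ℓ : ℝ, 0 < ℓ →
      (∀ f g : Granular.V3 → ℝ,
        Granular.MemLpW 1 (q + 3 + γ) f → Granular.MemW12 (q + 3 + γ) g →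
        Granular.IsGain (Granular.rescale ℓ e) b f g
            (Granular.gain (Granular.rescale ℓ e) b f g) ∧
        Granular.IsGain Granular.elastic b f g (Granular.gain Granular.elastic b f g) ∧
        Granular.normLpW 2 q (fun v =>
            Granular.gain (Granular.rescale ℓ e) b f g v - Granular.gain Granular.elastic b f g v)
          ≤ ENNReal.ofReal (C * ℓ ^ γ) *
            Granular.normLpW 1 (q + 3 + γ) f * Granular.normW12 (q + 3 + γ) g) ∧
      (∀ f g : Granular.V3 → ℝ,
        Granular.MemLpW 2 (q + 3 + γ) f → Granular.MemW12 (q + 3 + γ) g →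
        Granular.IsGain (Granular.rescale ℓ e) b g f
            (Granular.gain (Granular.rescale ℓ e) b g f) ∧
        Granular.IsGain Granular.elastic b g f (Granular.gain Granular.elastic b g f) ∧
        Granular.normLpW 2 q (fun v =>
            Granular.gain (Granular.rescale ℓ e) b g f v - Granular.gain Granular.elastic b g f v)
          ≤ ENNReal.ofReal (C * ℓ ^ γ) *
            Granular.normLpW 2 (q + 3 + γ) f * Granular.normW12 (q + 3 + γ) g) := by
  obtain ⟨K, hK⟩ := he.isDefect
  obtain ⟨A, hA, hDA⟩ := he.defect_le hγ
  obtain ⟨b₁, B, hb₁, -, hB, hbb⟩ := hb.exists_bounded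
  -- Since 3/4 = 1/2 + 1/4, Hölder leaves the exponent r = 4; the weight gap -1 becomes -4 < -3,
  -- integrable on ℝ³. This is the use of the third power in q + 3 + γ.
  obtain ⟨E, hE, hemb⟩ := Granular.exists_embedding (p := 4 / 3) (r := 4) (s := q + (2 + γ))
    (t := q + 3 + γ) (by norm_num) (by norm_num) (by norm_num) (by linarith)
  set X := Granular.gainConst A B K (2 + γ) q * (1 + E * E) with hX
  have hXt : X ≠ ⊤ := by
    have := Granular.gainConst_ne_top A B K (2 + γ) q
    rw [hX]
    finiteness
  have hX1 : Granular.gainConst A B K (2 + γ) q ≤ X := le_mul_of_one_le_right' le_self_add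
  have hX2 : Granular.gainConst A B K (2 + γ) q * (E * E) ≤ X := mul_le_mul_right le_add_self _
  -- Adding 1 only ensures strict positivity of the constant.
  refine ⟨X.toReal + 1, by positivity, fun ℓ hℓ => ?_⟩
  have hC : X * ENNReal.ofReal (ℓ ^ γ) ≤ ENNReal.ofReal ((X.toReal + 1) * ℓ ^ γ) := by
    rw [ENNReal.ofReal_mul (by positivity)]
    refine mul_le_mul_left ?_ _
    rw [ENNReal.le_ofReal_iff_toReal_le hXt (by positivity)]
    linarith
  refine ⟨fun f g hf hg => ?_, fun f g hf hg => ?_⟩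
  · obtain ⟨h1, h2, h3⟩ := Granular.IsRestitution.gain_estimate_one hγ hℓ (hK ℓ hℓ) hA.le
      (hDA ℓ hℓ) hq hb.measurable hb₁ hbb hB hf hg
    refine ⟨h1, h2, h3.trans ?_⟩
    gcongr
    exact (mul_le_mul_left hX1 _).trans hC
  · obtain ⟨h1, h2, h3⟩ := Granular.IsRestitution.gain_estimate_two hγ hℓ (hK ℓ hℓ) hA.le
      (hDA ℓ hℓ) hq hb.measurable hb₁ hbb hB hE hemb hf hg
    refine ⟨h1, h2, h3.trans ?_⟩
    gcongr
    exact (mul_le_mul_left hX2 _).trans hC
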